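/- **Setting.** For $\varepsilon>0$ let $\Omega_\varepsilon=\{x\in\mathbb R^2:\ |x_2|\le\varepsilon\}$, and let $f_\pm\colon\mathbb R\to\mathbb R$ be $C^\infty$ functions. A function $B$ on $\Omega\subset\Omega_\varepsilon$ is *diagonally concave* if it is concave on every segment contained in $\Omega$ that is parallel to $(1,1)$ or $(1,-1)$. It is a *Bellman candidate* on $\Omega$ if it is diagonally concave on $\Omega$, $B(x_1,\pm\varepsilon)=f_\pm(x_1)$ at the points of $\Omega\cap\partial\Omega_\varepsilon$, and for every $y\in\Omega$ either $B$ is linear on some segment in $\Omega$, parallel to $(1,1)$ or $(1,-1)$, that connects $y$ with a point of $\partial\Omega_\varepsilon$ (for $y\in\partial\Omega_\varepsilon$ the segment may be the single point $y$), or $B$ is linear in both diagonal directions in a neighborhood of $y$. Let $\Omega_{\rm R}(u_1,u_2)=\{x\in\Omega_\varepsilon: u_1\le x_1-x_2\le u_2\}$ and $\Omega_{\rm L}(u_1,u_2)=\{x\in\Omega_\varepsilon: u_1\le x_1+x_2\le u_2\}$. The standard candidates on them are $$B_{\rm R}(x)=\tfrac{\varepsilon+x_2}{2\varepsilon}f_+(x_1-x_2+\varepsilon)+\tfrac{\varepsilon-x_2}{2\varepsilon}f_-(x_1-x_2-\varepsilon),\qquad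 B_{\rm L}(x)=\tfrac{\varepsilon+x_2}{2\varepsilon}f_+(x_1+x_2-\varepsilon)+\tfrac{\varepsilon-x_2}{2\varepsilon}f_-(x_1+x_2+\varepsilon).$$ A *spine* over $[a,b]$, $a<b$, is the graph of a $C^1$ function $T$ on $[a,b]$ with $|T|<\varepsilon$ on $(a,b)$ and $|T'|\le1$, where $|T'|<1$ except at finitely many points. In a *left* (*right*) herringbone two ribs start from each spine point $(u,T(u))$: the upper one ends at $(u+T-\varepsilon,\varepsilon)$ (at $(u-T+\varepsilon,\varepsilon)$), the lower one at $(u-T-\varepsilon,-\varepsilon)$ (at $(u+T+\varepsilon,-\varepsilon)$), where $T=T(u)$. The region of the herringbone is the union of its ribs. The associated function $B$ equals $A(u)$ at $(u,T(u))$, equals $f_\pm$ at the end of the upper/lower rib, and is linear on each rib, i.e. $$B(x)=\tfrac{\varepsilon-x_2}{\varepsilon-T}A+\tfrac{x_2-T}{\varepsilon-T}f_+\ \ (x_2\ge T),\qquad B(x)=\tfrac{\varepsilon+x_2}{\varepsilon+T}A+\tfrac{T-x_2}{\varepsilon+T}f_-\ \ (x_2\le T),$$ where $$A=A_{\rm L}=\tfrac{\varepsilon^2-T^2}{2\varepsilon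 T}\big[(\varepsilon+T)f_+'-(\varepsilon-T)f_-'\big]+\tfrac{(\varepsilon+T)f_++(\varepsilon-T)f_-}{2\varepsilon},\qquad f_\pm=f_\pm(u\pm T-\varepsilon),$$ for a left herringbone and $$A=A_{\rm R}=\tfrac{\varepsilon^2-T^2}{2\varepsilon T}\big[(\varepsilon-T)f_-'-(\varepsilon+T)f_+'\big]+\tfrac{(\varepsilon+T)f_++(\varepsilon-T)f_-}{2\varepsilon},\qquad f_\pm=f_\pm(u\mp T+\varepsilon),$$ for a right one. At a point where $T(u)=0$ the value of $A$ is the limit value, that is, with $f_\pm$ and derivatives taken at $u-\varepsilon$ for $A_{\rm L}$ and at $u+\varepsilon$ for $A_{\rm R}$, $$A_{\rm L}=\tfrac12\big(f_++f_-+\varepsilon(f_+'+f_-')+\varepsilon^2(f_+''+f_-'')\big)+\tfrac{\varepsilon^2}{2T'(u)}(f_+''-f_-''),$$ $$A_{\rm R}=\tfrac12\big(f_++f_--\varepsilon(f_+'+f_-')+\varepsilon^2(f_+''+f_-'')\big)-\tfrac{\varepsilon^2}{2T'(u)}(f_+''-f_-'').$$ **Statement.** Let $u_0\in\mathbb R$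 with $f_+'(u_0)=f_-'(u_0)$. 1. **(SE-fissure)** Let $f_+''(u_0)>f_-''(u_0)$ and $f_+'''(u_0)<0$. Then for all sufficiently small $\varepsilon>0$ the equation $f_+'(u-\varepsilon)-f_-'(u+\varepsilon)+2\varepsilon f_+''(u-\varepsilon)=0$ has a unique root $u_+$ in $(u_0-2\varepsilon,u_0)$, and there are $v_->u_0+\varepsilon$ and a spine $T$ of a right herringbone over $[u_+-\varepsilon,v_--\varepsilon]$ with $T(u_0-\varepsilon)=0$, $T(u_+-\varepsilon)=\varepsilon$, $T(v_--\varepsilon)=-\varepsilon$, such that the associated function (with $A=A_{\rm R}$) is a Bellman candidate on the region $\Omega_{\rm SE}(u_+,v_-)$ of the herringbone; moreover, for some $\delta=\delta(\varepsilon)>0$, $B_{\rm L}$ on $\Omega_{\rm L}(u_+-\delta,u_+)$ and $B_{\rm R}$ on $\Omega_{\rm R}(v_-,v_-+\delta)$ are Bellman candidates and together with this function form a $C^1$-smooth Bellman candidate on the union of the three regions. 2. **(NW-fissure)** Let $f_+''(u_0)<f_-''(u_0)$ and $f_-'''(u_0)>0$. Then for all sufficiently small $\varepsilon>0$ the equation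 $f_-'(u+\varepsilon)-f_+'(u-\varepsilon)-2\varepsilon f_-''(u+\varepsilon)=0$ has a unique root $u_-$ in $(u_0,u_0+2\varepsilon)$, and there are $v_+<u_0-\varepsilon$ and a spine $T$ of a left herringbone over $[v_++\varepsilon,u_-+\varepsilon]$ with $T(u_0+\varepsilon)=0$, $T(u_-+\varepsilon)=-\varepsilon$, $T(v_++\varepsilon)=\varepsilon$, such that the associated function (with $A=A_{\rm L}$) is a Bellman candidate on the region $\Omega_{\rm NW}(v_+,u_-)$ of the herringbone; moreover, for some $\delta=\delta(\varepsilon)>0$, $B_{\rm L}$ on $\Omega_{\rm L}(u_-,u_-+\delta)$ and $B_{\rm R}$ on $\Omega_{\rm R}(v_+-\delta,v_+)$ are Bellman candidates and together with this function form a $C^1$-smooth Bellman candidate on the union of the three regions. 3. **(NE-fissure)** Let $f_+''(u_0)<f_-''(u_0)$ and $f_-'''(u_0)<0$. Then for all sufficiently small $\varepsilon>0$ the equation $f_-'(u-\varepsilon)-f_+'(u+\varepsilon)+2\varepsilon f_-''(u-\varepsilon)=0$ has a unique root $u_-$ in $(u_0-2\varepsilon,u_0)$, and there are $v_+>u_0+\varepsilon$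 and a spine $T$ of a right herringbone over $[u_--\varepsilon,v_+-\varepsilon]$ with $T(u_0-\varepsilon)=0$, $T(u_--\varepsilon)=-\varepsilon$, $T(v_+-\varepsilon)=\varepsilon$, such that the associated function (with $A=A_{\rm R}$) is a Bellman candidate on the region $\Omega_{\rm NE}(u_-,v_+)$ of the herringbone; moreover, for some $\delta=\delta(\varepsilon)>0$, $B_{\rm L}$ on $\Omega_{\rm L}(v_+,v_++\delta)$ and $B_{\rm R}$ on $\Omega_{\rm R}(u_--\delta,u_-)$ are Bellman candidates and together with this function form a $C^1$-smooth Bellman candidate on the union of the three regions. -/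

import Mathlib

open Set Topology
open scoped ContDiff

namespace DiagonalStrip

noncomputable section

/-! Points of the plane are pairs `x = (x.1, x.2)`; `fp`, `fm` are the boundary values on the
upper and on the lower side of the strip. -/

/-- The horizontal strip of half-width `ε`. -/
def strip (ε : ℝ) : Set (ℝ × ℝ) := {x | -ε ≤ x.2 ∧ x.2 ≤ ε}

/-- The two boundary lines of the strip. -/
def stripBoundary (ε : ℝ) : Set (ℝ × ℝ) := {x | x.2 = -ε ∨ x.2 = ε}

/-- The segment from `x` to `y` is parallel to `(1, 1)` or to `(1, -1)`. -/
def IsDiagonal (x y : ℝ × ℝ) : Prop :=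
  y.1 - x.1 = y.2 - x.2 ∨ y.1 - x.1 = -(y.2 - x.2)

/-- `B` is concave on every diagonal segment contained in `Ω`. -/
def DiagonallyConcaveOn (Ω : Set (ℝ × ℝ)) (B : ℝ × ℝ → ℝ) : Prop :=
  ∀ x y : ℝ × ℝ, IsDiagonal x y → segment ℝ x y ⊆ Ω → ConcaveOn ℝ (segment ℝ x y) B

/-- `B` is linear (affine) on the segment from `x` to `y`. -/
def LinearOnSegment (B : ℝ × ℝ → ℝ) (x y : ℝ × ℝ) : Prop :=
  ∀ t ∈ Icc (0 : ℝ) 1, B ((1 - t) • x + t • y) = (1 - t) * B x + t * B y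

/-- Bellman candidates on a subdomain `Ω` of the strip. In `extremal`, for a point `y` on the
boundary of the strip the segment may degenerate to `y`; for all other `y` it cannot. -/
structure IsBellmanCandidate (fp fm : ℝ → ℝ) (ε : ℝ) (Ω : Set (ℝ × ℝ)) (B : ℝ × ℝ → ℝ) :
    Prop where
  subset_strip : Ω ⊆ strip ε
  concave : DiagonallyConcaveOn Ω B
  upper_boundary : ∀ t : ℝ, (t, ε) ∈ Ω → B (t, ε) = fp t
  lower_boundary : ∀ t : ℝ, (t, -ε) ∈ Ω → B (t, -ε) = fm t
  extremal : ∀ y ∈ Ω,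
    (∃ z ∈ stripBoundary ε, IsDiagonal y z ∧ segment ℝ y z ⊆ Ω ∧ LinearOnSegment B y z) ∨
    (∃ U ∈ 𝓝 y, ∀ x z : ℝ × ℝ, IsDiagonal x z → segment ℝ x z ⊆ U ∩ Ω → LinearOnSegment B x z)

/-- The region foliated by the right extremal segments `x₁ - x₂ = u`, `u₁ ≤ u ≤ u₂`. -/
def rightRegion (ε u₁ u₂ : ℝ) : Set (ℝ × ℝ) :=
  {x | x ∈ strip ε ∧ u₁ ≤ x.1 - x.2 ∧ x.1 - x.2 ≤ u₂}

/-- The region foliated by the left extremal segments `x₁ + x₂ = u`, `u₁ ≤ u ≤ u₂`. -/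
def leftRegion (ε u₁ u₂ : ℝ) : Set (ℝ × ℝ) :=
  {x | x ∈ strip ε ∧ u₁ ≤ x.1 + x.2 ∧ x.1 + x.2 ≤ u₂}

/-- The standard candidate of the simple right foliation. -/
def rightStandard (fp fm : ℝ → ℝ) (ε : ℝ) (x : ℝ × ℝ) : ℝ :=
  (ε + x.2) / (2 * ε) * fp (x.1 - x.2 + ε) + (ε - x.2) / (2 * ε) * fm (x.1 - x.2 - ε)

/-- The standard candidate of the simple left foliation. -/
def leftStandard (fp fm : ℝ → ℝ) (ε : ℝ) (x : ℝ × ℝ) : ℝ :=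
  (ε + x.2) / (2 * ε) * fp (x.1 + x.2 - ε) + (ε - x.2) / (2 * ε) * fm (x.1 + x.2 + ε)

/-- The graph of `T` over `[a, b]` is the spine of a horizontal herringbone in the strip: `T` is
`C¹` on `[a, b]`, takes values in `(-ε, ε)` on `(a, b)`, and `|T'| ≤ 1` with strict inequality
except at finitely many points. -/
structure IsSpine (ε : ℝ) (T : ℝ → ℝ) (a b : ℝ) : Prop where
  lt : a < b
  contDiffOn : ContDiffOn ℝ 1 T (Icc a b)
  mem_strip : ∀ u ∈ Ioo a b, -ε < T u ∧ T u < ε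
  slope_le : ∀ u ∈ Icc a b, |derivWithin T (Icc a b) u| ≤ 1
  slope_lt : {u | u ∈ Icc a b ∧ |derivWithin T (Icc a b) u| = 1}.Finite

/-- The union of the ribs of a left herringbone: from the spine point `(u, T u)` the upper rib
goes to `(u + T u - ε, ε)` and the lower rib goes to `(u - T u - ε, -ε)`. -/
def leftHerringboneRegion (ε : ℝ) (T : ℝ → ℝ) (a b : ℝ) : Set (ℝ × ℝ) :=
  {x | ∃ u ∈ Icc a b,
    (x.1 + x.2 = u + T u ∧ T u ≤ x.2 ∧ x.2 ≤ ε) ∨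
    (x.1 - x.2 = u - T u ∧ -ε ≤ x.2 ∧ x.2 ≤ T u)}

/-- The union of the ribs of a right herringbone: from the spine point `(u, T u)` the upper rib
goes to `(u - T u + ε, ε)` and the lower rib goes to `(u + T u + ε, -ε)`. -/
def rightHerringboneRegion (ε : ℝ) (T : ℝ → ℝ) (a b : ℝ) : Set (ℝ × ℝ) :=
  {x | ∃ u ∈ Icc a b,
    (x.1 - x.2 = u - T u ∧ T u ≤ x.2 ∧ x.2 ≤ ε) ∨
    (x.1 + x.2 = u + T u ∧ -ε ≤ x.2 ∧ x.2 ≤ T u)}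

/-- The function `A` on the spine of a left herringbone. Where `T u = 0` the general expression is
undefined, and `A` has there the limit value (expressed through the slope of the spine). -/
def leftSpineValue (fp fm : ℝ → ℝ) (ε : ℝ) (T : ℝ → ℝ) (u : ℝ) : ℝ :=
  if T u = 0 then
    (fp (u - ε) + fm (u - ε) + ε * (deriv fp (u - ε) + deriv fm (u - ε))
        + ε ^ 2 * (iteratedDeriv 2 fp (u - ε) + iteratedDeriv 2 fm (u - ε))) / 2
      + ε ^ 2 / (2 * deriv T u) * (iteratedDeriv 2 fp (u - ε) - iteratedDeriv 2 fm (u - ε))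
  else
    (ε ^ 2 - T u ^ 2) / (2 * ε * T u) *
        ((ε + T u) * deriv fp (u + T u - ε) - (ε - T u) * deriv fm (u - T u - ε))
      + ((ε + T u) * fp (u + T u - ε) + (ε - T u) * fm (u - T u - ε)) / (2 * ε)

/-- The function `A` on the spine of a right herringbone, with the limit value where `T u = 0`. -/
def rightSpineValue (fp fm : ℝ → ℝ) (ε : ℝ) (T : ℝ → ℝ) (u : ℝ) : ℝ :=
  if T u = 0 then
    (fp (u + ε) + fm (u + ε) - ε * (deriv fp (u + ε) + deriv fm (u + ε))
        + ε ^ 2 * (iteratedDeriv 2 fp (u + ε) + iteratedDeriv 2 fm (u + ε))) / 2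
      - ε ^ 2 / (2 * deriv T u) * (iteratedDeriv 2 fp (u + ε) - iteratedDeriv 2 fm (u + ε))
  else
    (ε ^ 2 - T u ^ 2) / (2 * ε * T u) *
        ((ε - T u) * deriv fm (u + T u + ε) - (ε + T u) * deriv fp (u - T u + ε))
      + ((ε + T u) * fp (u - T u + ε) + (ε - T u) * fm (u + T u + ε)) / (2 * ε)

/-- `B` is, on the left herringbone with spine `T` over `[a, b]`, equal to `A` on the spine and
to the linear interpolation along every rib between `A` and the boundary value at the end of
the rib. The point at height `s` of an upper (a lower) rib is `(u + T u - s, s)`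
(is `(u - T u + s, s)`). -/
structure IsLeftHerringboneFun (fp fm : ℝ → ℝ) (ε : ℝ) (T A : ℝ → ℝ) (a b : ℝ)
    (B : ℝ × ℝ → ℝ) : Prop where
  spine : ∀ u ∈ Icc a b, B (u, T u) = A u
  upper : ∀ u ∈ Icc a b, ∀ s : ℝ, T u < s → s ≤ ε →
    B (u + T u - s, s) =
      (ε - s) / (ε - T u) * A u + (s - T u) / (ε - T u) * fp (u + T u - ε)
  lower : ∀ u ∈ Icc a b, ∀ s : ℝ, -ε ≤ s → s < T u →
    B (u - T u + s, s) =
      (ε + s) / (ε + T u) * A u + (T u - s) / (ε + T u) * fm (u - T u - ε)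

/-- The same for a right herringbone: the point at height `s` of an upper (a lower) rib is
`(u - T u + s, s)` (is `(u + T u - s, s)`). -/
structure IsRightHerringboneFun (fp fm : ℝ → ℝ) (ε : ℝ) (T A : ℝ → ℝ) (a b : ℝ)
    (B : ℝ × ℝ → ℝ) : Prop where
  spine : ∀ u ∈ Icc a b, B (u, T u) = A u
  upper : ∀ u ∈ Icc a b, ∀ s : ℝ, T u < s → s ≤ ε →
    B (u - T u + s, s) =
      (ε - s) / (ε - T u) * A u + (s - T u) / (ε - T u) * fp (u - T u + ε)
  lower : ∀ u ∈ Icc a b, ∀ s : ℝ, -ε ≤ s → s < T u →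
    B (u + T u - s, s) =
      (ε + s) / (ε + T u) * A u + (T u - s) / (ε + T u) * fm (u + T u + ε)

/-- `B` coincides with the standard candidates on the left foliated region `l₁ ≤ x₁ + x₂ ≤ l₂`
and on the right foliated region `r₁ ≤ x₁ - x₂ ≤ r₂` (which are Bellman candidates there), and is
a `C¹` Bellman candidate on the union of `Ω` with these two regions. -/
structure IsC1Gluing (fp fm : ℝ → ℝ) (ε : ℝ) (Ω : Set (ℝ × ℝ)) (B : ℝ × ℝ → ℝ)
    (l₁ l₂ r₁ r₂ : ℝ) : Prop where
  left_candidate : IsBellmanCandidate fp fm ε (leftRegion ε l₁ l₂) (leftStandard fp fm ε)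
  right_candidate : IsBellmanCandidate fp fm ε (rightRegion ε r₁ r₂) (rightStandard fp fm ε)
  left_eq : EqOn B (leftStandard fp fm ε) (leftRegion ε l₁ l₂)
  right_eq : EqOn B (rightStandard fp fm ε) (rightRegion ε r₁ r₂)
  union_candidate :
    IsBellmanCandidate fp fm ε (Ω ∪ leftRegion ε l₁ l₂ ∪ rightRegion ε r₁ r₂) B
  union_smooth : ContDiffOn ℝ 1 B (Ω ∪ leftRegion ε l₁ l₂ ∪ rightRegion ε r₁ r₂)

/-- `u` is the unique root of `F` in the open interval `(a, b)`. -/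
def IsUniqueRootIn (F : ℝ → ℝ) (a b u : ℝ) : Prop :=
  (u ∈ Ioo a b ∧ F u = 0) ∧ ∀ w ∈ Ioo a b, F w = 0 → w = u

end

end DiagonalStrip

/-! The south-east fissure carries all the analysis. The other two are its images under reflections
of the plane (`stripSymm`): in the horizontal axis for north-east, in the origin for north-west.

Write a = f₊', b = f₋'. The south-east spine descends, so it is parametrized by its height T; the
ribs from height T end at the abscissas p(T) above and p(T) + 2T below. If the mixed derivative κ =
(∂₁₁ − ∂₂₂)B/2 takes one value on both ribs of a spine point, matching ∂₁B across the spine gives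
b(p + 2T) − a(p) = 2Tκ, and compatibility along the spine gives (a'(p) − κ)p' = (ε − T)κ'.
Conversely, these relations (`IsSpineParam`) yield rib slopes for which B is C¹
(`IsSpineParam.exists_ribSlope`). Along a diagonal that crosses ribs, the derivative of B then
varies at the rate κ' times a factor of known sign, so concavity follows from κ' ≥ 0 and the
monotonicity of p and p + 2T (`herringboneFun_concave`). On a simple foliation it follows from one
inequality at each end of the segments.

For the existence of the spine (`exists_spineParam`) put w = 2(κ − a'(p)). Since a'(u₀) ≠ b'(u₀),
the implicit function theorem solves the first relation as p = P(T, w). The second is singular at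
the top T = ε, where w has to vanish. With t = ε − T and w = tχ it reads tχ' = G − 3χ, where G
equals −4a''(u₀) at T = w = 0 whatever χ is. In a thin strip a contraction
(`exists_regular_solution`, `exists_short_solution`) therefore gives a solution that stays near
−4a''(u₀)/3, which is positive because f₊'''(u₀) < 0. Positivity of χ yields the rest: κ' = −χp'/2,
and p' ≤ −2 because w + 2Tχ = (ε + T)χ ≥ 0, which is the slope bound for the spine.

The condition w = 0 at T = ε is the root equation for u₊. Its left-hand side is increasing in a thin
strip, which gives both uniqueness of the root and concavity of the left foliation adjoining the
fissure. -/

namespace DiagonalStrip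

/-! ### Calculus tools: monotone inverses, C¹ gluing, concavity along segments. -/

/-- A strictly decreasing continuous function on a compact interval has a continuous antitone
inverse defined on the whole line, constant beyond the range. -/
lemma exists_clamped_inverse {a b : ℝ} (hab : a ≤ b) {r : ℝ → ℝ} (hr : ContinuousOn r (Icc a b))
    (hanti : StrictAntiOn r (Icc a b)) :
    ∃ σ : ℝ → ℝ, Continuous σ ∧ Antitone σ ∧ (∀ y, σ y ∈ Icc a b) ∧
      (∀ T ∈ Icc a b, σ (r T) = T) ∧ (∀ y ∈ Icc (r b) (r a), r (σ y) = y) ∧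
      (∀ y, r a ≤ y → σ y = a) ∧ (∀ y, y ≤ r b → σ y = b) := by
  -- Prolonging −r with slope 1 beyond [a, b] gives an increasing bijection of the line; the inverse
  -- sought is its inverse followed by the projection to [a, b].
  set R : ℝ → ℝ := fun T => (T - projIcc a b hab T) - r (projIcc a b hab T) with hR
  have hclamp : ∀ T, (projIcc a b hab T : ℝ) = max a (min b T) := fun T => rfl
  have hRc : Continuous R := by
    refine (continuous_id.sub (continuous_subtype_val.comp continuous_projIcc)).sub ?_
    exact hr.comp_continuous (continuous_subtype_val.comp continuous_projIcc)
      (fun T => (projIcc a b hab T).2)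
  have hmono : StrictMono R := by
    intro s t hst
    have h1 : (projIcc a b hab s : ℝ) ≤ projIcc a b hab t := monotone_projIcc hab hst.le
    have hle : s - projIcc a b hab s ≤ t - projIcc a b hab t := by
      rw [hclamp, hclamp]
      rcases le_total b s with h | h <;> rcases le_total b t with h' | h' <;>
        rcases le_total a s with h'' | h'' <;> rcases le_total a t with h''' | h''' <;>
        simp [*] <;> linarith
    simp only [hR]
    rcases h1.lt_or_eq with h | h
    · have := hanti (projIcc a b hab s).2 (projIcc a b hab t).2 h
      linarith
    · rw [h]; linarith
  have hR_in : ∀ T ∈ Icc a b, R T = -r T := by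
    intro T hT
    simp only [hR]
    rw [projIcc_of_mem hab hT]; simp
  have htop : Filter.Tendsto R Filter.atTop Filter.atTop := by
    have : ∀ᶠ T in Filter.atTop, T - b - r b = R T := by
      filter_upwards [Filter.eventually_ge_atTop b] with T hT
      simp only [hR]; rw [projIcc_of_right_le hab hT]
    refine Filter.Tendsto.congr' this ?_
    simp only [sub_eq_add_neg, add_assoc]
    exact Filter.tendsto_atTop_add_const_right _ _ Filter.tendsto_id
  have hbot : Filter.Tendsto R Filter.atBot Filter.atBot := by
    have : ∀ᶠ T in Filter.atBot, T - a - r a = R T := by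
      filter_upwards [Filter.eventually_le_atBot a] with T hT
      simp only [hR]; rw [projIcc_of_le_left hab hT]
    refine Filter.Tendsto.congr' this ?_
    simp only [sub_eq_add_neg, add_assoc]
    exact Filter.tendsto_atBot_add_const_right _ _ Filter.tendsto_id
  have hsurj : Function.Surjective R := hRc.surjective htop hbot
  set e := hmono.orderIsoOfSurjective R hsurj
  have he : ∀ T, e T = R T := fun T => rfl
  refine ⟨fun y => projIcc a b hab (e.symm (-y)), ?_, ?_, fun y => Subtype.coe_prop _,
    ?_, ?_, ?_, ?_⟩
  · exact continuous_subtype_val.comp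
      (continuous_projIcc.comp (e.symm.continuous.comp continuous_neg))
  · intro x y hxy
    exact monotone_projIcc hab (e.symm.monotone (neg_le_neg hxy))
  · intro T hT
    have : e.symm (-r T) = T := by rw [← hR_in T hT, ← he, e.symm_apply_apply]
    simp only [this, projIcc_of_mem hab hT]
  · intro y hy
    have h1 : e.symm (-y) ∈ Icc a b := by
      constructor
      · rw [e.le_symm_apply, he, hR_in a (left_mem_Icc.2 hab)]; linarith [hy.2]
      · rw [e.symm_apply_le, he, hR_in b (right_mem_Icc.2 hab)]; linarith [hy.1]
    have h2 : R (e.symm (-y)) = -y := e.apply_symm_apply _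
    rw [hR_in _ h1] at h2
    simp only [projIcc_of_mem hab h1]
    linarith
  · intro y hy
    have h1 : e.symm (-y) ≤ a := by
      rw [e.symm_apply_le, he, hR_in a (left_mem_Icc.2 hab)]; linarith
    simp only [projIcc_of_le_left hab h1]
  · intro y hy
    have h1 : b ≤ e.symm (-y) := by
      rw [e.le_symm_apply, he, hR_in b (right_mem_Icc.2 hab)]; linarith
    simp only [projIcc_of_right_le hab h1]

/-- A function with vanishing derivative inside a compact interval is constant on it. -/
lemma eq_of_hasDerivAt_zero {a b : ℝ} {f : ℝ → ℝ} (hf : ContinuousOn f (Icc a b))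
    (hf' : ∀ x ∈ Ioo a b, HasDerivAt f 0 x) {x y : ℝ} (hx : x ∈ Icc a b) (hy : y ∈ Icc a b) :
    f x = f y := by
  have h1 : ∀ x ∈ interior (Icc a b),
      HasDerivWithinAt f ((fun _ => 0) x) (interior (Icc a b)) x := by
    rw [interior_Icc]; exact fun x hx => (hf' x hx).hasDerivWithinAt
  have hm := monotoneOn_of_hasDerivWithinAt_nonneg (convex_Icc a b) hf h1 (fun _ _ => le_rfl)
  have ha := antitoneOn_of_hasDerivWithinAt_nonpos (convex_Icc a b) hf h1 (fun _ _ => le_rfl)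
  rcases le_total x y with h | h
  · exact le_antisymm (hm hx hy h) (ha hx hy h)
  · exact le_antisymm (ha hy hx h) (hm hy hx h)

/-- Two `C¹` functions that agree to first order on the common part of two closed sets glue to
a function that is `C¹` on the union. -/
lemma hasFDerivWithinAt_glue {E : Type*} [NormedAddCommGroup E] [NormedSpace ℝ E]
    {F G B : E → ℝ} (hF : ContDiff ℝ 1 F) (hG : ContDiff ℝ 1 G) {s t : Set E} (hs : IsClosed s)
    (ht : IsClosed t) (hBF : EqOn B F s) (hBG : EqOn B G t)
    (hd : ∀ x ∈ s ∩ t, fderiv ℝ F x = fderiv ℝ G x) :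
    ∃ B' : E → E →L[ℝ] ℝ, EqOn B' (fderiv ℝ F) s ∧ EqOn B' (fderiv ℝ G) t ∧
      ContinuousOn B' (s ∪ t) ∧ ∀ x ∈ s ∪ t, HasFDerivWithinAt B (B' x) (s ∪ t) x := by
  classical
  have h1 : EqOn (s.piecewise (fderiv ℝ F) (fderiv ℝ G)) (fderiv ℝ F) s :=
    fun x hx => by simp [hx]
  have h2 : EqOn (s.piecewise (fderiv ℝ F) (fderiv ℝ G)) (fderiv ℝ G) t := by
    intro x hx
    by_cases hxs : x ∈ s
    · simp [hxs, hd x ⟨hxs, hx⟩]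
    · simp [hxs]
  refine ⟨s.piecewise (fderiv ℝ F) (fderiv ℝ G), h1, h2, ?_, ?_⟩
  · exact ContinuousOn.union_of_isClosed
      ((hF.continuous_fderiv one_ne_zero).continuousOn.congr h1)
      ((hG.continuous_fderiv one_ne_zero).continuousOn.congr h2) hs ht
  · intro x hx
    -- Both pieces are closed, so at a point off one of them every linear map is a derivative within
    -- that piece.
    refine HasFDerivWithinAt.union ?_ ?_
    · by_cases hxs : x ∈ s
      · rw [h1 hxs]
        exact ((hF.differentiable one_ne_zero x).hasFDerivAt.hasFDerivWithinAt).congr hBF (hBF hxs)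
      · exact HasFDerivWithinAt.of_notMem_closure (by rwa [hs.closure_eq])
    · by_cases hxt : x ∈ t
      · rw [h2 hxt]
        exact ((hG.differentiable one_ne_zero x).hasFDerivAt.hasFDerivWithinAt).congr hBG (hBG hxt)
      · exact HasFDerivWithinAt.of_notMem_closure (by rwa [ht.closure_eq])

lemma contDiffOn_one_of_hasFDerivWithinAt {E : Type*} [NormedAddCommGroup E] [NormedSpace ℝ E]
    {B : E → ℝ} {B' : E → E →L[ℝ] ℝ} {s : Set E} (hc : ContinuousOn B' s)
    (h : ∀ x ∈ s, HasFDerivWithinAt B (B' x) s x) : ContDiffOn ℝ 1 B s := by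
  have := (contDiffOn_succ_iff_hasFDerivWithinAt (𝕜 := ℝ) (f := B) (s := s) (n := 0) (by simp)).2
    (fun x hx => ⟨s, by rw [insert_eq_of_mem hx]; exact self_mem_nhdsWithin, by simp, B', h,
      contDiffOn_zero.2 hc⟩)
  simpa using this

/-- Concavity on a segment from the antitonicity of the derivative along the segment. -/
lemma concaveOn_segment_of_antitoneOn {B : ℝ × ℝ → ℝ} {B' : ℝ × ℝ → ℝ × ℝ →L[ℝ] ℝ}
    {S : Set (ℝ × ℝ)} (hB : ∀ x ∈ S, HasFDerivWithinAt B (B' x) S x) {x y : ℝ × ℝ}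
    (hxy : segment ℝ x y ⊆ S)
    (hanti : AntitoneOn (fun t : ℝ => B' (x + t • (y - x)) (y - x)) (Icc 0 1)) :
    ConcaveOn ℝ (segment ℝ x y) B := by
  have hseg : ∀ t ∈ Icc (0:ℝ) 1, x + t • (y - x) ∈ segment ℝ x y := by
    intro t ht
    rw [segment_eq_image']
    exact ⟨t, ht, rfl⟩
  have hline : ∀ t, HasDerivAt (fun t : ℝ => x + t • (y - x)) (y - x) t := by
    intro t
    simpa using ((hasDerivAt_id t).smul_const (y - x)).const_add x
  have hφ : ∀ t ∈ Icc (0:ℝ) 1, HasDerivWithinAt (fun t : ℝ => B (x + t • (y - x)))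
      (B' (x + t • (y - x)) (y - x)) (Icc 0 1) t := by
    intro t ht
    exact (hB _ (hxy (hseg t ht))).comp_hasDerivWithinAt t (hline t).hasDerivWithinAt
      (fun s hs => hxy (hseg s hs))
  have hint : ∀ t ∈ Ioo (0:ℝ) 1, HasDerivAt (fun t : ℝ => B (x + t • (y - x)))
      (B' (x + t • (y - x)) (y - x)) t := fun t ht =>
    (hφ t (Ioo_subset_Icc_self ht)).hasDerivAt (Icc_mem_nhds ht.1 ht.2)
  have hconc : ConcaveOn ℝ (Icc (0:ℝ) 1) (fun t : ℝ => B (x + t • (y - x))) := by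
    refine AntitoneOn.concaveOn_of_deriv (convex_Icc 0 1)
      (fun t ht => (hφ t ht).continuousWithinAt) ?_ ?_
    · rw [interior_Icc]
      exact fun t ht => (hint t ht).differentiableAt.differentiableWithinAt
    · rw [interior_Icc]
      intro s hs t ht hst
      rw [(hint s hs).deriv, (hint t ht).deriv]
      exact hanti (Ioo_subset_Icc_self hs) (Ioo_subset_Icc_self ht) hst
  refine ⟨convex_segment x y, ?_⟩
  intro P hP Q hQ α β hα hβ hαβ
  rw [segment_eq_image'] at hP hQ
  obtain ⟨s, hs, rfl⟩ := hP
  obtain ⟨t, ht, rfl⟩ := hQ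
  have := hconc.2 hs ht hα hβ hαβ
  have e : α • (x + s • (y - x)) + β • (x + t • (y - x)) = x + (α • s + β • t) • (y - x) := by
    obtain rfl : β = 1 - α := by linarith
    simp only [smul_eq_mul]
    module
  rw [e]
  exact this

lemma DiagonallyConcaveOn.mono {s t : Set (ℝ × ℝ)} {B : ℝ × ℝ → ℝ} (h : DiagonallyConcaveOn t B)
    (hst : s ⊆ t) : DiagonallyConcaveOn s B :=
  fun x y hd hxy => h x y hd (hxy.trans hst)

lemma DiagonallyConcaveOn.congr {s : Set (ℝ × ℝ)} {B C : ℝ × ℝ → ℝ} (h : DiagonallyConcaveOn s B)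
    (hBC : EqOn B C s) : DiagonallyConcaveOn s C := by
  intro x y hd hxy
  exact (h x y hd hxy).congr (hBC.mono hxy)

end DiagonalStrip

/-! ### The spine parametrized by height, and the slopes of the ribs. -/

namespace DiagonalStrip

/-- The spine of a right herringbone with decreasing spine, parametrized by its height `T`: the
upper rib from the point at height `T` ends at `(p T, ε)`, the lower one at `(p T + 2 T, -ε)`, and
`κ T` is the mixed second derivative `(∂₁₁ - ∂₂₂) B / 2` along both ribs. The functions `a`, `b`
are the derivatives of the boundary values. -/
structure IsSpineParam (a b : ℝ → ℝ) (ε : ℝ) (p κ dp dκ : ℝ → ℝ) : Prop where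
  pos : 0 < ε
  p_cont : ContinuousOn p (Icc (-ε) ε)
  κ_cont : ContinuousOn κ (Icc (-ε) ε)
  dp_cont : ContinuousOn dp (Icc (-ε) ε)
  p_deriv : ∀ T ∈ Ioo (-ε) ε, HasDerivAt p (dp T) T
  κ_deriv : ∀ T ∈ Ioo (-ε) ε, HasDerivAt κ (dκ T) T
  dp_lt : ∀ T ∈ Ioc (-ε) ε, dp T < -2
  dp_le : dp (-ε) ≤ -2
  dκ_nonneg : ∀ T ∈ Ioo (-ε) ε, 0 ≤ dκ T
  ode : ∀ T ∈ Ioo (-ε) ε, (deriv a (p T) - κ T) * dp T = (ε - T) * dκ T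
  rel : ∀ T ∈ Icc (-ε) ε, b (p T + 2 * T) - a (p T) = 2 * T * κ T

namespace IsSpineParam

variable {a b : ℝ → ℝ} {ε : ℝ} {p κ dp dκ : ℝ → ℝ}

lemma neg_le (h : IsSpineParam a b ε p κ dp dκ) : -ε ≤ ε := by linarith [h.pos]

lemma q_cont (h : IsSpineParam a b ε p κ dp dκ) :
    ContinuousOn (fun T => p T + 2 * T) (Icc (-ε) ε) := h.p_cont.add (by fun_prop)

lemma q_deriv (h : IsSpineParam a b ε p κ dp dκ) :
    ∀ T ∈ Ioo (-ε) ε, HasDerivAt (fun T => p T + 2 * T) (dp T + 2) T := by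
  intro T hT
  exact ((h.p_deriv T hT).add ((hasDerivAt_id T).const_mul 2)).congr_deriv (by simp)

lemma p_anti (h : IsSpineParam a b ε p κ dp dκ) : StrictAntiOn p (Icc (-ε) ε) := by
  refine strictAntiOn_of_hasDerivWithinAt_neg (f' := dp) (convex_Icc _ _) h.p_cont ?_ ?_ <;>
    rw [interior_Icc] <;> intro T hT
  · exact (h.p_deriv T hT).hasDerivWithinAt
  · linarith [h.dp_lt T (Ioo_subset_Ioc_self hT)]

lemma q_anti (h : IsSpineParam a b ε p κ dp dκ) :
    StrictAntiOn (fun T => p T + 2 * T) (Icc (-ε) ε) := by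
  refine strictAntiOn_of_hasDerivWithinAt_neg (f' := fun T => dp T + 2) (convex_Icc _ _) h.q_cont
    ?_ ?_ <;> rw [interior_Icc] <;> intro T hT
  · exact (h.q_deriv T hT).hasDerivWithinAt
  · linarith [h.dp_lt T (Ioo_subset_Ioc_self hT)]

/-- The first identity is the derivative of `rel`. Eliminating a'(p) from it by `ode` gives the
mirror equation for the lower ribs, with ε + T in place of ε − T. -/
lemma ode_q (h : IsSpineParam a b ε p κ dp dκ) (ha : Differentiable ℝ a)
    (hb : Differentiable ℝ b) {T : ℝ} (hT : T ∈ Ioo (-ε) ε) :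
    deriv b (p T + 2 * T) * (dp T + 2) - deriv a (p T) * dp T = 2 * κ T + 2 * T * dκ T ∧
    (deriv b (p T + 2 * T) - κ T) * (dp T + 2) = (ε + T) * dκ T := by
  have h1 : HasDerivAt (fun T => b (p T + 2 * T) - a (p T))
      (deriv b (p T + 2 * T) * (dp T + 2) - deriv a (p T) * dp T) T :=
    ((hb _).hasDerivAt.comp T (h.q_deriv T hT)).sub ((ha _).hasDerivAt.comp T (h.p_deriv T hT))
  have h2 : HasDerivAt (fun T => 2 * T * κ T) (2 * κ T + 2 * T * dκ T) T := by
    exact (((hasDerivAt_id T).const_mul 2).mul (h.κ_deriv T hT)).congr_deriv (by simp)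
  have h3 : (fun T => b (p T + 2 * T) - a (p T)) =ᶠ[𝓝 T] fun T => 2 * T * κ T := by
    filter_upwards [Icc_mem_nhds hT.1 hT.2] with S hS using h.rel S hS
  have h4 := (h2.congr_of_eventuallyEq h3).unique h1
  have h5 := h.ode T hT
  exact ⟨h4.symm, by linear_combination -h4 + h5⟩

/-- The differentiated quantity is ∂₁B on the spine. By `ode` only κ times the speed dp + 1 of the
abscissa p + T − ε survives. -/
lemma g_deriv (h : IsSpineParam a b ε p κ dp dκ) (ha : Differentiable ℝ a) {T : ℝ}
    (hT : T ∈ Ioo (-ε) ε) :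
    HasDerivAt (fun T => a (p T) - κ T * (ε - T)) (κ T * (dp T + 1)) T := by
  have h1 := ((ha _).hasDerivAt.comp T (h.p_deriv T hT)).sub
    ((h.κ_deriv T hT).mul ((hasDerivAt_id T).const_sub ε))
  refine h1.congr_deriv ?_
  have h5 := h.ode T hT
  simp only [id]
  linear_combination h5

end IsSpineParam

/-- The derivative of the herringbone function across the ribs, along a diagonal line, is monotone
on the herringbone. -/
lemma cross_derivative_le_of_spine {ε c : ℝ} {F r κ dr dκ τ μ m : ℝ → ℝ}
    (hF : Differentiable ℝ F) (hr : ContinuousOn r (Icc (-ε) ε))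
    (hκ : ContinuousOn κ (Icc (-ε) ε))
    (hdr : ∀ θ ∈ Ioo (-ε) ε, HasDerivAt r (dr θ) θ)
    (hdκ : ∀ θ ∈ Ioo (-ε) ε, HasDerivAt κ (dκ θ) θ)
    (hode : ∀ θ ∈ Ioo (-ε) ε, (deriv F (r θ + ε) - κ θ) * dr θ = (ε - τ θ) * dκ θ)
    (hpos : ∀ θ ∈ Ioo (-ε) ε, 0 ≤ dκ θ)
    (hbar : AntitoneOn (fun θ => r θ + 2 * τ θ) (Icc (-ε) ε))
    (hm : ∀ y, HasDerivAt m (μ y) y) (hμ : ∀ θ ∈ Icc (-ε) ε, μ (r θ) = κ θ)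
    {θ₁ θ₂ : ℝ} (h1 : θ₁ ∈ Icc (-ε) ε) (h2 : θ₂ ∈ Icc (-ε) ε) (h12 : θ₁ ≤ θ₂)
    (hc : r θ₁ + 2 * τ θ₁ ≤ c) :
    2 * F (r θ₁ + ε) - μ (r θ₁) * (2 * ε - (c - r θ₁)) - m (r θ₁) ≤
      2 * F (r θ₂ + ε) - μ (r θ₂) * (2 * ε - (c - r θ₂)) - m (r θ₂) := by
  have hsub : Icc θ₁ θ₂ ⊆ Icc (-ε) ε := Icc_subset_Icc h1.1 h2.2
  have hsub' : Ioo θ₁ θ₂ ⊆ Ioo (-ε) ε := Ioo_subset_Ioo h1.1 h2.2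
  have hmc : Continuous m := continuous_iff_continuousAt.2 fun y => (hm y).continuousAt
  have hFc : Continuous F := hF.continuous
  have hr' := hr.mono hsub
  have hκ' := hκ.mono hsub
  have hmono : MonotoneOn
      (fun θ => 2 * F (r θ + ε) - κ θ * (2 * ε - (c - r θ)) - m (r θ)) (Icc θ₁ θ₂) := by
    -- The equation of the spine collapses the derivative to κ' times c − (r + 2τ). For a point of
    -- the rib this factor is twice its distance in height from the spine.
    refine monotoneOn_of_hasDerivWithinAt_nonneg (convex_Icc _ _)
      (f' := fun θ => dκ θ * (c - (r θ + 2 * τ θ))) ?_ ?_ ?_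
    · fun_prop
    · rw [interior_Icc]
      intro θ hθ
      have hθ' := hsub' hθ
      have e1 := ((hF (r θ + ε)).hasDerivAt.comp θ ((hdr θ hθ').add_const ε)).const_mul 2
      have e2 := (hdκ θ hθ').mul (((hdr θ hθ').const_sub c).const_sub (2 * ε))
      have e3 := (hm (r θ)).comp θ (hdr θ hθ')
      refine (((e1.sub e2).sub e3).congr_deriv ?_).hasDerivWithinAt
      have := hode θ hθ'
      rw [hμ θ (Ioo_subset_Icc_self hθ')]
      linear_combination 2 * this
    · rw [interior_Icc]
      intro θ hθ
      have hb := hbar h1 (hsub (Ioo_subset_Icc_self hθ)) hθ.1.le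
      exact mul_nonneg (hpos θ (hsub' hθ)) (by simp only at hb; linarith)
  rw [hμ _ h1, hμ _ h2]
  exact hmono (left_mem_Icc.2 h12) (right_mem_Icc.2 h12) h12

/-- The same monotonicity on a region with a simple foliation. -/
lemma cross_derivative_le_of_standard {ε c : ℝ} (hε : 0 < ε) {F G μ m : ℝ → ℝ}
    (hF : Differentiable ℝ F) (hG : Differentiable ℝ G) {y₁ y₂ : ℝ} (h12 : y₁ ≤ y₂)
    (hm : ∀ y, HasDerivAt m (μ y) y)
    (hμ : ∀ y ∈ Icc y₁ y₂, μ y = (F (y + ε) - G (y - ε)) / (2 * ε))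
    (h1 : ∀ y ∈ Icc y₁ y₂, deriv F (y + ε) ≤ (F (y + ε) - G (y - ε)) / (2 * ε))
    (h2 : ∀ y ∈ Icc y₁ y₂, deriv G (y - ε) ≤ (F (y + ε) - G (y - ε)) / (2 * ε))
    (hc1 : c - y₁ ≤ 2 * ε) (hc2 : -(2 * ε) ≤ c - y₂) :
    2 * F (y₂ + ε) - μ y₂ * (2 * ε - (c - y₂)) - m y₂ ≤
      2 * F (y₁ + ε) - μ y₁ * (2 * ε - (c - y₁)) - m y₁ := by
  have hmc : Continuous m := continuous_iff_continuousAt.2 fun y => (hm y).continuousAt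
  have hFc : Continuous F := hF.continuous
  have hGc : Continuous G := hG.continuous
  have hanti : AntitoneOn (fun y => 2 * F (y + ε) -
      (F (y + ε) - G (y - ε)) / (2 * ε) * (2 * ε - (c - y)) - m y) (Icc y₁ y₂) := by
    -- The derivative is affine along each segment of the foliation: its two weights each vanish at
    -- one end, so the sign conditions at the two ends suffice.
    refine antitoneOn_of_hasDerivWithinAt_nonpos (convex_Icc _ _)
      (f' := fun y => (deriv F (y + ε) - (F (y + ε) - G (y - ε)) / (2 * ε)) *
          ((2 * ε + (c - y)) / (2 * ε)) +
        (deriv G (y - ε) - (F (y + ε) - G (y - ε)) / (2 * ε)) *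
          ((2 * ε - (c - y)) / (2 * ε))) ?_ ?_ ?_
    · fun_prop
    · rw [interior_Icc]
      intro y hy
      have e1 := (hF (y + ε)).hasDerivAt.comp y ((hasDerivAt_id y).add_const ε)
      have e2 := (hG (y - ε)).hasDerivAt.comp y ((hasDerivAt_id y).sub_const ε)
      have e3 := ((hasDerivAt_id y).const_sub c).const_sub (2 * ε)
      refine ((((e1.const_mul 2).sub (((e1.fun_sub e2).div_const (2 * ε)).mul e3)).sub
        (hm y)).congr_deriv ?_).hasDerivWithinAt
      rw [hμ y (Ioo_subset_Icc_self hy)]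
      simp only [id, Function.comp]
      field_simp
      ring
    · rw [interior_Icc]
      intro y hy
      have hy' := Ioo_subset_Icc_self hy
      have k1 := h1 y hy'
      have k2 := h2 y hy'
      have k3 : 0 ≤ (2 * ε + (c - y)) / (2 * ε) := div_nonneg (by linarith [hy.2]) (by linarith)
      have k4 : 0 ≤ (2 * ε - (c - y)) / (2 * ε) := div_nonneg (by linarith [hy.1]) (by linarith)
      exact add_nonpos (mul_nonpos_of_nonpos_of_nonneg (by linarith) k3)
        (mul_nonpos_of_nonpos_of_nonneg (by linarith) k4)
  rw [hμ _ (left_mem_Icc.2 h12), hμ _ (right_mem_Icc.2 h12)]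
  exact hanti (left_mem_Icc.2 h12) (right_mem_Icc.2 h12) h12

/-- The slopes `m`, `-n` of the herringbone function along the upper and the lower ribs, together
with their derivatives, extended by the slopes of the standard candidates. -/
structure IsRibSlope (fp fm : ℝ → ℝ) (ε : ℝ) (p κ : ℝ → ℝ) (m dm n dn : ℝ → ℝ) : Prop where
  dm_cont : Continuous dm
  dn_cont : Continuous dn
  m_deriv : ∀ y, HasDerivAt m (dm y) y
  n_deriv : ∀ z, HasDerivAt n (dn z) z
  dm_spine : ∀ T ∈ Icc (-ε) ε, dm (p T - ε) = κ T
  dn_spine : ∀ T ∈ Icc (-ε) ε, dn (p T + 2 * T - ε) = κ T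
  m_spine : ∀ T ∈ Icc (-ε) ε, m (p T - ε) =
    (fp (p T) - fm (p T + 2 * T) + 2 * (ε + T) * (deriv fp (p T) - κ T * (ε - T))) / (2 * ε)
  n_spine : ∀ T ∈ Icc (-ε) ε, n (p T + 2 * T - ε) =
    (fm (p T + 2 * T) - fp (p T) + 2 * (ε - T) * (deriv fp (p T) - κ T * (ε - T))) / (2 * ε)
  dm_right : ∀ y, p (-ε) - ε ≤ y → dm y = (deriv fp (y + ε) - deriv fm (y - ε)) / (2 * ε)
  dn_left : ∀ z, z ≤ p ε + ε → dn z = (deriv fm (z + ε) - deriv fp (z - ε)) / (2 * ε)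
  m_right : ∀ y, p (-ε) - ε ≤ y → m y = (fp (y + ε) - fm (y - ε)) / (2 * ε)
  n_left : ∀ z, z ≤ p ε + ε → n z = (fm (z + ε) - fp (z - ε)) / (2 * ε)

/-- An antiderivative with prescribed value at a point. -/
lemma exists_antideriv {f : ℝ → ℝ} (hf : Continuous f) (x₀ c : ℝ) :
    ∃ F : ℝ → ℝ, F x₀ = c ∧ ∀ x, HasDerivAt F (f x) x := by
  refine ⟨fun x => c + ∫ t in x₀..x, f t, by simp, fun x => ?_⟩
  exact (intervalIntegral.integral_hasDerivAt_right (hf.intervalIntegrable _ _)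
    (hf.stronglyMeasurableAtFilter _ _) hf.continuousAt).const_add c

lemma eq_of_hasDerivAt_eq {f g f' : ℝ → ℝ} {a b : ℝ} (hf : ContinuousOn f (Icc a b))
    (hg : ContinuousOn g (Icc a b)) (hf' : ∀ x ∈ Ioo a b, HasDerivAt f (f' x) x)
    (hg' : ∀ x ∈ Ioo a b, HasDerivAt g (f' x) x) {x₀ : ℝ} (hx₀ : x₀ ∈ Icc a b)
    (h : f x₀ = g x₀) {x : ℝ} (hx : x ∈ Icc a b) : f x = g x := by
  have := eq_of_hasDerivAt_zero (f := fun x => f x - g x) (hf.sub hg)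
    (fun x hx => ((hf' x hx).sub (hg' x hx)).congr_deriv (sub_self _)) hx hx₀
  linarith

/-- The slopes are obtained as antiderivatives of continuous functions, so that they are C¹ without
any discussion at the ends of the spine. Their values on the spine hold because both sides have the
same derivative, κ·dp or κ·(dp + 2), and agree at T = −ε for m and at T = ε for n. -/
lemma IsSpineParam.exists_ribSlope {fp fm : ℝ → ℝ} {ε : ℝ} {p κ dp dκ : ℝ → ℝ}
    (hfp : ContDiff ℝ 2 fp) (hfm : ContDiff ℝ 2 fm)
    (h : IsSpineParam (deriv fp) (deriv fm) ε p κ dp dκ) :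
    ∃ m dm n dn, IsRibSlope fp fm ε p κ m dm n dn := by
  have hε := h.pos
  have hε0 := hε.ne'
  have hfpd : Differentiable ℝ fp := hfp.differentiable (by norm_num)
  have hfmd : Differentiable ℝ fm := hfm.differentiable (by norm_num)
  have ha1 : ContDiff ℝ 1 (deriv fp) := by
    have : ContDiff ℝ (1 + 1) fp := by simpa [one_add_one_eq_two] using hfp
    exact (contDiff_succ_iff_deriv.1 this).2.2
  have hb1 : ContDiff ℝ 1 (deriv fm) := by
    have : ContDiff ℝ (1 + 1) fm := by simpa [one_add_one_eq_two] using hfm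
    exact (contDiff_succ_iff_deriv.1 this).2.2
  have had : Differentiable ℝ (deriv fp) := ha1.differentiable (by norm_num)
  have hbd : Differentiable ℝ (deriv fm) := hb1.differentiable (by norm_num)
  have hac := ha1.continuous
  have hbc := hb1.continuous
  have hfpc := hfp.continuous
  have hfmc := hfm.continuous
  have hpc := h.p_cont
  have hκc := h.κ_cont
  have hmem1 : -ε ∈ Icc (-ε) ε := left_mem_Icc.2 h.neg_le
  have hmem2 : ε ∈ Icc (-ε) ε := right_mem_Icc.2 h.neg_le
  obtain ⟨σ, hσc, -, hσm, hσi, -, hσa, hσb⟩ := exists_clamped_inverse h.neg_le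
    (r := fun T => p T - ε) (h.p_cont.sub continuousOn_const)
    (fun x hx y hy hxy => sub_lt_sub_right (h.p_anti hx hy hxy) ε)
  obtain ⟨ρ, hρc, -, hρm, hρi, -, hρa, hρb⟩ := exists_clamped_inverse h.neg_le
    (r := fun T => p T + 2 * T - ε) (h.q_cont.sub continuousOn_const)
    (fun x hx y hy hxy => sub_lt_sub_right (h.q_anti hx hy hxy) ε)
  have hrel1 := h.rel _ hmem1
  have hrel2 := h.rel _ hmem2
  set v := p (-ε) - ε with hv
  set u := p ε + ε with hu
  set kR : ℝ → ℝ := fun y => (deriv fp (y + ε) - deriv fm (y - ε)) / (2 * ε) with hkR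
  set kL : ℝ → ℝ := fun z => (deriv fm (z + ε) - deriv fp (z - ε)) / (2 * ε) with hkL
  have hkRv : kR v = κ (-ε) := by
    simp only [hkR, hv]
    rw [show p (-ε) - ε + ε = p (-ε) by ring, show p (-ε) - ε - ε = p (-ε) + 2 * -ε by ring]
    rw [div_eq_iff (by positivity)]
    linarith
  have hkLu : kL u = κ ε := by
    simp only [hkL, hu]
    rw [show p ε + ε + ε = p ε + 2 * ε by ring, show p ε + ε - ε = p ε by ring]
    rw [div_eq_iff (by positivity)]
    linarith
  -- Beyond v the inverse σ is constant, so the increment of kR prolongs κ ∘ σ continuously; `hkRv`,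
  -- which is `rel` at −ε, makes the result equal to kR there.
  set dm : ℝ → ℝ := fun y => κ (σ y) + (kR (max y v) - kR v) with hdm
  set dn : ℝ → ℝ := fun z => κ (ρ z) + (kL (min z u) - kL u) with hdn
  have hkRc : Continuous kR := by fun_prop
  have hkLc : Continuous kL := by fun_prop
  have hdmc : Continuous dm :=
    (hκc.comp_continuous hσc hσm).add ((hkRc.comp (by fun_prop)).sub continuous_const)
  have hdnc : Continuous dn :=
    (hκc.comp_continuous hρc hρm).add ((hkLc.comp (by fun_prop)).sub continuous_const)
  obtain ⟨m, hm0, hm⟩ := exists_antideriv hdmc v ((fp (v + ε) - fm (v - ε)) / (2 * ε))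
  obtain ⟨n, hn0, hn⟩ := exists_antideriv hdnc u ((fm (u + ε) - fp (u - ε)) / (2 * ε))
  have hmc : Continuous m := continuous_iff_continuousAt.2 fun y => (hm y).continuousAt
  have hnc : Continuous n := continuous_iff_continuousAt.2 fun y => (hn y).continuousAt
  have hdm_spine : ∀ T ∈ Icc (-ε) ε, dm (p T - ε) = κ T := by
    intro T hT
    have : p T - ε ≤ v := sub_le_sub_right (h.p_anti.antitoneOn hmem1 hT hT.1) ε
    have e := hσi T hT
    simp only [hdm, max_eq_right this, e]
    ring
  have hdn_spine : ∀ T ∈ Icc (-ε) ε, dn (p T + 2 * T - ε) = κ T := by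
    intro T hT
    have : u ≤ p T + 2 * T - ε := by
      have := h.q_anti.antitoneOn hT hmem2 hT.2
      linarith
    have e := hρi T hT
    simp only [hdn, min_eq_right this, e]
    ring
  have hdm_right : ∀ y, v ≤ y → dm y = kR y := by
    intro y hy
    simp only [hdm, max_eq_left hy, hσa y hy, hkRv]
    ring
  have hdn_left : ∀ z, z ≤ u → dn z = kL z := by
    intro z hz
    simp only [hdn, min_eq_left hz, hρb z (by linarith), hkLu]
    ring
  have hq := h.q_cont
  refine ⟨m, dm, n, dn, ⟨hdmc, hdnc, hm, hn, hdm_spine, hdn_spine, ?_, ?_, hdm_right, hdn_left,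
    ?_, ?_⟩⟩
  · intro T hT
    refine eq_of_hasDerivAt_eq (f := fun T => m (p T - ε)) (g := fun T => (fp (p T) -
      fm (p T + 2 * T) + 2 * (ε + T) * (deriv fp (p T) - κ T * (ε - T))) / (2 * ε))
      (f' := fun T => κ T * dp T) ?_ ?_ ?_ ?_ hmem1 ?_ hT
    · fun_prop
    · fun_prop
    · intro T hT
      rw [← hdm_spine T (Ioo_subset_Icc_self hT)]
      exact (hm _).comp T ((h.p_deriv T hT).sub_const ε)
    · intro T hT
      have e1 := (hfpd _).hasDerivAt.comp T (h.p_deriv T hT)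
      have e2 := (hfmd _).hasDerivAt.comp T (h.q_deriv T hT)
      have e3 := (((hasDerivAt_id T).const_add ε).const_mul 2).mul (h.g_deriv had hT)
      refine (((e1.sub e2).add e3).div_const (2 * ε)).congr_deriv ?_
      have := h.rel T (Ioo_subset_Icc_self hT)
      simp only [id]
      field_simp
      linear_combination (-(dp T + 2)) * this
    · rw [show p (-ε) - ε = v from rfl, hm0]
      rw [show v + ε = p (-ε) by rw [hv]; ring, show v - ε = p (-ε) + 2 * -ε by rw [hv]; ring]
      ring
  · intro T hT
    refine eq_of_hasDerivAt_eq (f := fun T => n (p T + 2 * T - ε)) (g := fun T =>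
      (fm (p T + 2 * T) - fp (p T) + 2 * (ε - T) * (deriv fp (p T) - κ T * (ε - T))) / (2 * ε))
      (f' := fun T => κ T * (dp T + 2)) ?_ ?_ ?_ ?_ hmem2 ?_ hT
    · fun_prop
    · fun_prop
    · intro T hT
      rw [← hdn_spine T (Ioo_subset_Icc_self hT)]
      exact (hn _).comp T ((h.q_deriv T hT).sub_const ε)
    · intro T hT
      have e1 := (hfpd _).hasDerivAt.comp T (h.p_deriv T hT)
      have e2 := (hfmd _).hasDerivAt.comp T (h.q_deriv T hT)
      have e3 := (((hasDerivAt_id T).const_sub ε).const_mul 2).mul (h.g_deriv had hT)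
      refine (((e2.sub e1).add e3).div_const (2 * ε)).congr_deriv ?_
      have := h.rel T (Ioo_subset_Icc_self hT)
      simp only [id]
      field_simp
      linear_combination (dp T + 2) * this
    · rw [show p ε + 2 * ε - ε = u by rw [hu]; ring, hn0]
      rw [show u + ε = p ε + 2 * ε by rw [hu]; ring, show u - ε = p ε by rw [hu]; ring]
      ring
  · intro y hy
    refine eq_of_hasDerivAt_eq (f := m) (g := fun y => (fp (y + ε) - fm (y - ε)) / (2 * ε))
      (f' := kR) (a := v) (b := y) ?_ ?_ ?_ ?_ (left_mem_Icc.2 hy) hm0 (right_mem_Icc.2 hy)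
    · fun_prop
    · fun_prop
    · intro x hx
      rw [← hdm_right x hx.1.le]
      exact hm x
    · intro x _
      have e1 := (hfpd (x + ε)).hasDerivAt.comp x ((hasDerivAt_id x).add_const ε)
      have e2 := (hfmd (x - ε)).hasDerivAt.comp x ((hasDerivAt_id x).sub_const ε)
      exact ((e1.sub e2).div_const (2 * ε)).congr_deriv (by simp [hkR])
  · intro z hz
    refine eq_of_hasDerivAt_eq (f := n) (g := fun y => (fm (y + ε) - fp (y - ε)) / (2 * ε))
      (f' := kL) (a := z) (b := u) ?_ ?_ ?_ ?_ (right_mem_Icc.2 hz) hn0 (left_mem_Icc.2 hz)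
    · fun_prop
    · fun_prop
    · intro x hx
      rw [← hdn_left x hx.2.le]
      exact hn x
    · intro x _
      have e1 := (hfmd (x + ε)).hasDerivAt.comp x ((hasDerivAt_id x).add_const ε)
      have e2 := (hfpd (x - ε)).hasDerivAt.comp x ((hasDerivAt_id x).sub_const ε)
      exact ((e1.sub e2).div_const (2 * ε)).congr_deriv (by simp [hkL])

end DiagonalStrip

/-! ### The herringbone function: C¹ smoothness and diagonal concavity. -/

namespace DiagonalStrip

/-- The function that is linear with slope `m` along the ribs ending on the upper boundary. -/
def upperRib (fp : ℝ → ℝ) (ε : ℝ) (m : ℝ → ℝ) (x : ℝ × ℝ) : ℝ :=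
  fp (x.1 - x.2 + ε) - m (x.1 - x.2) * (ε - x.2)

/-- The function that is linear with slope `-n` along the ribs ending on the lower boundary. -/
def lowerRib (fm : ℝ → ℝ) (ε : ℝ) (n : ℝ → ℝ) (x : ℝ × ℝ) : ℝ :=
  fm (x.1 + x.2 + ε) - n (x.1 + x.2) * (ε + x.2)

/-- The part of the strip above the spine. -/
def aboveSpine (ε : ℝ) (p : ℝ → ℝ) : Set (ℝ × ℝ) := {x | x ∈ strip ε ∧ p x.2 + x.2 - ε ≤ x.1}

/-- The part of the strip below the spine. -/
def belowSpine (ε : ℝ) (p : ℝ → ℝ) : Set (ℝ × ℝ) := {x | x ∈ strip ε ∧ x.1 ≤ p x.2 + x.2 - ε}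

open Classical in
/-- The herringbone function, extended to the strip. -/
noncomputable def herringboneFun (fp fm : ℝ → ℝ) (ε : ℝ) (p m n : ℝ → ℝ) (x : ℝ × ℝ) : ℝ :=
  if p x.2 + x.2 - ε ≤ x.1 then upperRib fp ε m x else lowerRib fm ε n x

lemma isClosed_strip (ε : ℝ) : IsClosed (strip ε) :=
  (isClosed_le continuous_const continuous_snd).inter (isClosed_le continuous_snd continuous_const)

lemma isClosed_aboveSpine {ε : ℝ} {p : ℝ → ℝ} (hp : ContinuousOn p (Icc (-ε) ε)) :
    IsClosed (aboveSpine ε p) := by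
  refine (isClosed_strip ε).isClosed_le ?_ continuous_fst.continuousOn
  have : ContinuousOn (fun x : ℝ × ℝ => p x.2) (strip ε) :=
    hp.comp continuous_snd.continuousOn (fun x hx => hx)
  exact (this.add continuousOn_snd).sub continuousOn_const

lemma isClosed_belowSpine {ε : ℝ} {p : ℝ → ℝ} (hp : ContinuousOn p (Icc (-ε) ε)) :
    IsClosed (belowSpine ε p) := by
  refine (isClosed_strip ε).isClosed_le continuous_fst.continuousOn ?_
  have : ContinuousOn (fun x : ℝ × ℝ => p x.2) (strip ε) :=
    hp.comp continuous_snd.continuousOn (fun x hx => hx)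
  exact (this.add continuousOn_snd).sub continuousOn_const

lemma above_union_below (ε : ℝ) (p : ℝ → ℝ) : aboveSpine ε p ∪ belowSpine ε p = strip ε := by
  ext x
  constructor
  · rintro (h | h) <;> exact h.1
  · intro h
    rcases le_total (p x.2 + x.2 - ε) x.1 with h' | h'
    · exact Or.inl ⟨h, h'⟩
    · exact Or.inr ⟨h, h'⟩

lemma upperRib_hasFDerivAt {fp m dm : ℝ → ℝ} {ε : ℝ} (hfp : Differentiable ℝ fp)
    (hm : ∀ y, HasDerivAt m (dm y) y) (x : ℝ × ℝ) :
    HasFDerivAt (upperRib fp ε m)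
      ((deriv fp (x.1 - x.2 + ε) - dm (x.1 - x.2) * (ε - x.2)) •
        (ContinuousLinearMap.fst ℝ ℝ ℝ - ContinuousLinearMap.snd ℝ ℝ ℝ) +
        m (x.1 - x.2) • ContinuousLinearMap.snd ℝ ℝ ℝ) x := by
  have hy : HasFDerivAt (fun x : ℝ × ℝ => x.1 - x.2)
    (ContinuousLinearMap.fst ℝ ℝ ℝ - ContinuousLinearMap.snd ℝ ℝ ℝ) x :=
    hasFDerivAt_fst.sub hasFDerivAt_snd
  have h1 := (hfp (x.1 - x.2 + ε)).hasDerivAt.comp_hasFDerivAt x (hy.add_const ε)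
  have h2 := (hm (x.1 - x.2)).comp_hasFDerivAt x hy
  have h3 := h1.sub (h2.mul ((hasFDerivAt_snd (𝕜 := ℝ) (p := x)).const_sub ε))
  refine h3.congr_fderiv ?_
  ext <;> simp <;> ring

lemma lowerRib_hasFDerivAt {fm n dn : ℝ → ℝ} {ε : ℝ} (hfm : Differentiable ℝ fm)
    (hn : ∀ y, HasDerivAt n (dn y) y) (x : ℝ × ℝ) :
    HasFDerivAt (lowerRib fm ε n)
      ((deriv fm (x.1 + x.2 + ε) - dn (x.1 + x.2) * (ε + x.2)) •
        (ContinuousLinearMap.fst ℝ ℝ ℝ + ContinuousLinearMap.snd ℝ ℝ ℝ) -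
        n (x.1 + x.2) • ContinuousLinearMap.snd ℝ ℝ ℝ) x := by
  have hy : HasFDerivAt (fun x : ℝ × ℝ => x.1 + x.2)
    (ContinuousLinearMap.fst ℝ ℝ ℝ + ContinuousLinearMap.snd ℝ ℝ ℝ) x :=
    hasFDerivAt_fst.add hasFDerivAt_snd
  have h1 := (hfm (x.1 + x.2 + ε)).hasDerivAt.comp_hasFDerivAt x (hy.add_const ε)
  have h2 := (hn (x.1 + x.2)).comp_hasFDerivAt x hy
  have h3 := h1.sub (h2.mul ((hasFDerivAt_snd (𝕜 := ℝ) (p := x)).const_add ε))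
  refine h3.congr_fderiv ?_
  ext <;> simp <;> ring

lemma contDiff_one_of_hasDerivAt {m dm : ℝ → ℝ} (hm : ∀ y, HasDerivAt m (dm y) y)
    (hc : Continuous dm) : ContDiff ℝ 1 m := by
  rw [contDiff_one_iff_deriv]
  refine ⟨fun y => (hm y).differentiableAt, ?_⟩
  rwa [show deriv m = dm from funext fun y => (hm y).deriv]

section

variable {fp fm : ℝ → ℝ} {ε : ℝ} {p κ dp dκ m dm n dn : ℝ → ℝ}

/-- The symmetric expression in p and κ is the form in which the common value is later compared with
the prescribed value A on the spine. -/
lemma IsRibSlope.rib_eq (h : IsSpineParam (deriv fp) (deriv fm) ε p κ dp dκ)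
    (k : IsRibSlope fp fm ε p κ m dm n dn) {x : ℝ × ℝ}
    (hx : x ∈ aboveSpine ε p ∩ belowSpine ε p) :
    upperRib fp ε m x = lowerRib fm ε n x ∧
    upperRib fp ε m x = ((ε + x.2) * fp (p x.2) + (ε - x.2) * fm (p x.2 + 2 * x.2)) / (2 * ε) -
      (ε ^ 2 - x.2 ^ 2) / ε * (deriv fp (p x.2) - κ x.2 * (ε - x.2)) := by
  have hε := h.pos.ne'
  have hxT : x.2 ∈ Icc (-ε) ε := hx.1.1
  have hx1 : x.1 = p x.2 + x.2 - ε := le_antisymm hx.2.2 hx.1.2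
  have e1 : x.1 - x.2 = p x.2 - ε := by rw [hx1]; ring
  have e2 : x.1 + x.2 = p x.2 + 2 * x.2 - ε := by rw [hx1]; ring
  unfold upperRib lowerRib
  rw [e1, e2, k.m_spine _ hxT, k.n_spine _ hxT, sub_add_cancel, sub_add_cancel]
  constructor <;> field_simp <;> ring

/-- Equality of the ∂₁-derivatives on the spine is exactly `rel`; with the spine values of m and n
it also gives equality of the ∂₂-derivatives. -/
lemma IsRibSlope.fderiv_eq (hfp : Differentiable ℝ fp) (hfm : Differentiable ℝ fm)
    (h : IsSpineParam (deriv fp) (deriv fm) ε p κ dp dκ)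
    (k : IsRibSlope fp fm ε p κ m dm n dn) :
    ∀ x ∈ aboveSpine ε p ∩ belowSpine ε p,
      fderiv ℝ (upperRib fp ε m) x = fderiv ℝ (lowerRib fm ε n) x := by
  intro x hx
  have hε := h.pos.ne'
  have hxT : x.2 ∈ Icc (-ε) ε := hx.1.1
  have hx1 : x.1 = p x.2 + x.2 - ε := le_antisymm hx.2.2 hx.1.2
  have e1 : x.1 - x.2 = p x.2 - ε := by rw [hx1]; ring
  have e2 : x.1 + x.2 = p x.2 + 2 * x.2 - ε := by rw [hx1]; ring
  have hrel := h.rel _ hxT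
  rw [(upperRib_hasFDerivAt hfp k.m_deriv x).fderiv, (lowerRib_hasFDerivAt hfm k.n_deriv x).fderiv,
    e1, e2, k.m_spine _ hxT, k.n_spine _ hxT, k.dm_spine _ hxT, k.dn_spine _ hxT, sub_add_cancel,
    sub_add_cancel]
  ext
  · simp
    linear_combination -hrel
  · simp
    generalize deriv fm (p x.2 + 2 * x.2) = b at *
    field_simp
    linear_combination (-2 * ε) * hrel

lemma herringboneFun_above : EqOn (herringboneFun fp fm ε p m n) (upperRib fp ε m)
    (aboveSpine ε p) := fun _ hx => if_pos hx.2

lemma herringboneFun_below (h : IsSpineParam (deriv fp) (deriv fm) ε p κ dp dκ)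
    (k : IsRibSlope fp fm ε p κ m dm n dn) :
    EqOn (herringboneFun fp fm ε p m n) (lowerRib fm ε n) (belowSpine ε p) := by
  intro x hx
  by_cases h' : p x.2 + x.2 - ε ≤ x.1
  · rw [herringboneFun_above ⟨hx.1, h'⟩]
    exact (k.rib_eq h ⟨⟨hx.1, h'⟩, hx⟩).1
  · exact if_neg h'

/-- The gradient of the herringbone function. -/
lemma IsRibSlope.exists_gradient (hfp : ContDiff ℝ 2 fp) (hfm : ContDiff ℝ 2 fm)
    (h : IsSpineParam (deriv fp) (deriv fm) ε p κ dp dκ)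
    (k : IsRibSlope fp fm ε p κ m dm n dn) :
    ∃ B' : ℝ × ℝ → ℝ × ℝ →L[ℝ] ℝ,
      (∀ x ∈ aboveSpine ε p, B' x =
        (deriv fp (x.1 - x.2 + ε) - dm (x.1 - x.2) * (ε - x.2)) •
        (ContinuousLinearMap.fst ℝ ℝ ℝ - ContinuousLinearMap.snd ℝ ℝ ℝ) +
        m (x.1 - x.2) • ContinuousLinearMap.snd ℝ ℝ ℝ) ∧
      (∀ x ∈ belowSpine ε p, B' x =
        (deriv fm (x.1 + x.2 + ε) - dn (x.1 + x.2) * (ε + x.2)) •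
        (ContinuousLinearMap.fst ℝ ℝ ℝ + ContinuousLinearMap.snd ℝ ℝ ℝ) -
        n (x.1 + x.2) • ContinuousLinearMap.snd ℝ ℝ ℝ) ∧
      ContinuousOn B' (strip ε) ∧
      ∀ x ∈ strip ε, HasFDerivWithinAt (herringboneFun fp fm ε p m n) (B' x) (strip ε) x := by
  have hfpd : Differentiable ℝ fp := hfp.differentiable (by norm_num)
  have hfmd : Differentiable ℝ fm := hfm.differentiable (by norm_num)
  have hm := contDiff_one_of_hasDerivAt k.m_deriv k.dm_cont
  have hn := contDiff_one_of_hasDerivAt k.n_deriv k.dn_cont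
  have hfp1 : ContDiff ℝ 1 fp := hfp.of_le (by norm_num)
  have hfm1 : ContDiff ℝ 1 fm := hfm.of_le (by norm_num)
  obtain ⟨B', h1, h2, h3, h4⟩ := hasFDerivWithinAt_glue (F := upperRib fp ε m)
    (G := lowerRib fm ε n) (by unfold upperRib; fun_prop) (by unfold lowerRib; fun_prop)
    (isClosed_aboveSpine h.p_cont) (isClosed_belowSpine h.p_cont) herringboneFun_above
    (herringboneFun_below h k) (k.fderiv_eq hfpd hfmd h)
  rw [above_union_below] at h3 h4
  refine ⟨B', fun x hx => ?_, fun x hx => ?_, h3, h4⟩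
  · rw [h1 hx, (upperRib_hasFDerivAt hfpd k.m_deriv x).fderiv]
  · rw [h2 hx, (lowerRib_hasFDerivAt hfmd k.n_deriv x).fderiv]

/-- A neighbourhood of the herringbone in the strip. -/
def wideRegion (ε : ℝ) (p : ℝ → ℝ) (δ : ℝ) : Set (ℝ × ℝ) :=
  {x | x ∈ strip ε ∧ p ε + ε - δ ≤ x.1 + x.2 ∧ x.1 - x.2 ≤ p (-ε) - ε + δ}

/-- This is the derivative of B in the direction (1, −1) above the spine. A point there lies either
on a rib from the spine or in the right simple foliation; two points of different kinds are compared
through the common ray x₁ − x₂ = p(−ε) − ε. -/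
lemma upper_cross_derivative_le (h : IsSpineParam (deriv fp) (deriv fm) ε p κ dp dκ)
    (ha : Differentiable ℝ (deriv fp)) (hb : Differentiable ℝ (deriv fm))
    (k : IsRibSlope fp fm ε p κ m dm n dn) {δ : ℝ}
    (hR : ∀ y ∈ Icc (p (-ε) - ε) (p (-ε) - ε + δ),
      deriv (deriv fp) (y + ε) ≤ (deriv fp (y + ε) - deriv fm (y - ε)) / (2 * ε) ∧
      deriv (deriv fm) (y - ε) ≤ (deriv fp (y + ε) - deriv fm (y - ε)) / (2 * ε))
    {P Q : ℝ × ℝ} (hP : P ∈ aboveSpine ε p) (hQ : Q ∈ aboveSpine ε p)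
    (hQ' : Q.1 - Q.2 ≤ p (-ε) - ε + δ) (hsum : P.1 + P.2 = Q.1 + Q.2)
    (hPQ : P.1 - P.2 ≤ Q.1 - Q.2) :
    2 * deriv fp (Q.1 - Q.2 + ε) - dm (Q.1 - Q.2) * (2 * (ε - Q.2)) - m (Q.1 - Q.2) ≤
    2 * deriv fp (P.1 - P.2 + ε) - dm (P.1 - P.2) * (2 * (ε - P.2)) - m (P.1 - P.2) := by
  have hε := h.pos
  have hmem1 : -ε ∈ Icc (-ε) ε := left_mem_Icc.2 h.neg_le
  set c := P.1 + P.2 with hc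
  have eP : 2 * (ε - P.2) = 2 * ε - (c - (P.1 - P.2)) := by rw [hc]; ring
  have eQ : 2 * (ε - Q.2) = 2 * ε - (c - (Q.1 - Q.2)) := by rw [hsum]; ring
  rw [eP, eQ]
  have hP1 := hP.1.1
  have hP2 := hP.1.2
  have hQ1 := hQ.1.1
  have hQ2 := hQ.1.2
  have hP3 := hP.2
  have hQ3 := hQ.2
  -- The rib through X starts at a height θ not above X, found by the intermediate value theorem for
  -- p on [−ε, X.2].
  have exθ : ∀ X ∈ aboveSpine ε p, X.1 - X.2 ≤ p (-ε) - ε →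
      ∃ θ ∈ Icc (-ε) ε, p θ - ε = X.1 - X.2 ∧ θ ≤ X.2 := by
    intro X hX hXv
    have hsub : Icc (-ε) X.2 ⊆ Icc (-ε) ε := Icc_subset_Icc_right hX.1.2
    obtain ⟨θ, hθ, hθ'⟩ := intermediate_value_Icc' hX.1.1
      ((h.p_cont.mono hsub).sub (continuousOn_const (c := ε)))
      (show X.1 - X.2 ∈ Icc (p X.2 - ε) (p (-ε) - ε) from ⟨by linarith [hX.2], hXv⟩)
    exact ⟨θ, hsub hθ, hθ', hθ.2⟩
  have spine := fun {θ₁ θ₂ : ℝ} => cross_derivative_le_of_spine (ε := ε) (c := c)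
    (F := deriv fp) (r := fun T => p T - ε) (κ := κ) (dr := dp) (dκ := dκ) (τ := id) (μ := dm)
    (m := m) ha (h.p_cont.sub continuousOn_const) h.κ_cont
    (fun θ hθ => (h.p_deriv θ hθ).sub_const ε) h.κ_deriv
    (fun θ hθ => by simpa using h.ode θ hθ) h.dκ_nonneg
    (fun x hx y hy hxy => by
      have := h.q_anti.antitoneOn hx hy hxy
      simp only [id] at this ⊢
      linarith)
    k.m_deriv k.dm_spine (θ₁ := θ₁) (θ₂ := θ₂)
  have std := fun {y₁ y₂ : ℝ} (h12 : y₁ ≤ y₂) (h1 : p (-ε) - ε ≤ y₁)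
      (h2 : y₂ ≤ p (-ε) - ε + δ) => cross_derivative_le_of_standard (c := c) hε
    (F := deriv fp) (G := deriv fm) (μ := dm) (m := m) ha hb h12 k.m_deriv
    (fun y hy => k.dm_right y (h1.trans hy.1))
    (fun y hy => (hR y ⟨h1.trans hy.1, hy.2.trans h2⟩).1)
    (fun y hy => (hR y ⟨h1.trans hy.1, hy.2.trans h2⟩).2)
  rcases le_total (p (-ε) - ε) (P.1 - P.2) with hPv | hPv
  · exact std hPQ hPv hQ' (by linarith) (by linarith)
  · obtain ⟨θ₁, hθ₁, e₁, hθ₁'⟩ := exθ P hP hPv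
    rcases le_total (Q.1 - Q.2) (p (-ε) - ε) with hQv | hQv
    · obtain ⟨θ₂, hθ₂, e₂, hθ₂'⟩ := exθ Q hQ hQv
      rw [← e₁, ← e₂]
      refine spine hθ₂ hθ₁ ?_ ?_
      · by_contra hlt
        push Not at hlt
        have := h.p_anti hθ₁ hθ₂ hlt
        linarith
      · simp only [id]; linarith
    · have s1 := std hQv le_rfl hQ' (by linarith) (by linarith)
      have s2 := spine hmem1 hθ₁ hθ₁.1 (by simp only [id]; linarith)
      simp only [e₁] at s2
      linarith

/-- Mirror case in the direction (1, 1): p and p + 2T exchange roles, τ becomes −T, and `ode_q`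
replaces `ode`. -/
lemma lower_cross_derivative_le (h : IsSpineParam (deriv fp) (deriv fm) ε p κ dp dκ)
    (ha : Differentiable ℝ (deriv fp)) (hb : Differentiable ℝ (deriv fm))
    (k : IsRibSlope fp fm ε p κ m dm n dn) {δ : ℝ}
    (hL : ∀ z ∈ Icc (p ε + ε - δ) (p ε + ε),
      deriv (deriv fm) (z + ε) ≤ (deriv fm (z + ε) - deriv fp (z - ε)) / (2 * ε) ∧
      deriv (deriv fp) (z - ε) ≤ (deriv fm (z + ε) - deriv fp (z - ε)) / (2 * ε))
    {P Q : ℝ × ℝ} (hP : P ∈ belowSpine ε p) (hQ : Q ∈ belowSpine ε p)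
    (hP' : p ε + ε - δ ≤ P.1 + P.2) (hsum : P.1 - P.2 = Q.1 - Q.2)
    (hPQ : P.1 + P.2 ≤ Q.1 + Q.2) :
    2 * deriv fm (Q.1 + Q.2 + ε) - dn (Q.1 + Q.2) * (2 * (ε + Q.2)) - n (Q.1 + Q.2) ≤
    2 * deriv fm (P.1 + P.2 + ε) - dn (P.1 + P.2) * (2 * (ε + P.2)) - n (P.1 + P.2) := by
  have hε := h.pos
  have hmem2 : ε ∈ Icc (-ε) ε := right_mem_Icc.2 h.neg_le
  set c := P.1 - P.2 with hc
  have eP : 2 * (ε + P.2) = 2 * ε - (c - (P.1 + P.2)) := by rw [hc]; ring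
  have eQ : 2 * (ε + Q.2) = 2 * ε - (c - (Q.1 + Q.2)) := by rw [hsum]; ring
  rw [eP, eQ]
  have hP1 := hP.1.1
  have hP2 := hP.1.2
  have hQ1 := hQ.1.1
  have hQ2 := hQ.1.2
  have hP3 := hP.2
  have hQ3 := hQ.2
  have exθ : ∀ X ∈ belowSpine ε p, p ε + ε ≤ X.1 + X.2 →
      ∃ θ ∈ Icc (-ε) ε, p θ + 2 * θ - ε = X.1 + X.2 ∧ X.2 ≤ θ := by
    intro X hX hXv
    have hsub : Icc X.2 ε ⊆ Icc (-ε) ε := Icc_subset_Icc_left hX.1.1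
    obtain ⟨θ, hθ, hθ'⟩ := intermediate_value_Icc' hX.1.2
      ((h.q_cont.mono hsub).sub (continuousOn_const (c := ε)))
      (show X.1 + X.2 ∈ Icc (p ε + 2 * ε - ε) (p X.2 + 2 * X.2 - ε) from
        ⟨by linarith, by linarith [hX.2]⟩)
    exact ⟨θ, hsub hθ, hθ', hθ.1⟩
  have spine := fun {θ₁ θ₂ : ℝ} => cross_derivative_le_of_spine (ε := ε) (c := c)
    (F := deriv fm) (r := fun T => p T + 2 * T - ε) (κ := κ) (dr := fun T => dp T + 2) (dκ := dκ)
    (τ := fun T => -T) (μ := dn)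
    (m := n) hb (h.q_cont.sub continuousOn_const) h.κ_cont
    (fun θ hθ => (h.q_deriv θ hθ).sub_const ε) h.κ_deriv
    (fun θ hθ => by simpa using (h.ode_q ha hb hθ).2) h.dκ_nonneg
    (fun x hx y hy hxy => by
      have := h.p_anti.antitoneOn hx hy hxy
      simp only at this ⊢
      linarith)
    k.n_deriv k.dn_spine (θ₁ := θ₁) (θ₂ := θ₂)
  have std := fun {y₁ y₂ : ℝ} (h12 : y₁ ≤ y₂) (h1 : p ε + ε - δ ≤ y₁)
      (h2 : y₂ ≤ p ε + ε) => cross_derivative_le_of_standard (c := c) hε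
    (F := deriv fm) (G := deriv fp) (μ := dn) (m := n) hb ha h12 k.n_deriv
    (fun y hy => k.dn_left y (hy.2.trans h2))
    (fun y hy => (hL y ⟨h1.trans hy.1, hy.2.trans h2⟩).1)
    (fun y hy => (hL y ⟨h1.trans hy.1, hy.2.trans h2⟩).2)
  have eu : p ε + 2 * ε - ε = p ε + ε := by ring
  rcases le_total (Q.1 + Q.2) (p ε + ε) with hQv | hQv
  · exact std hPQ hP' hQv (by linarith) (by linarith)
  · obtain ⟨θ₂, hθ₂, e₂, hθ₂'⟩ := exθ Q hQ hQv
    rcases le_total (p ε + ε) (P.1 + P.2) with hPv | hPv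
    · obtain ⟨θ₁, hθ₁, e₁, hθ₁'⟩ := exθ P hP hPv
      rw [← e₁, ← e₂]
      refine spine hθ₂ hθ₁ ?_ ?_
      · by_contra hlt
        push Not at hlt
        have := h.q_anti hθ₁ hθ₂ hlt
        simp only at this
        linarith
      · linarith
    · have s1 := std hPv hP' le_rfl (by linarith) (by linarith)
      have s2 := spine hθ₂ hmem2 hθ₂.2 (by linarith)
      simp only [e₂, eu] at s2
      linarith

/-- The extended herringbone function is diagonally concave near the herringbone. -/
theorem herringboneFun_concave (hfp : ContDiff ℝ 3 fp) (hfm : ContDiff ℝ 3 fm)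
    (h : IsSpineParam (deriv fp) (deriv fm) ε p κ dp dκ)
    (k : IsRibSlope fp fm ε p κ m dm n dn) {δ : ℝ}
    (hR : ∀ y ∈ Icc (p (-ε) - ε) (p (-ε) - ε + δ),
      deriv (deriv fp) (y + ε) ≤ (deriv fp (y + ε) - deriv fm (y - ε)) / (2 * ε) ∧
      deriv (deriv fm) (y - ε) ≤ (deriv fp (y + ε) - deriv fm (y - ε)) / (2 * ε))
    (hL : ∀ z ∈ Icc (p ε + ε - δ) (p ε + ε),
      deriv (deriv fm) (z + ε) ≤ (deriv fm (z + ε) - deriv fp (z - ε)) / (2 * ε) ∧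
      deriv (deriv fp) (z - ε) ≤ (deriv fm (z + ε) - deriv fp (z - ε)) / (2 * ε)) :
    DiagonallyConcaveOn (wideRegion ε p δ) (herringboneFun fp fm ε p m n) := by
  have hε := h.pos
  have ha : Differentiable ℝ (deriv fp) := by
    have : ContDiff ℝ (2 + 1) fp := by
      rw [show (2 + 1 : ℕ∞ω) = 3 by norm_num]; exact hfp
    exact (contDiff_succ_iff_deriv.1 this).2.2.differentiable (by norm_num)
  have hb : Differentiable ℝ (deriv fm) := by
    have : ContDiff ℝ (2 + 1) fm := by
      rw [show (2 + 1 : ℕ∞ω) = 3 by norm_num]; exact hfm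
    exact (contDiff_succ_iff_deriv.1 this).2.2.differentiable (by norm_num)
  obtain ⟨B', hBu, hBl, -, hB⟩ := k.exists_gradient (hfp.of_le (by norm_num))
    (hfm.of_le (by norm_num)) h
  have hcover : ∀ x ∈ wideRegion ε p δ, x ∈ aboveSpine ε p ∨ x ∈ belowSpine ε p := by
    intro x hx
    have : x ∈ aboveSpine ε p ∪ belowSpine ε p := by rw [above_union_below]; exact hx.1
    exact this
  have minus : ∀ P ∈ wideRegion ε p δ, ∀ Q ∈ wideRegion ε p δ, P.1 + P.2 = Q.1 + Q.2 →
      P.1 - P.2 ≤ Q.1 - Q.2 → B' Q (1, -1) ≤ B' P (1, -1) := by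
    have up : ∀ P ∈ aboveSpine ε p, B' P (1, -1) =
        2 * deriv fp (P.1 - P.2 + ε) - dm (P.1 - P.2) * (2 * (ε - P.2)) - m (P.1 - P.2) := by
      intro P hP; rw [hBu P hP]; simp; ring
    have low : ∀ P ∈ belowSpine ε p, B' P (1, -1) = n (P.1 + P.2) := by
      intro P hP; rw [hBl P hP]; simp
    intro P hP Q hQ hsum hPQ
    rcases hcover P hP with hP' | hP' <;> rcases hcover Q hQ with hQ' | hQ'
    · rw [up P hP', up Q hQ']
      exact upper_cross_derivative_le h ha hb k hR hP' hQ' hQ.2.2 hsum hPQ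
    -- The line from P down to Q crosses the spine at height θ. Below the crossing it runs along a
    -- rib, where the derivative in its direction is constant, so only the part above matters.
    · obtain ⟨θ, hθ, hθ'⟩ := intermediate_value_Icc' (show Q.2 ≤ P.2 by linarith)
        ((h.q_cont.mono (Icc_subset_Icc hQ'.1.1 hP'.1.2)).sub (continuousOn_const (c := ε)))
        (show P.1 + P.2 ∈ Icc (p P.2 + 2 * P.2 - ε) (p Q.2 + 2 * Q.2 - ε) from
          ⟨by linarith [hP'.2], by linarith [hQ'.2]⟩)
      change p θ + 2 * θ - ε = _ at hθ'
      have hC : (p θ + θ - ε, θ) ∈ strip ε := ⟨hQ'.1.1.trans hθ.1, hθ.2.trans hP'.1.2⟩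
      have hCu : (p θ + θ - ε, θ) ∈ aboveSpine ε p := ⟨hC, le_rfl⟩
      have hCl : (p θ + θ - ε, θ) ∈ belowSpine ε p := ⟨hC, le_rfl⟩
      have e1 := upper_cross_derivative_le h ha hb k hR hP' hCu
        (by simp only; linarith [hQ.2.2, hθ.1]) (by simp only; linarith)
        (by simp only; linarith [hθ.2])
      rw [← up _ hP', ← up _ hCu, low _ hCl] at e1
      rw [low _ hQ', ← hsum]
      rwa [show p θ + θ - ε + θ = P.1 + P.2 by linarith] at e1
    -- A descending diagonal cannot pass from below the spine to above it, since p + 2T is strictly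
    -- decreasing: both points coincide, on the spine.
    · have hle : Q.2 ≤ P.2 := by linarith
      have hge : P.2 ≤ Q.2 := by
        by_contra hlt
        push Not at hlt
        have := h.q_anti hQ'.1 hP'.1 hlt
        simp only at this
        linarith [hP'.2, hQ'.2]
      have : P = Q := Prod.ext (by linarith) (by linarith)
      rw [this]
    · rw [low _ hP', low _ hQ', hsum]
  have plus : ∀ P ∈ wideRegion ε p δ, ∀ Q ∈ wideRegion ε p δ, P.1 - P.2 = Q.1 - Q.2 →
      P.1 + P.2 ≤ Q.1 + Q.2 → B' Q (1, 1) ≤ B' P (1, 1) := by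
    have up : ∀ P ∈ aboveSpine ε p, B' P (1, 1) = m (P.1 - P.2) := by
      intro P hP; rw [hBu P hP]; simp
    have low : ∀ P ∈ belowSpine ε p, B' P (1, 1) =
        2 * deriv fm (P.1 + P.2 + ε) - dn (P.1 + P.2) * (2 * (ε + P.2)) - n (P.1 + P.2) := by
      intro P hP; rw [hBl P hP]; simp; ring
    intro P hP Q hQ hsum hPQ
    rcases hcover P hP with hP' | hP' <;> rcases hcover Q hQ with hQ' | hQ'
    · rw [up P hP', up Q hQ', hsum]
    · have hle : P.2 ≤ Q.2 := by linarith
      have hge : Q.2 ≤ P.2 := by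
        by_contra hlt
        push Not at hlt
        have := h.p_anti hP'.1 hQ'.1 hlt
        linarith [hP'.2, hQ'.2]
      have : P = Q := Prod.ext (by linarith) (by linarith)
      rw [this]
    · obtain ⟨θ, hθ, hθ'⟩ := intermediate_value_Icc' (show P.2 ≤ Q.2 by linarith)
        ((h.p_cont.mono (Icc_subset_Icc hP'.1.1 hQ'.1.2)).sub (continuousOn_const (c := ε)))
        (show P.1 - P.2 ∈ Icc (p Q.2 - ε) (p P.2 - ε) from
          ⟨by linarith [hQ'.2], by linarith [hP'.2]⟩)
      change p θ - ε = _ at hθ'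
      have hC : (p θ + θ - ε, θ) ∈ strip ε := ⟨hP'.1.1.trans hθ.1, hθ.2.trans hQ'.1.2⟩
      have hCu : (p θ + θ - ε, θ) ∈ aboveSpine ε p := ⟨hC, le_rfl⟩
      have hCl : (p θ + θ - ε, θ) ∈ belowSpine ε p := ⟨hC, le_rfl⟩
      have e1 := lower_cross_derivative_le h ha hb k hL hP' hCl
        (by linarith [hP.2.1]) (by simp only; linarith)
        (by simp only; linarith [hθ.1])
      rw [← low _ hP', ← low _ hCl, up _ hCu] at e1
      rw [up _ hQ', ← hsum]
      rwa [show p θ + θ - ε - θ = P.1 - P.2 by linarith] at e1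
    · rw [low P hP', low Q hQ']
      exact lower_cross_derivative_le h ha hb k hL hP' hQ' hP.2.1 hsum hPQ
  intro x y hd hxy
  have hmem : ∀ t ∈ Icc (0:ℝ) 1, x + t • (y - x) ∈ wideRegion ε p δ := by
    intro t ht
    apply hxy
    rw [segment_eq_image']
    exact ⟨t, ht, rfl⟩
  refine concaveOn_segment_of_antitoneOn hB (hxy.trans fun x hx => hx.1) ?_
  intro s hs t ht hst
  have hs' := hmem s hs
  have ht' := hmem t ht
  simp only
  rcases hd with hd | hd
  · have e : y - x = (y.1 - x.1) • ((1 : ℝ), (1 : ℝ)) := by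
      ext <;> simp [hd]
    have key : ∀ s t : ℝ, x + s • (y - x) ∈ wideRegion ε p δ → x + t • (y - x) ∈ wideRegion ε p δ →
        s * (y.1 - x.1) ≤ t * (y.1 - x.1) →
        B' (x + t • (y - x)) (1, 1) ≤ B' (x + s • (y - x)) (1, 1) := by
      intro s t hs ht hst
      refine plus _ hs _ ht ?_ ?_
      · simp [← hd]
      · simp [← hd]; linarith
    have l : ∀ P, B' P (y - x) = (y.1 - x.1) * B' P (1, 1) := by
      intro P; rw [e, map_smul]; simp
    rw [l, l]
    rcases le_total 0 (y.1 - x.1) with h0 | h0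
    · exact mul_le_mul_of_nonneg_left (key s t hs' ht' (mul_le_mul_of_nonneg_right hst h0)) h0
    · exact mul_le_mul_of_nonpos_left (key t s ht' hs' (mul_le_mul_of_nonpos_right hst h0)) h0
  · have e : y - x = (y.1 - x.1) • ((1 : ℝ), (-1 : ℝ)) := by
      ext <;> simp [hd]
    have hd' : y.2 - x.2 = -(y.1 - x.1) := by linarith
    have key : ∀ s t : ℝ, x + s • (y - x) ∈ wideRegion ε p δ → x + t • (y - x) ∈ wideRegion ε p δ →
        s * (y.1 - x.1) ≤ t * (y.1 - x.1) →
        B' (x + t • (y - x)) (1, -1) ≤ B' (x + s • (y - x)) (1, -1) := by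
      intro s t hs ht hst
      refine minus _ hs _ ht ?_ ?_
      · simp [hd']; ring
      · simp [hd']; linarith
    have l : ∀ P, B' P (y - x) = (y.1 - x.1) * B' P (1, -1) := by
      intro P; rw [e, map_smul]; simp
    rw [l, l]
    rcases le_total 0 (y.1 - x.1) with h0 | h0
    · exact mul_le_mul_of_nonneg_left (key s t hs' ht' (mul_le_mul_of_nonneg_right hst h0)) h0
    · exact mul_le_mul_of_nonpos_left (key t s ht' hs' (mul_le_mul_of_nonpos_right hst h0)) h0

end

end DiagonalStrip

/-! ### From a parametrized spine to the glued Bellman candidate. -/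

namespace DiagonalStrip

lemma LinearOnSegment.congr {B C : ℝ × ℝ → ℝ} {x y : ℝ × ℝ} (h : LinearOnSegment B x y)
    (hBC : EqOn B C (segment ℝ x y)) : LinearOnSegment C x y := by
  intro t ht
  have hm : (1 - t) • x + t • y ∈ segment ℝ x y :=
    ⟨1 - t, t, by linarith [ht.2], ht.1, by ring, rfl⟩
  rw [← hBC hm, ← hBC (left_mem_segment ℝ x y), ← hBC (right_mem_segment ℝ x y)]
  exact h t ht

lemma IsBellmanCandidate.congr {fp fm : ℝ → ℝ} {ε : ℝ} {Ω : Set (ℝ × ℝ)} {B C : ℝ × ℝ → ℝ}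
    (h : IsBellmanCandidate fp fm ε Ω B) (hBC : EqOn B C Ω) : IsBellmanCandidate fp fm ε Ω C where
  subset_strip := h.subset_strip
  concave := h.concave.congr hBC
  upper_boundary t ht := by rw [← hBC ht, h.upper_boundary t ht]
  lower_boundary t ht := by rw [← hBC ht, h.lower_boundary t ht]
  extremal y hy := by
    rcases h.extremal y hy with ⟨z, hz, hd, hs, hl⟩ | ⟨U, hU, hl⟩
    · exact Or.inl ⟨z, hz, hd, hs, hl.congr (hBC.mono hs)⟩
    · exact Or.inr ⟨U, hU, fun x z hd hs =>
        (hl x z hd hs).congr (hBC.mono (hs.trans inter_subset_right))⟩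

/-- A decreasing function on a compact interval with continuous nonvanishing derivative has a
`C¹` inverse. -/
lemma exists_contDiffOn_inverse {a b : ℝ} (hab : a < b) {U dU : ℝ → ℝ}
    (hU : ContinuousOn U (Icc a b)) (hdU : ContinuousOn dU (Icc a b))
    (hd : ∀ T ∈ Ioo a b, HasDerivAt U (dU T) T) (hneg : ∀ T ∈ Icc a b, dU T < 0) :
    ∃ S : ℝ → ℝ, (∀ T ∈ Icc a b, S (U T) = T) ∧
      (∀ x ∈ Icc (U b) (U a), S x ∈ Icc a b ∧ U (S x) = x) ∧
      (∀ x ∈ Ioo (U b) (U a), S x ∈ Ioo a b) ∧ U b < U a ∧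
      ContDiffOn ℝ 1 S (Icc (U b) (U a)) ∧
      ∀ x ∈ Icc (U b) (U a), HasDerivAt S (dU (S x))⁻¹ x := by
  -- Freezing the derivative outside [a, b] prolongs U to a C¹ strictly decreasing function of the
  -- line, so the inverse has a two-sided derivative even at the ends.
  set d : ℝ → ℝ := fun T => dU (projIcc a b hab.le T) with hdd
  have hdc : Continuous d := hdU.comp_continuous (continuous_subtype_val.comp continuous_projIcc)
    (fun T => (projIcc a b hab.le T).2)
  have hd_in : ∀ T ∈ Icc a b, d T = dU T := by
    intro T hT; simp only [hdd, projIcc_of_mem hab.le hT]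
  have hdneg : ∀ T, d T < 0 := fun T => hneg _ (projIcc a b hab.le T).2
  obtain ⟨V, hVa, hV⟩ := exists_antideriv hdc a (U a)
  have hVc : Continuous V := continuous_iff_continuousAt.2 fun y => (hV y).continuousAt
  have hVU : ∀ T ∈ Icc a b, V T = U T := by
    intro T hT
    refine eq_of_hasDerivAt_eq (f' := d) hVc.continuousOn hU (fun x _ => hV x) ?_
      (left_mem_Icc.2 hab.le) hVa hT
    intro x hx
    rw [hd_in x (Ioo_subset_Icc_self hx)]
    exact hd x hx
  have hVanti : StrictAnti V := strictAnti_of_hasDerivAt_neg hV hdneg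
  obtain ⟨S, hSc, -, -, hSi, hSr, -, -⟩ := exists_clamped_inverse
    (show a - 1 ≤ b + 1 by linarith) hVc.continuousOn (hVanti.strictAntiOn _)
  have ha : a ∈ Icc a b := left_mem_Icc.2 hab.le
  have hb : b ∈ Icc a b := right_mem_Icc.2 hab.le
  have hwide : Icc a b ⊆ Icc (a - 1) (b + 1) := Icc_subset_Icc (by linarith) (by linarith)
  have hVb1 : V (b + 1) < U b := by rw [← hVU b hb]; exact hVanti (by linarith)
  have hVa1 : U a < V (a - 1) := by rw [← hVU a ha]; exact hVanti (by linarith)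
  have hVS : ∀ x ∈ Icc (U b) (U a), V (S x) = x := fun x hx =>
    hSr x ⟨hVb1.le.trans hx.1, hx.2.trans hVa1.le⟩
  have hSm : ∀ x ∈ Icc (U b) (U a), S x ∈ Icc a b := by
    intro x hx
    constructor
    · refine hVanti.le_iff_ge.1 ?_
      rw [hVS x hx, hVU a ha]; exact hx.2
    · refine hVanti.le_iff_ge.1 ?_
      rw [hVS x hx, hVU b hb]; exact hx.1
  have hder : ∀ x ∈ Icc (U b) (U a), HasDerivAt S (dU (S x))⁻¹ x := by
    intro x hx
    rw [← hd_in _ (hSm x hx)]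
    refine HasDerivAt.of_local_left_inverse hSc.continuousAt (hV (S x)) (hdneg _).ne ?_
    filter_upwards [Icc_mem_nhds (hVb1.trans_le hx.1) (hx.2.trans_lt hVa1)] with y hy
      using hSr y hy
  have hlt : U b < U a := by rw [← hVU b hb, ← hVU a ha]; exact hVanti hab
  refine ⟨S, fun T hT => ?_, fun x hx => ⟨hSm x hx, ?_⟩, ?_, hlt, ?_, hder⟩
  · rw [← hVU T hT]; exact hSi T (hwide hT)
  · rw [← hVU _ (hSm x hx), hVS x hx]
  · intro x hx
    have hx' := Ioo_subset_Icc_self hx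
    constructor
    · refine hVanti.lt_iff_gt.1 ?_
      rw [hVS x hx', hVU a ha]; exact hx.2
    · refine hVanti.lt_iff_gt.1 ?_
      rw [hVS x hx', hVU b hb]; exact hx.1
  · refine contDiffOn_one_of_hasFDerivWithinAt
      (B' := fun x => ContinuousLinearMap.toSpanSingleton ℝ (d (S x))⁻¹) ?_ ?_
    · have : Continuous fun x => (d (S x))⁻¹ :=
        (hdc.comp hSc).inv₀ (fun x => (hdneg _).ne)
      exact ((ContinuousLinearMap.toSpanSingletonCLE (𝕜 := ℝ) (E := ℝ)).continuous.comp
        this).continuousOn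
    · intro x hx
      have := hder x hx
      rw [← hd_in _ (hSm x hx)] at this
      exact this.hasFDerivAt.hasFDerivWithinAt

section

variable {fp fm : ℝ → ℝ} {ε : ℝ} {p κ dp dκ m dm n dn : ℝ → ℝ}

/-- Since p decreases, a point moving up in the direction (1, 1) stays above the spine, where B is
`upperRib`, affine for fixed x₁ − x₂. -/
lemma upper_extremal {x : ℝ × ℝ} (hx : x ∈ aboveSpine ε p)
    (hp : AntitoneOn p (Icc (-ε) ε)) {Ω : Set (ℝ × ℝ)}
    (hΩ : ∀ P : ℝ × ℝ, P.1 - P.2 = x.1 - x.2 → x.2 ≤ P.2 → P.2 ≤ ε → P ∈ Ω) :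
    ∃ z ∈ stripBoundary ε, IsDiagonal x z ∧ segment ℝ x z ⊆ Ω ∧
      LinearOnSegment (herringboneFun fp fm ε p m n) x z := by
  have hseg : ∀ P ∈ segment ℝ x (x.1 + (ε - x.2), ε), P.1 - P.2 = x.1 - x.2 ∧ x.2 ≤ P.2 ∧
      P.2 ≤ ε := by
    intro P hP
    rw [segment_eq_image'] at hP
    obtain ⟨t, ht, rfl⟩ := hP
    have := hx.1.2
    refine ⟨by simp, ?_, ?_⟩ <;> simp <;> nlinarith [ht.1, ht.2]
  refine ⟨(x.1 + (ε - x.2), ε), Or.inr rfl, Or.inl (by simp), fun P hP => ?_, ?_⟩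
  · obtain ⟨h1, h2, h3⟩ := hseg P hP
    exact hΩ P h1 h2 h3
  · refine LinearOnSegment.congr (B := upperRib fp ε m) ?_ (herringboneFun_above.symm.mono ?_)
    · intro t _
      have e : ((1 - t) • x + t • (x.1 + (ε - x.2), ε)).1 -
          ((1 - t) • x + t • (x.1 + (ε - x.2), ε)).2 = x.1 - x.2 := by simp; ring
      have e' : x.1 + (ε - x.2) - ε = x.1 - x.2 := by ring
      unfold upperRib
      rw [e]
      simp only [e', Prod.snd_add, Prod.smul_snd, smul_eq_mul]
      ring
    · intro P hP
      obtain ⟨h1, h2, h3⟩ := hseg P hP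
      have hP2 : P.2 ∈ Icc (-ε) ε := ⟨hx.1.1.trans h2, h3⟩
      refine ⟨hP2, ?_⟩
      have := hp hx.1 hP2 h2
      linarith [hx.2]

lemma lower_extremal (h : IsSpineParam (deriv fp) (deriv fm) ε p κ dp dκ)
    (k : IsRibSlope fp fm ε p κ m dm n dn) {x : ℝ × ℝ} (hx : x ∈ belowSpine ε p)
    {Ω : Set (ℝ × ℝ)}
    (hΩ : ∀ P : ℝ × ℝ, P.1 + P.2 = x.1 + x.2 → P.2 ≤ x.2 → -ε ≤ P.2 → P ∈ Ω) :
    ∃ z ∈ stripBoundary ε, IsDiagonal x z ∧ segment ℝ x z ⊆ Ω ∧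
      LinearOnSegment (herringboneFun fp fm ε p m n) x z := by
  have hseg : ∀ P ∈ segment ℝ x (x.1 + (ε + x.2), -ε), P.1 + P.2 = x.1 + x.2 ∧ P.2 ≤ x.2 ∧
      -ε ≤ P.2 := by
    intro P hP
    rw [segment_eq_image'] at hP
    obtain ⟨t, ht, rfl⟩ := hP
    have := hx.1.1
    refine ⟨by simp; ring, ?_, ?_⟩ <;> simp <;> nlinarith [ht.1, ht.2]
  refine ⟨(x.1 + (ε + x.2), -ε), Or.inl rfl, Or.inr (by simp; ring), fun P hP => ?_, ?_⟩
  · obtain ⟨h1, h2, h3⟩ := hseg P hP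
    exact hΩ P h1 h2 h3
  · refine LinearOnSegment.congr (B := lowerRib fm ε n) ?_ ((herringboneFun_below h k).symm.mono ?_)
    · intro t _
      have e : ((1 - t) • x + t • (x.1 + (ε + x.2), -ε)).1 +
          ((1 - t) • x + t • (x.1 + (ε + x.2), -ε)).2 = x.1 + x.2 := by simp; ring
      have e' : x.1 + (ε + x.2) + -ε = x.1 + x.2 := by ring
      unfold lowerRib
      rw [e]
      simp only [e', Prod.snd_add, Prod.smul_snd, smul_eq_mul]
      ring
    · intro P hP
      obtain ⟨h1, h2, h3⟩ := hseg P hP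
      have hP2 : P.2 ∈ Icc (-ε) ε := ⟨h3, h2.trans hx.1.2⟩
      refine ⟨hP2, ?_⟩
      have := h.q_anti.antitoneOn hP2 hx.1 h2
      linarith [hx.2]

/-- A set that contains, with every point, a rib joining it to the boundary of the strip. -/
def IsRibClosed (ε : ℝ) (p : ℝ → ℝ) (Ω : Set (ℝ × ℝ)) : Prop :=
  ∀ x ∈ Ω,
    (x ∈ aboveSpine ε p ∧ ∀ P : ℝ × ℝ, P.1 - P.2 = x.1 - x.2 → x.2 ≤ P.2 → P.2 ≤ ε → P ∈ Ω) ∨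
    (x ∈ belowSpine ε p ∧ ∀ P : ℝ × ℝ, P.1 + P.2 = x.1 + x.2 → P.2 ≤ x.2 → -ε ≤ P.2 → P ∈ Ω)

lemma IsRibClosed.union {Ω Ω' : Set (ℝ × ℝ)} (h : IsRibClosed ε p Ω) (h' : IsRibClosed ε p Ω') :
    IsRibClosed ε p (Ω ∪ Ω') := by
  rintro x (hx | hx)
  · rcases h x hx with ⟨h1, h2⟩ | ⟨h1, h2⟩
    · exact Or.inl ⟨h1, fun P a b c => Or.inl (h2 P a b c)⟩
    · exact Or.inr ⟨h1, fun P a b c => Or.inl (h2 P a b c)⟩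
  · rcases h' x hx with ⟨h1, h2⟩ | ⟨h1, h2⟩
    · exact Or.inl ⟨h1, fun P a b c => Or.inr (h2 P a b c)⟩
    · exact Or.inr ⟨h1, fun P a b c => Or.inr (h2 P a b c)⟩

/-- Every point lies on a rib that reaches the boundary of the strip, so the first alternative of
`extremal` always applies. -/
lemma herringboneFun_candidate (h : IsSpineParam (deriv fp) (deriv fm) ε p κ dp dκ)
    (k : IsRibSlope fp fm ε p κ m dm n dn) {δ : ℝ}
    (hconc : DiagonallyConcaveOn (wideRegion ε p δ) (herringboneFun fp fm ε p m n))
    {Ω : Set (ℝ × ℝ)} (hΩ : Ω ⊆ wideRegion ε p δ) (hrib : IsRibClosed ε p Ω) :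
    IsBellmanCandidate fp fm ε Ω (herringboneFun fp fm ε p m n) := by
  have hε := h.pos
  refine ⟨fun x hx => (hΩ hx).1, hconc.mono hΩ, fun t ht => ?_, fun t ht => ?_, fun y hy => ?_⟩
  · by_cases hc : p ε + ε - ε ≤ t
    · rw [herringboneFun_above (p := p) (x := (t, ε)) ⟨(hΩ ht).1, hc⟩]
      simp [upperRib]
    -- An upper boundary point below the spine belongs to the left simple foliation, where n is the
    -- standard slope, and this slope reproduces the value of fp at the other end of the segment.
    · push Not at hc
      rw [herringboneFun_below h k (x := (t, ε)) ⟨(hΩ ht).1, hc.le⟩]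
      simp only [lowerRib]
      rw [k.n_left _ (by linarith)]
      field_simp
      ring_nf
  · by_cases hc : p (-ε) + -ε - ε ≤ t
    · rw [herringboneFun_above (p := p) (x := (t, -ε)) ⟨(hΩ ht).1, hc⟩]
      simp only [upperRib]
      rw [k.m_right _ (by linarith)]
      field_simp
      ring_nf
    · push Not at hc
      rw [herringboneFun_below h k (x := (t, -ε)) ⟨(hΩ ht).1, hc.le⟩]
      simp [lowerRib]
  · rcases hrib y hy with ⟨h1, h2⟩ | ⟨h1, h2⟩
    · exact Or.inl (upper_extremal h1 h.p_anti.antitoneOn h2)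
    · exact Or.inl (lower_extremal h k h1 h2)

/-- The minimum of p + 2T is attained at T = ε, so this whole region lies below the spine, in the
range where n is the standard slope. -/
lemma leftRegion_eqOn (h : IsSpineParam (deriv fp) (deriv fm) ε p κ dp dκ)
    (k : IsRibSlope fp fm ε p κ m dm n dn) (l : ℝ) :
    EqOn (herringboneFun fp fm ε p m n) (leftStandard fp fm ε) (leftRegion ε l (p ε + ε)) ∧
    leftRegion ε l (p ε + ε) ⊆ belowSpine ε p := by
  have hε := h.pos
  have hsub : leftRegion ε l (p ε + ε) ⊆ belowSpine ε p := by
    intro x hx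
    refine ⟨hx.1, ?_⟩
    have := h.q_anti.antitoneOn hx.1 (right_mem_Icc.2 h.neg_le) hx.1.2
    linarith [hx.2.2]
  refine ⟨fun x hx => ?_, hsub⟩
  rw [herringboneFun_below h k (hsub hx)]
  simp only [lowerRib, leftStandard]
  rw [k.n_left _ hx.2.2]
  field_simp
  ring

lemma rightRegion_eqOn (h : IsSpineParam (deriv fp) (deriv fm) ε p κ dp dκ)
    (k : IsRibSlope fp fm ε p κ m dm n dn) (r : ℝ) :
    EqOn (herringboneFun fp fm ε p m n) (rightStandard fp fm ε) (rightRegion ε (p (-ε) - ε) r) ∧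
    rightRegion ε (p (-ε) - ε) r ⊆ aboveSpine ε p := by
  have hε := h.pos
  have hsub : rightRegion ε (p (-ε) - ε) r ⊆ aboveSpine ε p := by
    intro x hx
    refine ⟨hx.1, ?_⟩
    have := h.p_anti.antitoneOn (left_mem_Icc.2 h.neg_le) hx.1 hx.1.1
    linarith [hx.2.1]
  refine ⟨fun x hx => ?_, hsub⟩
  rw [herringboneFun_above (hsub hx)]
  simp only [upperRib, rightStandard]
  rw [k.m_right _ hx.2.1]
  field_simp
  ring

/-- A parametrized spine, together with the concavity of the standard candidates beyond its ends,
gives a herringbone that is glued to the two simple foliations. -/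
theorem IsSpineParam.exists_herringbone (hfp : ContDiff ℝ 3 fp) (hfm : ContDiff ℝ 3 fm)
    (h : IsSpineParam (deriv fp) (deriv fm) ε p κ dp dκ) {δ : ℝ} (hδ : 0 < δ)
    (hR : ∀ y ∈ Icc (p (-ε) - ε) (p (-ε) - ε + δ),
      deriv (deriv fp) (y + ε) ≤ (deriv fp (y + ε) - deriv fm (y - ε)) / (2 * ε) ∧
      deriv (deriv fm) (y - ε) ≤ (deriv fp (y + ε) - deriv fm (y - ε)) / (2 * ε))
    (hL : ∀ z ∈ Icc (p ε + ε - δ) (p ε + ε),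
      deriv (deriv fm) (z + ε) ≤ (deriv fm (z + ε) - deriv fp (z - ε)) / (2 * ε) ∧
      deriv (deriv fp) (z - ε) ≤ (deriv fm (z + ε) - deriv fp (z - ε)) / (2 * ε))
    {u v u₀ : ℝ} (hu : u = p ε + ε) (hv : v = p (-ε) - ε) (hu₀ : u₀ = p 0) :
    ∃ T : ℝ → ℝ, ∃ B : ℝ × ℝ → ℝ,
      IsSpine ε T (u - ε) (v - ε) ∧
      T (u₀ - ε) = 0 ∧ T (u - ε) = ε ∧ T (v - ε) = -ε ∧
      IsRightHerringboneFun fp fm ε T (rightSpineValue fp fm ε T) (u - ε) (v - ε) B ∧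
      IsBellmanCandidate fp fm ε (rightHerringboneRegion ε T (u - ε) (v - ε)) B ∧
      IsC1Gluing fp fm ε (rightHerringboneRegion ε T (u - ε) (v - ε)) B (u - δ) u v (v + δ) := by
  have hε := h.pos
  have hε0 := hε.ne'
  have hmem1 : -ε ∈ Icc (-ε) ε := left_mem_Icc.2 h.neg_le
  have hmem2 : ε ∈ Icc (-ε) ε := right_mem_Icc.2 h.neg_le
  have hfp2 : ContDiff ℝ 2 fp := hfp.of_le (by norm_num)
  have hfm2 : ContDiff ℝ 2 fm := hfm.of_le (by norm_num)
  have ha : Differentiable ℝ (deriv fp) := by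
    have : ContDiff ℝ (1 + 1) fp := by simpa [one_add_one_eq_two] using hfp2
    exact (contDiff_succ_iff_deriv.1 this).2.2.differentiable (by norm_num)
  have hb : Differentiable ℝ (deriv fm) := by
    have : ContDiff ℝ (1 + 1) fm := by simpa [one_add_one_eq_two] using hfm2
    exact (contDiff_succ_iff_deriv.1 this).2.2.differentiable (by norm_num)
  obtain ⟨m, dm, n, dn, k⟩ := h.exists_ribSlope hfp2 hfm2
  have hconc := herringboneFun_concave hfp hfm h k hR hL
  obtain ⟨B', -, -, hB'c, hB'⟩ := k.exists_gradient hfp2 hfm2 h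
  have hsmooth := contDiffOn_one_of_hasFDerivWithinAt hB'c hB'
  have hdpneg : ∀ T ∈ Icc (-ε) ε, dp T ≤ -2 := by
    intro T hT
    rcases hT.1.eq_or_lt with e | e
    · rw [← e]; exact h.dp_le
    · exact (h.dp_lt T ⟨e, hT.2⟩).le
  -- The graph form of the spine inverts the abscissa p + T − ε as a function of the height.
  obtain ⟨S, hS1, hS2, hS3, hlt, hSC, hSd⟩ := exists_contDiffOn_inverse (a := -ε) (b := ε)
    (by linarith) (U := fun T => p T + T - ε) (dU := fun T => dp T + 1)
    ((h.p_cont.add continuousOn_id).sub continuousOn_const)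
    (h.dp_cont.add continuousOn_const)
    (fun T hT => ((h.p_deriv T hT).add (hasDerivAt_id T)).sub_const ε)
    (fun T hT => by linarith [hdpneg T hT])
  have eu : p ε + ε - ε = u - ε := by rw [hu]
  have ev : p (-ε) + -ε - ε = v - ε := by rw [hv]; ring
  simp only [eu, ev] at hS2 hS3 hlt hSC hSd
  have hder : ∀ x ∈ Icc (u - ε) (v - ε), derivWithin S (Icc (u - ε) (v - ε)) x =
      (dp (S x) + 1)⁻¹ := fun x hx =>
    (hSd x hx).hasDerivWithinAt.derivWithin (uniqueDiffOn_Icc hlt x hx)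
  have habs : ∀ x ∈ Icc (u - ε) (v - ε), |(dp (S x) + 1)⁻¹| = (-(dp (S x) + 1))⁻¹ := by
    intro x hx
    have := hdpneg _ (hS2 x hx).1
    rw [abs_inv, abs_of_neg (by linarith)]
  have hspine : IsSpine ε S (u - ε) (v - ε) := by
    refine ⟨hlt, hSC, hS3, fun x hx => ?_, ?_⟩
    · rw [hder x hx, habs x hx]
      have := hdpneg _ (hS2 x hx).1
      exact inv_le_one_of_one_le₀ (by linarith)
    -- The slope is 1/(dp + 1), of modulus 1 only where dp = −2; by `dp_lt` this can happen only at
    -- T = −ε, the right end.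
    · refine (finite_singleton (v - ε)).subset ?_
      rintro x ⟨hx, hx1⟩
      rw [hder x hx, habs x hx, inv_eq_one] at hx1
      have h1 : S x = -ε := by
        by_contra hne
        have := h.dp_lt (S x) ⟨lt_of_le_of_ne (hS2 x hx).1.1 (Ne.symm hne), (hS2 x hx).1.2⟩
        linarith
      have h2 := (hS2 x hx).2
      rw [h1, ev] at h2
      exact h2.symm
  have hmono : ∀ x ∈ Icc (u - ε) (v - ε), ∀ s, S x ≤ s → s ≤ ε →
      (x - S x + s, s) ∈ aboveSpine ε p := by
    intro x hx s hs hsε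
    obtain ⟨h1, h2⟩ := hS2 x hx
    have hsm : s ∈ Icc (-ε) ε := ⟨h1.1.trans hs, hsε⟩
    refine ⟨hsm, ?_⟩
    have := h.p_anti.antitoneOn h1 hsm hs
    simp only
    linarith
  have hmono' : ∀ x ∈ Icc (u - ε) (v - ε), ∀ s, -ε ≤ s → s ≤ S x →
      (x + S x - s, s) ∈ belowSpine ε p := by
    intro x hx s hsε hs
    obtain ⟨h1, h2⟩ := hS2 x hx
    have hsm : s ∈ Icc (-ε) ε := ⟨hsε, hs.trans h1.2⟩
    refine ⟨hsm, ?_⟩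
    have := h.q_anti.antitoneOn hsm h1 hs
    simp only at this ⊢
    linarith
  have hvalue : ∀ x ∈ Icc (u - ε) (v - ε),
      rightSpineValue fp fm ε S x = upperRib fp ε m (x, S x) ∧
      upperRib fp ε m (x, S x) = lowerRib fm ε n (x, S x) := by
    intro x hx
    obtain ⟨h1, h2⟩ := hS2 x hx
    have hmem : (x, S x) ∈ aboveSpine ε p ∩ belowSpine ε p := ⟨⟨h1, h2.le⟩, ⟨h1, h2.ge⟩⟩
    obtain ⟨r1, r2⟩ := k.rib_eq h hmem
    refine ⟨?_, r1⟩
    rw [r2]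
    simp only
    have hrel := h.rel _ h1
    have ep : x - S x + ε = p (S x) := by linarith
    have eq : x + S x + ε = p (S x) + 2 * S x := by linarith
    unfold rightSpineValue
    split_ifs with h0
    -- At height 0 the relation `rel` no longer determines κ; its derivative, the first part of
    -- `ode_q`, does.
    · have hT0 : (0:ℝ) ∈ Ioo (-ε) ε := ⟨by linarith, hε⟩
      have e1 := (h.ode_q ha hb hT0).1
      rw [h0] at ep eq hrel
      simp only [mul_zero, add_zero, zero_mul, sub_zero] at ep eq hrel e1
      rw [(hSd x hx).deriv, h0, ep]
      have e2 : ∀ f : ℝ → ℝ, iteratedDeriv 2 f = deriv (deriv f) := by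
        intro f; rw [iteratedDeriv_succ, iteratedDeriv_one]
      rw [e2, e2]
      have hdp := hdpneg 0 (Ioo_subset_Icc_self hT0)
      have hne : dp 0 + 1 ≠ 0 := by linarith
      simp only [mul_zero, add_zero, sub_zero]
      field_simp
      linear_combination (-ε ^ 2) * hrel + ε ^ 3 * e1
    · rw [ep, eq]
      generalize deriv fm (p (S x) + 2 * S x) = b at *
      obtain rfl : b = deriv fp (p (S x)) + 2 * S x * κ (S x) := by linarith
      field_simp
      ring
  have hfun : IsRightHerringboneFun fp fm ε S (rightSpineValue fp fm ε S) (u - ε) (v - ε)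
      (herringboneFun fp fm ε p m n) := by
    refine ⟨fun x hx => ?_, fun x hx s hs hsε => ?_, fun x hx s hsε hs => ?_⟩
    · have hmem := hmono x hx (S x) le_rfl (hS2 x hx).1.2
      rw [sub_add_cancel] at hmem
      rw [herringboneFun_above hmem, (hvalue x hx).1]
    · rw [herringboneFun_above (hmono x hx s hs.le hsε), (hvalue x hx).1]
      have hne : ε - S x ≠ 0 := by linarith
      simp only [upperRib, add_sub_cancel_right]
      field_simp
      ring
    · rw [herringboneFun_below h k (hmono' x hx s hsε hs.le), (hvalue x hx).1, (hvalue x hx).2]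
      have hne : ε + S x ≠ 0 := by linarith
      simp only [lowerRib, sub_add_cancel]
      field_simp
      ring
  -- This gap keeps each simple foliation on the admissible side of the line that bounds
  -- `wideRegion` at the other end.
  have huv : u + 2 * ε < v := by
    have := h.q_anti hmem1 hmem2 (by linarith)
    simp only at this
    linarith
  have hwideL : leftRegion ε (u - δ) u ⊆ wideRegion ε p δ := by
    rintro x ⟨hx, h1, h2⟩
    exact ⟨hx, by linarith, by linarith [hx.1]⟩
  have hwideR : rightRegion ε v (v + δ) ⊆ wideRegion ε p δ := by
    rintro x ⟨hx, h1, h2⟩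
    exact ⟨hx, by linarith [hx.1], by linarith⟩
  have hwideH : rightHerringboneRegion ε S (u - ε) (v - ε) ⊆ wideRegion ε p δ := by
    rintro x ⟨w, hw, ⟨h1, h2, h3⟩ | ⟨h1, h2, h3⟩⟩ <;> obtain ⟨h4, h5⟩ := hS2 w hw
    · have p1 := h.p_anti.antitoneOn hmem1 h4 h4.1
      have p2 := h.q_anti.antitoneOn h4 hmem2 h4.2
      exact ⟨⟨h4.1.trans h2, h3⟩, by linarith, by linarith⟩
    · have p1 := h.q_anti.antitoneOn hmem1 h4 h4.1
      have p2 := h.q_anti.antitoneOn h4 hmem2 h4.2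
      exact ⟨⟨h2, h3.trans h4.2⟩, by linarith, by linarith⟩
  have hribL : IsRibClosed ε p (leftRegion ε (u - δ) u) := by
    intro x hx
    refine Or.inr ⟨(leftRegion_eqOn h k (u - δ)).2 (by rw [← hu]; exact hx), fun P h1 h2 h3 => ?_⟩
    exact ⟨⟨h3, h2.trans hx.1.2⟩, by rw [h1]; exact hx.2.1, by rw [h1]; exact hx.2.2⟩
  have hribR : IsRibClosed ε p (rightRegion ε v (v + δ)) := by
    intro x hx
    refine Or.inl ⟨(rightRegion_eqOn h k (v + δ)).2 (by rw [← hv]; exact hx), fun P h1 h2 h3 => ?_⟩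
    exact ⟨⟨hx.1.1.trans h2, h3⟩, by rw [h1]; exact hx.2.1, by rw [h1]; exact hx.2.2⟩
  have hribH : IsRibClosed ε p (rightHerringboneRegion ε S (u - ε) (v - ε)) := by
    rintro x ⟨w, hw, ⟨h1, h2, h3⟩ | ⟨h1, h2, h3⟩⟩
    · left
      have := hmono w hw x.2 h2 h3
      rw [show (w - S w + x.2, x.2) = x from Prod.ext (by simp only; linarith) rfl] at this
      refine ⟨this, fun P a b c => ⟨w, hw, Or.inl ⟨a.trans h1, h2.trans b, c⟩⟩⟩
    · right
      have := hmono' w hw x.2 h2 h3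
      rw [show (w + S w - x.2, x.2) = x from Prod.ext (by simp only; linarith) rfl] at this
      refine ⟨this, fun P a b c => ⟨w, hw, Or.inr ⟨a.trans h1, c, b.trans h3⟩⟩⟩
  have hcand := fun {Ω : Set (ℝ × ℝ)} => herringboneFun_candidate h k hconc (Ω := Ω)
  have hLeq : EqOn (herringboneFun fp fm ε p m n) (leftStandard fp fm ε)
      (leftRegion ε (u - δ) u) := by rw [hu]; exact (leftRegion_eqOn h k _).1
  have hReq : EqOn (herringboneFun fp fm ε p m n) (rightStandard fp fm ε)
      (rightRegion ε v (v + δ)) := by rw [hv]; exact (rightRegion_eqOn h k _).1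
  have hunion := union_subset (union_subset hwideH hwideL) hwideR
  refine ⟨S, herringboneFun fp fm ε p m n, hspine, ?_, ?_, ?_, hfun, hcand hwideH hribH,
    (hcand hwideL hribL).congr hLeq, (hcand hwideR hribR).congr hReq, hLeq, hReq,
    hcand hunion ((hribH.union hribL).union hribR), hsmooth.mono (hunion.trans fun x hx => hx.1)⟩
  · have := hS1 0 ⟨by linarith, hε.le⟩
    simpa [hu₀] using this
  · have := hS1 ε hmem2
    simpa [eu] using this
  · have := hS1 (-ε) hmem1
    simpa only [ev] using this

end

end DiagonalStrip

/-! ### A singular ordinary differential equation. -/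

namespace DiagonalStrip

/-- The regular solution of the singular equation `t χ' = h t χ - 3 χ`. -/
lemma exists_regular_solution {h : ℝ → ℝ → ℝ} (hc : Continuous (Function.uncurry h)) {x₀ r : ℝ}
    (hr : ∀ t x, |h t x - 3 * x₀| ≤ r) (hL : ∀ t x y, |h t x - h t y| ≤ |x - y| / 2) :
    ∃ χ : ℝ → ℝ, Continuous χ ∧ (∀ t, |χ t - x₀| ≤ r) ∧
      ∀ t, 0 < t → HasDerivAt (fun t => t * χ t) (h t (χ t) - 2 * χ t) t := by
  have hcomp : ∀ χ : ℝ → ℝ, Continuous χ →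
      Continuous (Function.uncurry fun t s : ℝ => s ^ 2 * h (s * t) (χ (s * t))) := by
    intro χ hχ
    have : Continuous fun x : ℝ × ℝ => Function.uncurry h (x.2 * x.1, χ (x.2 * x.1)) :=
      hc.comp (by fun_prop)
    exact (by fun_prop : Continuous fun x : ℝ × ℝ => x.2 ^ 2).mul this
  have hcont : ∀ χ : ℝ → ℝ, Continuous χ →
      Continuous fun t => ∫ s in (0:ℝ)..1, s ^ 2 * h (s * t) (χ (s * t)) := fun χ hχ =>
    intervalIntegral.continuous_parametric_intervalIntegral_of_continuous' (hcomp χ hχ) 0 1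
  have hint : ∀ χ : ℝ → ℝ, Continuous χ → ∀ t, IntervalIntegrable
      (fun s : ℝ => s ^ 2 * h (s * t) (χ (s * t))) MeasureTheory.volume 0 1 := by
    intro χ hχ t
    have : Continuous fun s : ℝ => s ^ 2 * h (s * t) (χ (s * t)) :=
      (hcomp χ hχ).comp (by fun_prop : Continuous fun s : ℝ => (t, s))
    exact this.intervalIntegrable _ _
  have hsq : ∀ s ∈ uIoc (0:ℝ) 1, s ^ 2 ≤ 1 := by
    intro s hs
    rw [uIoc_of_le zero_le_one] at hs
    nlinarith [hs.1, hs.2]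
  have hbd : ∀ χ : ℝ → ℝ, Continuous χ → ∀ t,
      |(∫ s in (0:ℝ)..1, s ^ 2 * h (s * t) (χ (s * t))) - x₀| ≤ r := by
    intro χ hχ t
    -- The weight s² has integral 1/3, which is why h is compared with 3x₀.
    have e : x₀ = ∫ s in (0:ℝ)..1, s ^ 2 * (3 * x₀) := by
      rw [intervalIntegral.integral_mul_const, integral_pow]; norm_num; ring
    have hi : IntervalIntegrable (fun s : ℝ => s ^ 2 * (3 * x₀)) MeasureTheory.volume 0 1 :=
      (by fun_prop : Continuous fun s : ℝ => s ^ 2 * (3 * x₀)).intervalIntegrable _ _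
    conv_lhs => rw [e]
    rw [← intervalIntegral.integral_sub (hint χ hχ t) hi]
    have hC : r * |(1:ℝ) - 0| ≤ r := by simp
    rw [← Real.norm_eq_abs]
    refine le_trans (intervalIntegral.norm_integral_le_of_norm_le_const (C := r) fun s hs => ?_) hC
    rw [← mul_sub, norm_mul, Real.norm_of_nonneg (sq_nonneg s), Real.norm_eq_abs]
    exact (mul_le_of_le_one_left (abs_nonneg _) (hsq s hs)).trans (hr _ _)
  -- The equation is (t³χ)' = t²h(t, χ). Integrating from 0 and rescaling the variable to [0, 1]
  -- gives this fixed-point form, which excludes the solutions singular like t⁻³.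
  set Φ : BoundedContinuousFunction ℝ ℝ → BoundedContinuousFunction ℝ ℝ := fun χ =>
    BoundedContinuousFunction.ofNormedAddCommGroup
      (fun t => ∫ s in (0:ℝ)..1, s ^ 2 * h (s * t) (χ (s * t))) (hcont χ χ.continuous) (|x₀| + r)
      (fun t => by
        have h1 := hbd χ χ.continuous t
        have h2 := abs_sub_abs_le_abs_sub (∫ s in (0:ℝ)..1, s ^ 2 * h (s * t) (χ (s * t))) x₀
        rw [Real.norm_eq_abs]
        linarith) with hΦ
  have hΦ_apply : ∀ χ t, Φ χ t = ∫ s in (0:ℝ)..1, s ^ 2 * h (s * t) (χ (s * t)) :=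
    fun χ t => rfl
  have hcontr : ContractingWith (1 / 2) Φ := by
    refine ⟨by norm_num, LipschitzWith.of_dist_le_mul fun χ ψ => ?_⟩
    rw [BoundedContinuousFunction.dist_le (by positivity)]
    intro t
    rw [Real.dist_eq, hΦ_apply, hΦ_apply,
      ← intervalIntegral.integral_sub (hint χ χ.continuous t) (hint ψ ψ.continuous t)]
    have hC : dist χ ψ / 2 * |(1:ℝ) - 0| ≤ ((1 / 2 : NNReal) : ℝ) * dist χ ψ := by
      simp; linarith
    rw [← Real.norm_eq_abs]
    refine le_trans (intervalIntegral.norm_integral_le_of_norm_le_const (C := dist χ ψ / 2)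
      fun s hs => ?_) hC
    rw [← mul_sub, norm_mul, Real.norm_of_nonneg (sq_nonneg s), Real.norm_eq_abs]
    refine (mul_le_of_le_one_left (abs_nonneg _) (hsq s hs)).trans ((hL _ _ _).trans ?_)
    have := BoundedContinuousFunction.dist_coe_le_dist (f := χ) (g := ψ) (s * t)
    rw [Real.dist_eq] at this
    linarith
  set χ := ContractingWith.fixedPoint Φ hcontr with hχ
  have hfix : Φ χ = χ := hcontr.fixedPoint_isFixedPt
  have hval : ∀ t, χ t = ∫ s in (0:ℝ)..1, s ^ 2 * h (s * t) (χ (s * t)) := by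
    intro t; rw [← hΦ_apply, hfix]
  refine ⟨χ, χ.continuous, fun t => ?_, fun t ht => ?_⟩
  · rw [hval t]; exact hbd χ χ.continuous t
  · have hg : Continuous fun s => s ^ 2 * h s (χ s) := by
      have : Continuous fun s : ℝ => Function.uncurry h (s, χ s) :=
        hc.comp (continuous_id.prodMk χ.continuous)
      exact (continuous_pow 2).mul this
    have hcube : ∀ t, t ^ 3 * χ t = ∫ s in (0:ℝ)..t, s ^ 2 * h s (χ s) := by
      intro t
      have := intervalIntegral.mul_integral_comp_mul_right (a := 0) (b := 1)
        (f := fun s => s ^ 2 * h s (χ s)) t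
      rw [zero_mul, one_mul] at this
      rw [← this, hval t, ← intervalIntegral.integral_const_mul,
        ← intervalIntegral.integral_const_mul]
      congr 1
      ext s
      ring
    have hd : HasDerivAt (fun t => t ^ 3 * χ t) (t ^ 2 * h t (χ t)) t := by
      rw [show (fun t => t ^ 3 * χ t) = fun t => ∫ s in (0:ℝ)..t, s ^ 2 * h s (χ s) from
        funext hcube]
      exact intervalIntegral.integral_hasDerivAt_right (hg.intervalIntegrable _ _)
        (hg.stronglyMeasurableAtFilter _ _) hg.continuousAt
    have hq := hd.div (hasDerivAt_pow 2 t) (by positivity)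
    have hev : (fun t => t * χ t) =ᶠ[𝓝 t] ((fun t => t ^ 3 * χ t) / fun x => x ^ 2) := by
      filter_upwards [lt_mem_nhds ht] with s hs
      simp only [Pi.div_apply]
      field_simp
    refine (hq.congr_of_eventuallyEq hev).congr_deriv ?_
    simp only [Nat.cast_ofNat]
    field_simp
    norm_num
    ring

/-- The antiderivative-free form used for the spine: a function `G` of `(T, w, χ)` that is
strictly differentiable at `(0, 0, x₀)` and stationary in `χ` there governs, on every sufficiently
short interval, a solution of the singular equation. -/
lemma exists_short_solution {G : ℝ × ℝ × ℝ → ℝ} {x₀ : ℝ} {L : ℝ × ℝ × ℝ →L[ℝ] ℝ}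
    (hG : HasStrictFDerivAt G L (0, 0, x₀)) (hL : L (0, 0, 1) = 0) (hG₀ : G (0, 0, x₀) = 3 * x₀)
    (hGc : ∀ᶠ z in 𝓝 ((0 : ℝ), (0 : ℝ), x₀), ContinuousAt G z) {r : ℝ} (hr : 0 < r) :
    ∃ ε₀ > 0, ∀ ε, 0 < ε → ε < ε₀ → ∃ χ : ℝ → ℝ, Continuous χ ∧ (∀ t, |χ t - x₀| ≤ r) ∧
      ∀ t ∈ Ioo 0 (2 * ε), HasDerivAt (fun t => t * χ t)
        (G (ε - t, t * χ t, χ t) - 2 * χ t) t := by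
  -- Strict differentiability makes G − L Lipschitz with constant 1/4 near the point; the other
  -- quarter of the required constant 1/2 is left for L.
  have hlin := hG.isLittleO.bound (show (0:ℝ) < 1 / 4 by norm_num)
  rw [nhds_prod_eq] at hlin
  obtain ⟨s, hs, hlin'⟩ := Filter.mem_prod_same_iff.1 hlin
  have hlin : ∀ x ∈ s, ∀ y ∈ s, ‖G x - G y - L (x - y)‖ ≤ 1 / 4 * ‖x - y‖ :=
    fun x hx y hy => hlin' (mk_mem_prod hx hy)
  obtain ⟨ρ, hρ, hball⟩ := Metric.mem_nhds_iff.1 (Filter.inter_mem hs hGc)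
  set r' := min r (ρ / 2) with hr'
  have hr'0 : 0 < r' := by positivity
  set M := |x₀| + r' + 1 with hM
  have hM0 : 0 < M := by positivity
  have hLn := norm_nonneg L
  -- The three bounds on ε serve, in order, the Lipschitz estimate, the inclusion of all arguments
  -- in the ball of radius ρ, and the distance of the field from 3x₀.
  refine ⟨min (1 / (8 * (‖L‖ + 1))) (min (ρ / (8 * M)) (r' / (16 * M * (‖L‖ + 1)))), by positivity,
    fun ε hε hε'' => ?_⟩
  have hε' := hε''.trans_le (min_le_right _ _)
  have hε0 : ε * (8 * (‖L‖ + 1)) < 1 := by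
    rw [← lt_div_iff₀ (by positivity)]; exact hε''.trans_le (min_le_left _ _)
  have hε1 : ε * (8 * M) < ρ := by
    rw [← lt_div_iff₀ (by positivity)]; exact hε'.trans_le (min_le_left _ _)
  have hε2 : ε * (16 * M * (‖L‖ + 1)) < r' := by
    rw [← lt_div_iff₀ (by positivity)]; exact hε'.trans_le (min_le_right _ _)
  have hM1 : 1 ≤ M := by rw [hM]; linarith [abs_nonneg x₀]
  have h0 : (0:ℝ) ≤ 2 * ε := by linarith
  have h1 : x₀ - r' ≤ x₀ + r' := by linarith
  -- Clamping t and χ makes the field global with uniform bounds; on (0, 2ε) the solution found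
  -- never feels the clamps.
  set ct : ℝ → ℝ := fun t => projIcc 0 (2 * ε) h0 t with hct
  set cx : ℝ → ℝ := fun x => projIcc (x₀ - r') (x₀ + r') h1 x with hcx
  have hctm : ∀ t, ct t ∈ Icc 0 (2 * ε) := fun t => (projIcc 0 (2 * ε) h0 t).2
  have hcxm : ∀ x, |cx x - x₀| ≤ r' := by
    intro x
    have := (projIcc (x₀ - r') (x₀ + r') h1 x).2
    rw [abs_le]; constructor <;> linarith [this.1, this.2]
  have hcxM : ∀ x, |cx x| ≤ M := by
    intro x
    have := abs_sub_abs_le_abs_sub (cx x) x₀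
    linarith [hcxm x]
  have hctc : Continuous ct := continuous_subtype_val.comp continuous_projIcc
  have hcxc : Continuous cx := continuous_subtype_val.comp continuous_projIcc
  set z : ℝ → ℝ → ℝ × ℝ × ℝ := fun t x => (ε - ct t, ct t * cx x, cx x) with hz
  have hεM : 2 * ε * M ≤ ρ / 4 := by linarith
  have hc1 : ∀ t, |ε - ct t| ≤ 2 * ε := by
    intro t; rw [abs_le]; constructor <;> linarith [(hctm t).1, (hctm t).2]
  have hc2 : ∀ t x, |ct t * cx x| ≤ 2 * ε * M := by
    intro t x
    rw [abs_mul, abs_of_nonneg (hctm t).1]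
    exact mul_le_mul (hctm t).2 (hcxM x) (abs_nonneg _) h0
  have hzball : ∀ t x, z t x ∈ Metric.ball ((0:ℝ), (0:ℝ), x₀) ρ := by
    intro t x
    rw [Metric.mem_ball, Prod.dist_eq, Prod.dist_eq, Real.dist_eq, Real.dist_eq, Real.dist_eq]
    simp only [hz, sub_zero]
    refine max_lt ?_ (max_lt ?_ ?_)
    · have := hc1 t; nlinarith
    · have := hc2 t x; linarith
    · have := hcxm x; have := min_le_right r (ρ / 2); linarith
  have hz0 : ((0:ℝ), (0:ℝ), x₀) ∈ s := (hball (Metric.mem_ball_self hρ)).1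
  -- As G is stationary in χ, the variable χ enters L only through tχ, which carries a factor at
  -- most 2ε.
  have hLe : ∀ a b c, L (a, b, c) = L (a, b, 0) := by
    intro a b c
    have : ((a, b, c) : ℝ × ℝ × ℝ) = (a, b, 0) + c • (0, 0, 1) := by simp
    rw [this, map_add, map_smul, hL]; simp
  have hLb : ∀ a b c, |L (a, b, c)| ≤ ‖L‖ * max |a| |b| := by
    intro a b c
    rw [hLe]
    refine (L.le_opNorm _).trans (le_of_eq ?_)
    simp [Prod.norm_def]
  set h : ℝ → ℝ → ℝ := fun t x => G (z t x) with hh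
  have hcont : Continuous (Function.uncurry h) := by
    rw [continuous_iff_continuousAt]
    rintro ⟨t, x⟩
    have hzc : Continuous (Function.uncurry z) := by
      simp only [hz, Function.uncurry_def]; fun_prop
    exact ContinuousAt.comp (f := Function.uncurry z) (g := G)
      (hball (hzball t x)).2 hzc.continuousAt
  have hbound : ∀ t x, |h t x - 3 * x₀| ≤ r' := by
    intro t x
    have e := hlin _ (hball (hzball t x)).1 _ hz0
    rw [Real.norm_eq_abs, hG₀] at e
    simp only [hz, Prod.mk_sub_mk, sub_zero, Prod.norm_def, Real.norm_eq_abs] at e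
    have e2 := hLb (ε - ct t) (ct t * cx x) (cx x - x₀)
    have e3 : max |ε - ct t| |ct t * cx x| ≤ 2 * ε * M :=
      max_le ((hc1 t).trans (by nlinarith)) (hc2 t x)
    have e4 : max |ε - ct t| (max |ct t * cx x| |cx x - x₀|) ≤ 2 * ε * M + r' := by
      have := hc1 t; have := hc2 t x; have := hcxm x
      refine max_le ?_ (max_le ?_ ?_) <;> nlinarith
    have e5 : ‖L‖ * max |ε - ct t| |ct t * cx x| ≤ ‖L‖ * (2 * ε * M) :=
      mul_le_mul_of_nonneg_left e3 hLn
    have e6 : ε * M ≥ 0 := by positivity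
    have e7 : ε * M * ‖L‖ ≥ 0 := by positivity
    simp only [hh, hz]
    rw [abs_le] at e e2 ⊢
    constructor <;> nlinarith
  have hLip : ∀ t x y, |h t x - h t y| ≤ |x - y| / 2 := by
    intro t x y
    have e := hlin _ (hball (hzball t x)).1 _ (hball (hzball t y)).1
    rw [Real.norm_eq_abs] at e
    simp only [hz, Prod.mk_sub_mk, sub_self, Prod.norm_def, Real.norm_eq_abs, ← mul_sub,
      abs_zero] at e
    have hcd : |cx x - cx y| ≤ |x - y| := abs_projIcc_sub_projIcc h1
    have e1 : |ct t * (cx x - cx y)| ≤ 2 * ε * |cx x - cx y| := by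
      rw [abs_mul, abs_of_nonneg (hctm t).1]
      exact mul_le_mul_of_nonneg_right (hctm t).2 (abs_nonneg _)
    have e2 := hLb 0 (ct t * (cx x - cx y)) (cx x - cx y)
    rw [abs_zero, max_eq_right (abs_nonneg _)] at e2
    have e0 := abs_nonneg (cx x - cx y)
    have e3 : max 0 (max |ct t * (cx x - cx y)| |cx x - cx y|) ≤ |cx x - cx y| := by
      refine max_le e0 (max_le (e1.trans ?_) le_rfl)
      have : 2 * ε ≤ 1 := by nlinarith
      exact mul_le_of_le_one_left e0 this
    have e4 : ‖L‖ * |ct t * (cx x - cx y)| ≤ |cx x - cx y| / 4 := by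
      have : ‖L‖ * (2 * ε) ≤ 1 / 4 := by linarith
      calc ‖L‖ * |ct t * (cx x - cx y)| ≤ ‖L‖ * (2 * ε * |cx x - cx y|) :=
            mul_le_mul_of_nonneg_left e1 hLn
        _ = ‖L‖ * (2 * ε) * |cx x - cx y| := by ring
        _ ≤ 1 / 4 * |cx x - cx y| := mul_le_mul_of_nonneg_right this e0
        _ = |cx x - cx y| / 4 := by ring
    simp only [hh, hz]
    rw [abs_le] at e e2 ⊢
    constructor <;> linarith
  obtain ⟨χ, hχ, hχb, hχd⟩ := exists_regular_solution hcont hbound hLip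
  refine ⟨χ, hχ, fun t => (hχb t).trans (min_le_left _ _), fun t ht => ?_⟩
  have := hχd t ht.1
  have e1 : ct t = t := by
    simp only [hct]; rw [projIcc_of_mem h0 (Ioo_subset_Icc_self ht)]
  have e2 : cx (χ t) = χ t := by
    have := abs_le.1 (hχb t)
    simp only [hcx]; rw [projIcc_of_mem h1 ⟨by linarith, by linarith⟩]
  simpa only [hh, hz, e1, e2] using this

end DiagonalStrip

/-! ### Existence of the spine in a thin strip. -/

namespace DiagonalStrip

lemma contDiff_deriv_infty {f : ℝ → ℝ} (hf : ContDiff ℝ ∞ f) : ContDiff ℝ ∞ (deriv f) :=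
  (contDiff_infty_iff_deriv.1 hf).2

/-- The upper end `p` of the rib from the spine point at height `T`, as a function of `T` and of
the slope defect `w`. -/
lemma exists_implicit_endpoint {a b : ℝ → ℝ} (ha : ContDiff ℝ ∞ a) (hb : ContDiff ℝ ∞ b) {u₀ : ℝ}
    (h₀ : a u₀ = b u₀) (h₁ : deriv b u₀ < deriv a u₀) :
    ∃ P : ℝ × ℝ → ℝ, P (0, 0) = u₀ ∧ (∀ᶠ z in 𝓝 ((0 : ℝ), (0 : ℝ)), ContDiffAt ℝ 1 P z) ∧
      ∀ᶠ z in 𝓝 ((0 : ℝ), (0 : ℝ)),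
        a (P z) + 2 * z.1 * deriv a (P z) - b (P z + 2 * z.1) + z.1 * z.2 = 0 := by
  have ha1 := contDiff_deriv_infty ha
  set E : (ℝ × ℝ) × ℝ → ℝ := fun y =>
    a y.2 + 2 * y.1.1 * deriv a y.2 - b (y.2 + 2 * y.1.1) + y.1.1 * y.1.2 with hE
  have hEc : ContDiff ℝ ∞ E := by fun_prop
  have hEc1 : ContDiffAt ℝ 1 E ((0, 0), u₀) := (hEc.of_le (by norm_cast)).contDiffAt
  have hΔ : deriv a u₀ - deriv b u₀ ≠ 0 := (sub_pos.2 h₁).ne'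
  have had : DifferentiableAt ℝ a u₀ := (ha.differentiable (by simp)) u₀
  have hbd : DifferentiableAt ℝ b u₀ := (hb.differentiable (by simp)) u₀
  -- For T = w = 0 the equation reads a(p) − b(p) = 0, so the partial derivative in p is a'(u₀) −
  -- b'(u₀).
  have hinv : (fderiv ℝ E ((0, 0), u₀) ∘L .inr ℝ (ℝ × ℝ) ℝ).IsInvertible := by
    refine ⟨ContinuousLinearEquiv.unitsEquivAut ℝ (Units.mk0 _ hΔ), ?_⟩
    ext
    have h1 : HasDerivAt (fun p : ℝ => (((0:ℝ), (0:ℝ)), p)) (0, 1) u₀ :=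
      (hasDerivAt_const u₀ ((0:ℝ), (0:ℝ))).prodMk (hasDerivAt_id u₀)
    have h2 := (hEc1.differentiableAt (by simp)).hasFDerivAt.comp_hasDerivAt u₀ h1
    have h3 : HasDerivAt (fun p => a p - b p) (deriv a u₀ - deriv b u₀) u₀ :=
      had.hasDerivAt.sub hbd.hasDerivAt
    have h4 : (E ∘ fun p : ℝ => (((0:ℝ), (0:ℝ)), p)) = fun p => a p - b p := by
      ext p; simp [hE]
    rw [h4] at h2
    have h5 := h3.unique h2
    simp only [ContinuousLinearMap.comp_apply, ContinuousLinearMap.inr_apply]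
    rw [← h5]
    simp
  refine ⟨hEc1.implicitFunction one_ne_zero hinv, ?_, ?_, ?_⟩
  · exact hEc1.implicitFunction_apply_self one_ne_zero hinv
  · exact (hEc1.contDiffAt_implicitFunction one_ne_zero hinv).eventually (by simp)
  · filter_upwards [hEc1.eventually_apply_implicitFunction one_ne_zero hinv] with z hz
    simp only [hE] at hz
    rw [hz, h₀]
    simp

/-- The right-hand side of the singular equation of the spine. -/
noncomputable def spineField (a b : ℝ → ℝ) (P : ℝ × ℝ → ℝ) (z : ℝ × ℝ × ℝ) : ℝ :=
  2 * z.2.2 - (2 * deriv (deriv a) (P (z.1, z.2.1)) + z.2.2) *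
    (z.2.1 + 2 * (deriv a (P (z.1, z.2.1)) - deriv b (P (z.1, z.2.1) + 2 * z.1))) /
    (deriv a (P (z.1, z.2.1)) - deriv b (P (z.1, z.2.1) + 2 * z.1) - z.1 * z.2.2)

lemma spineField_contDiffAt {a b : ℝ → ℝ} (ha : ContDiff ℝ ∞ a) (hb : ContDiff ℝ ∞ b) {u₀ : ℝ}
    (h₁ : deriv b u₀ < deriv a u₀) {P : ℝ × ℝ → ℝ} (hP₀ : P (0, 0) = u₀)
    (hP : ContDiffAt ℝ 1 P (0, 0)) (x₀ : ℝ) : ContDiffAt ℝ 1 (spineField a b P) (0, 0, x₀) := by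
  have h1 : ContDiff ℝ 1 (deriv a) :=
    (contDiff_deriv_infty ha).of_le (by norm_cast)
  have h2 : ContDiff ℝ 1 (deriv (deriv a)) :=
    (contDiff_deriv_infty (contDiff_deriv_infty ha)).of_le (by norm_cast)
  have h3 : ContDiff ℝ 1 (deriv b) :=
    (contDiff_deriv_infty hb).of_le (by norm_cast)
  have hQ : ContDiffAt ℝ 1 (fun z : ℝ × ℝ × ℝ => P (z.1, z.2.1)) (0, 0, x₀) :=
    ContDiffAt.comp (f := fun z : ℝ × ℝ × ℝ => (z.1, z.2.1)) (g := P) ((0 : ℝ), (0 : ℝ), x₀) hP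
      (by fun_prop)
  have hQ1 := h1.contDiffAt.comp ((0 : ℝ), (0 : ℝ), x₀) hQ
  have hQ2 := h2.contDiffAt.comp ((0 : ℝ), (0 : ℝ), x₀) hQ
  have hQ3 := h3.contDiffAt.comp ((0 : ℝ), (0 : ℝ), x₀)
    (hQ.add (by fun_prop : ContDiffAt ℝ 1 (fun z : ℝ × ℝ × ℝ => 2 * z.1) (0, 0, x₀)))
  have hc1 : ContDiffAt ℝ 1 (fun z : ℝ × ℝ × ℝ => z.2.2) (0, 0, x₀) := by fun_prop
  have hc2 : ContDiffAt ℝ 1 (fun z : ℝ × ℝ × ℝ => z.2.1) (0, 0, x₀) := by fun_prop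
  have hc3 : ContDiffAt ℝ 1 (fun z : ℝ × ℝ × ℝ => z.1) (0, 0, x₀) := by fun_prop
  have hδ := hQ1.sub hQ3
  refine (contDiffAt_const.mul hc1).sub ((((contDiffAt_const.mul hQ2).add hc1).mul
    (hc2.add (contDiffAt_const.mul hδ))).div (hδ.sub (hc3.mul hc1)) ?_)
  simp [hP₀]
  linarith

/-- At T = w = 0 the quotient 2δ/δ equals 2 and the terms in χ cancel. Independence of χ is the
stationarity required for the contraction, and the value fixes the limit −4a''(u₀)/3 of χ. -/
lemma spineField_zero {a b : ℝ → ℝ} {u₀ : ℝ} (h₁ : deriv b u₀ < deriv a u₀) {P : ℝ × ℝ → ℝ}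
    (hP₀ : P (0, 0) = u₀) (x : ℝ) : spineField a b P (0, 0, x) = -4 * deriv (deriv a) u₀ := by
  have : deriv a u₀ - deriv b u₀ ≠ 0 := (sub_pos.2 h₁).ne'
  simp only [spineField, hP₀, mul_zero, add_zero, zero_add, zero_mul, sub_zero]
  field_simp
  ring

/-- Existence of the parametrized spine through `(u₀ - ε, 0)` in a narrow strip. -/
theorem exists_spineParam {a b : ℝ → ℝ} (ha : ContDiff ℝ ∞ a) (hb : ContDiff ℝ ∞ b) {u₀ : ℝ}
    (h₀ : a u₀ = b u₀) (h₁ : deriv b u₀ < deriv a u₀) (h₂ : deriv (deriv a) u₀ < 0) :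
    ∃ ε₀ > 0, ∀ ε, 0 < ε → ε < ε₀ → ∃ p κ dp dκ : ℝ → ℝ,
      IsSpineParam a b ε p κ dp dκ ∧ p 0 = u₀ ∧ p ε ∈ Ioo (u₀ - 3 * ε) (u₀ - ε) ∧
      κ ε = deriv a (p ε) ∧ deriv b (p ε + 2 * ε) < κ ε ∧
      deriv a (p (-ε)) < κ (-ε) ∧ deriv b (p (-ε) + 2 * -ε) < κ (-ε) ∧
      StrictMonoOn (fun w => a (w - ε) - b (w + ε) + 2 * ε * deriv a (w - ε))
        (Icc (u₀ - 2 * ε) u₀) := by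
  have ha1 := contDiff_deriv_infty ha
  have ha2 := contDiff_deriv_infty ha1
  have hb1 := contDiff_deriv_infty hb
  have had : Differentiable ℝ a := ha.differentiable (by simp)
  have hbd : Differentiable ℝ b := hb.differentiable (by simp)
  have had1 : Differentiable ℝ (deriv a) := ha1.differentiable (by simp)
  have hac := had.continuous
  have hbc := hbd.continuous
  have hac1 := ha1.continuous
  have hbc1 := hb1.continuous
  have hac2 := ha2.continuous
  set Δ := deriv a u₀ - deriv b u₀ with hΔ
  have hΔ0 : 0 < Δ := sub_pos.2 h₁
  set K := |deriv (deriv a) u₀| + 1 with hK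
  have hK0 : 0 < K := by positivity
  set x₀ := -4 * deriv (deriv a) u₀ / 3 with hx₀
  have hx₀0 : 0 < x₀ := by rw [hx₀]; linarith
  obtain ⟨R, hR0, hR⟩ : ∃ R > 0, ∀ p, |p - u₀| < R → |deriv a p - deriv a u₀| < Δ / 4 ∧
      |deriv b p - deriv b u₀| < Δ / 4 ∧ |deriv (deriv a) p| < K := by
    have e1 := (hac1.tendsto u₀).eventually (Metric.ball_mem_nhds _ (show 0 < Δ / 4 by positivity))
    have e2 := (hbc1.tendsto u₀).eventually (Metric.ball_mem_nhds _ (show 0 < Δ / 4 by positivity))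
    have e3 := (hac2.abs.tendsto u₀).eventually (gt_mem_nhds (show |deriv (deriv a) u₀| < K by
      rw [hK]; linarith))
    obtain ⟨R, hR0, hR⟩ := Metric.eventually_nhds_iff.1 (e1.and (e2.and e3))
    exact ⟨R, hR0, fun p hp => hR hp⟩
  have hδR : ∀ p q, |p - u₀| < R → |q - u₀| < R → Δ / 2 < deriv a p - deriv b q := by
    intro p q hp hq
    have := abs_lt.1 (hR p hp).1
    have := abs_lt.1 (hR q hq).2.1
    linarith
  obtain ⟨P, hP₀, hPs, hPE⟩ := exists_implicit_endpoint ha hb h₀ h₁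
  have hPd := hPs.self_of_nhds
  have hPR : ∀ᶠ z in 𝓝 ((0 : ℝ), (0 : ℝ)), |P z - u₀| < R / 2 := by
    have := (hPd.continuousAt.tendsto).eventually (Metric.ball_mem_nhds _ (half_pos hR0))
    rw [hP₀] at this
    exact this
  obtain ⟨ρ, hρ0, hρ⟩ := Metric.eventually_nhds_iff.1 (hPs.and (hPE.and hPR))
  have hG := spineField_contDiffAt ha hb h₁ hP₀ hPd x₀
  have hL : fderiv ℝ (spineField a b P) (0, 0, x₀) (0, 0, 1) = 0 := by
    have e1 : HasDerivAt (fun x : ℝ => ((0:ℝ), (0:ℝ), x)) (0, 0, 1) x₀ :=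
      (hasDerivAt_const x₀ (0:ℝ)).prodMk ((hasDerivAt_const x₀ (0:ℝ)).prodMk (hasDerivAt_id x₀))
    have e2 := (hG.differentiableAt (by simp)).hasFDerivAt.comp_hasDerivAt x₀ e1
    rw [show (spineField a b P ∘ fun x : ℝ => ((0:ℝ), (0:ℝ), x)) =
      fun _ => -4 * deriv (deriv a) u₀ from funext fun x => spineField_zero h₁ hP₀ x] at e2
    exact e2.unique (hasDerivAt_const _ _)
  obtain ⟨ε₁, hε₁, hsol⟩ := exists_short_solution (hG.hasStrictFDerivAt one_ne_zero) hL
    (by rw [spineField_zero h₁ hP₀, hx₀]; ring)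
    ((hG.eventually (by simp)).mono fun z hz => hz.continuousAt) (half_pos hx₀0)
  -- Beyond ε₁, the bounds keep (T, w) in the domain of P (ρ) and all arguments of a and b within R
  -- of u₀ (R/4). They keep δ − Tχ positive with dp > −3 (40x₀), and make a'' negligible against Δ
  -- in the derivatives with respect to p and of the root equation (8K).
  refine ⟨min ε₁ (min (ρ / (1 + 4 * x₀)) (min (R / 4) (min (Δ / (40 * x₀)) (Δ / (8 * K))))),
    by positivity, fun ε hε hε' => ?_⟩
  have hεε₁ : ε < ε₁ := hε'.trans_le (min_le_left _ _)
  have hε'' := hε'.trans_le (min_le_right _ _)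
  have hερ : ε * (1 + 4 * x₀) < ρ := by
    rw [← lt_div_iff₀ (by positivity)]; exact hε''.trans_le (min_le_left _ _)
  have hε3 := hε''.trans_le (min_le_right _ _)
  have hεR : ε < R / 4 := hε3.trans_le (min_le_left _ _)
  have hε4 := hε3.trans_le (min_le_right _ _)
  have hεx : ε * (40 * x₀) < Δ := by
    rw [← lt_div_iff₀ (by positivity)]; exact hε4.trans_le (min_le_left _ _)
  have hεK : ε * (8 * K) < Δ := by
    rw [← lt_div_iff₀ (by positivity)]; exact hε4.trans_le (min_le_right _ _)
  clear hε4 hε3 hε'' hε'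
  obtain ⟨X, hXc, hXb, hXd⟩ := hsol ε hε hεε₁
  have hX0 : ∀ t, 0 < X t := by intro t; have := abs_le.1 (hXb t); linarith
  have hX2 : ∀ t, X t ≤ 2 * x₀ := by intro t; have := abs_le.1 (hXb t); linarith
  -- The singular time t = 0 is the top end T = ε of the spine, where w vanishes.
  set χ : ℝ → ℝ := fun T => X (ε - T) with hχ
  set w : ℝ → ℝ := fun T => (ε - T) * χ T with hw
  set p : ℝ → ℝ := fun T => P (T, w T) with hp
  set δ : ℝ → ℝ := fun T => deriv a (p T) - deriv b (p T + 2 * T) with hδ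
  set dp : ℝ → ℝ := fun T => -((w T + 2 * δ T) / (δ T - T * χ T)) with hdp
  have hχc : Continuous χ := hXc.comp (by fun_prop)
  have hwc : Continuous w := by fun_prop
  have hχ0 : ∀ T, 0 < χ T := fun T => hX0 _
  have hχ2 : ∀ T, χ T ≤ 2 * x₀ := fun T => hX2 _
  have hw0 : ∀ T ∈ Icc (-ε) ε, 0 ≤ w T := fun T hT => mul_nonneg (by linarith [hT.2]) (hχ0 T).le
  have hw1 : ∀ T ∈ Icc (-ε) ε, w T ≤ 4 * (ε * x₀) := by
    intro T hT
    have : w T ≤ (2 * ε) * (2 * x₀) :=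
      mul_le_mul (by linarith [hT.1]) (hχ2 T) (hχ0 T).le (by linarith)
    linarith
  have hgood : ∀ T ∈ Icc (-ε) ε, ContDiffAt ℝ 1 P (T, w T) ∧
      a (p T) + 2 * T * deriv a (p T) - b (p T + 2 * T) + T * w T = 0 ∧ |p T - u₀| < R / 2 := by
    intro T hT
    refine hρ ?_
    rw [Prod.dist_eq, Real.dist_eq, Real.dist_eq, sub_zero, sub_zero]
    have h1 : |T| ≤ ε := abs_le.2 hT
    have h2 : 0 < ε * x₀ := by positivity
    refine max_lt (by linarith) ?_
    rw [abs_of_nonneg (hw0 T hT)]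
    linarith [hw1 T hT]
  have hpR : ∀ T ∈ Icc (-ε) ε, |p T - u₀| < R := fun T hT => by linarith [(hgood T hT).2.2]
  have hqR : ∀ T ∈ Icc (-ε) ε, |p T + 2 * T - u₀| < R := by
    intro T hT
    have := abs_lt.1 (hgood T hT).2.2
    rw [abs_lt]
    constructor <;> linarith [hT.1, hT.2]
  have hδ0 : ∀ T ∈ Icc (-ε) ε, Δ / 2 < δ T := fun T hT => hδR _ _ (hpR T hT) (hqR T hT)
  have hTχ : ∀ T ∈ Icc (-ε) ε, |T * χ T| ≤ 2 * (ε * x₀) := by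
    intro T hT
    rw [abs_mul, abs_of_pos (hχ0 T)]
    have : |T| * χ T ≤ ε * (2 * x₀) :=
      mul_le_mul (abs_le.2 hT) (hχ2 T) (hχ0 T).le hε.le
    linarith
  have hden : ∀ T ∈ Icc (-ε) ε, 0 < δ T - T * χ T := by
    intro T hT
    have := abs_le.1 (hTχ T hT)
    linarith [hδ0 T hT]
  have hpc : ContinuousOn p (Icc (-ε) ε) := by
    intro T hT
    have h1 : ContinuousAt (fun T => (T, w T)) T := by fun_prop
    exact (ContinuousAt.comp (f := fun T => (T, w T)) (g := P) (hgood T hT).1.continuousAt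
      h1).continuousWithinAt
  have hδc : ContinuousOn δ (Icc (-ε) ε) := by fun_prop
  have hdpc : ContinuousOn dp (Icc (-ε) ε) := by
    refine ContinuousOn.neg (ContinuousOn.div ?_ ?_ (fun T hT => (hden T hT).ne'))
    · fun_prop
    · fun_prop
  have hwd : ∀ T ∈ Ioo (-ε) ε,
      HasDerivAt w (-((2 * deriv (deriv a) (p T) + χ T) * dp T)) T := by
    intro T hT
    have h1 := hXd (ε - T) ⟨by linarith [hT.2], by linarith [hT.1]⟩
    have h2 := h1.comp T ((hasDerivAt_id T).const_sub ε)
    refine h2.congr_deriv ?_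
    have e1 : (ε - T) * X (ε - T) = w T := rfl
    have e2 : P (T, w T) = p T := rfl
    rw [e1, sub_sub_cancel]
    simp only [spineField, e2]
    rw [show X (ε - T) = χ T from rfl]
    simp only [hdp, hδ]
    ring
  have hpd : ∀ T ∈ Ioo (-ε) ε, HasDerivAt p (dp T) T := by
    intro T hT
    have hT' := Ioo_subset_Icc_self hT
    have h1 : HasDerivAt (fun T => (T, w T)) (1, -((2 * deriv (deriv a) (p T) + χ T) * dp T)) T :=
      (hasDerivAt_id T).prodMk (hwd T hT)
    have h2 := ((hgood T hT').1.differentiableAt (by simp)).hasFDerivAt.comp_hasDerivAt T h1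
    set d := fderiv ℝ P (T, w T) (1, -((2 * deriv (deriv a) (p T) + χ T) * dp T)) with hd
    have h3 : HasDerivAt p d T := h2
    have h4 : HasDerivAt (fun T => p T + 2 * T) (d + 2 * 1) T :=
      h3.add ((hasDerivAt_id T).const_mul 2)
    have h5 := (((had _).hasDerivAt.comp T h3).add
      (((hasDerivAt_id T).const_mul 2).mul ((had1 _).hasDerivAt.comp T h3))).sub
      ((hbd _).hasDerivAt.comp T h4)
    have h6 := h5.add ((hasDerivAt_id T).mul (hwd T hT))
    have h7 : (fun _ => (0:ℝ)) =ᶠ[𝓝 T] fun T =>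
        a (p T) + 2 * T * deriv a (p T) - b (p T + 2 * T) + T * w T := by
      filter_upwards [Icc_mem_nhds hT.1 hT.2] with S hS using (hgood S hS).2.1.symm
    have h8 := (h6.congr_of_eventuallyEq h7).unique (hasDerivAt_const T 0)
    simp only [id, Function.comp] at h8
    have h9 : dp T * (δ T - T * χ T) = -(w T + 2 * δ T) := by
      simp only [hdp]
      have := (hden T hT').ne'
      field_simp
    -- This is the coefficient of the unknown derivative d of p in the differentiated endpoint
    -- equation; as it is nonzero, d must be the candidate dp.
    have h10 : δ T + 2 * T * deriv (deriv a) (p T) ≠ 0 := by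
      have e1 := hδ0 T hT'
      have e2 := (hR _ (hpR T hT')).2.2
      have e3 : |T * deriv (deriv a) (p T)| ≤ ε * K := by
        rw [abs_mul]
        exact mul_le_mul (abs_le.2 hT') e2.le (abs_nonneg _) hε.le
      have := abs_le.1 e3
      have : 0 < δ T + 2 * T * deriv (deriv a) (p T) := by linarith
      exact this.ne'
    have h11 : d = dp T := by
      refine mul_left_cancel₀ h10 ?_
      simp only [hδ] at h9 ⊢
      linear_combination h8 - h9
    rw [← h11]
    exact h3
  have hdp_lt : ∀ T ∈ Ioc (-ε) ε, dp T < -2 := by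
    intro T hT
    have hT' := Ioc_subset_Icc_self hT
    -- The inequality dp < −2 is w + 2Tχ > 0, and w + 2Tχ = (ε + T)χ; it degenerates only at T = −ε.
    have h1 : 0 < (ε + T) * χ T := mul_pos (by linarith [hT.1]) (hχ0 T)
    simp only [hdp]
    rw [neg_lt_neg_iff, lt_div_iff₀ (hden T hT')]
    simp only [hw]
    linarith
  have hdp_le : dp (-ε) ≤ -2 := by
    have hT' : -ε ∈ Icc (-ε) ε := left_mem_Icc.2 (by linarith)
    simp only [hdp]
    rw [neg_le_neg_iff, le_div_iff₀ (hden _ hT')]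
    simp only [hw]
    linarith
  have hdp_gt : ∀ T ∈ Icc (-ε) ε, -3 < dp T := by
    intro T hT
    simp only [hdp]
    rw [neg_lt_neg_iff, div_lt_iff₀ (hden T hT)]
    have := abs_le.1 (hTχ T hT)
    linarith [hw1 T hT, hδ0 T hT]
  -- With this choice the terms in a'' cancel in κ', leaving −(χ/2)·dp, which is positive because χ
  -- > 0 and dp < 0.
  set κ : ℝ → ℝ := fun T => deriv a (p T) + w T / 2 with hκ
  have hparam : IsSpineParam a b ε p κ dp (fun T => -(χ T / 2 * dp T)) := by
    refine ⟨hε, hpc, by fun_prop, hdpc, hpd, fun T hT => ?_, hdp_lt, hdp_le, fun T hT => ?_,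
      fun T hT => ?_, fun T hT => ?_⟩
    · refine (((had1 _).hasDerivAt.comp T (hpd T hT)).add
        ((hwd T hT).div_const 2)).congr_deriv ?_
      ring
    · have h1 := hdp_lt T (Ioo_subset_Ioc_self hT)
      have h2 := hχ0 T
      nlinarith
    · simp only [hκ, hw]; ring
    · have := (hgood T hT).2.1
      simp only [hκ]
      linarith
  have hmem0 : (0:ℝ) ∈ Icc (-ε) ε := ⟨by linarith, hε.le⟩
  have hmem1 : -ε ∈ Icc (-ε) ε := left_mem_Icc.2 (by linarith)
  have hmem2 : ε ∈ Icc (-ε) ε := right_mem_Icc.2 (by linarith)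
  have hp0 : p 0 = u₀ := by
    have h1 := (hgood 0 hmem0).2.1
    simp only [mul_zero, zero_mul, add_zero] at h1
    -- Here w 0 is not zero, so p 0 is not P (0, 0) by definition; it is identified as the only zero
    -- of a − b near u₀.
    have hmono : StrictMonoOn (fun x => a x - b x) (Ioo (u₀ - R) (u₀ + R)) := by
      refine strictMonoOn_of_hasDerivWithinAt_pos (f' := fun x => deriv a x - deriv b x)
        (convex_Ioo _ _) (by fun_prop) ?_ ?_ <;> rw [interior_Ioo] <;> intro x hx
      · exact ((had x).hasDerivAt.sub (hbd x).hasDerivAt).hasDerivWithinAt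
      · have hx' : |x - u₀| < R := by rw [abs_lt]; constructor <;> linarith [hx.1, hx.2]
        linarith [hδR x x hx' hx']
    have hm := abs_lt.1 (hpR 0 hmem0)
    exact hmono.injOn ⟨by linarith, by linarith⟩ ⟨by linarith, by linarith⟩
      (by linarith)
  obtain ⟨c, hc, hc'⟩ := exists_hasDerivAt_eq_slope p dp hε
    (hpc.mono (Icc_subset_Icc (by linarith) le_rfl))
    (fun T hT => hpd T ⟨by linarith [hT.1], hT.2⟩)
  have hcI : c ∈ Ioc (-ε) ε := ⟨by linarith [hc.1], hc.2.le⟩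
  have hpε : p ε = u₀ + dp c * ε := by
    rw [hc', hp0, sub_zero, div_mul_cancel₀ _ hε.ne']; ring
  have hwε : w ε = 0 := by simp [hw]
  have hwε' : 0 < w (-ε) := mul_pos (by linarith) (hχ0 _)
  refine ⟨p, κ, dp, _, hparam, hp0, ⟨?_, ?_⟩, ?_, ?_, ?_, ?_, ?_⟩
  · rw [hpε]
    have := hdp_gt c (Ioc_subset_Icc_self hcI)
    nlinarith
  · rw [hpε]
    have := hdp_lt c hcI
    nlinarith
  · simp only [hκ, hwε]; ring
  · have := hδ0 ε hmem2
    simp only [hδ] at this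
    simp only [hκ, hwε]
    linarith
  · simp only [hκ]; linarith
  · have := hδ0 (-ε) hmem1
    simp only [hδ] at this
    simp only [hκ]
    linarith
  · refine strictMonoOn_of_hasDerivWithinAt_pos (f' := fun x => deriv a (x - ε) -
      deriv b (x + ε) + 2 * ε * deriv (deriv a) (x - ε)) (convex_Icc _ _) (by fun_prop) ?_ ?_ <;>
      rw [interior_Icc] <;> intro x hx
    · have e1 := (hasDerivAt_id x).sub_const ε
      have e2 := (hasDerivAt_id x).add_const ε
      refine (((((had _).hasDerivAt.comp x e1).sub ((hbd _).hasDerivAt.comp x e2)).add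
        (((had1 _).hasDerivAt.comp x e1).const_mul (2 * ε))).congr_deriv ?_).hasDerivWithinAt
      simp
    · have h1 : |x - ε - u₀| < R := by rw [abs_lt]; constructor <;> linarith [hx.1, hx.2]
      have h2 : |x + ε - u₀| < R := by rw [abs_lt]; constructor <;> linarith [hx.1, hx.2]
      have h3 := hδR _ _ h1 h2
      have h4 := abs_lt.1 (hR _ h1).2.2
      nlinarith

end DiagonalStrip

/-! ### The south-east fissure. -/

namespace DiagonalStrip

lemma iteratedDeriv_two_eq (f : ℝ → ℝ) : iteratedDeriv 2 f = deriv (deriv f) := by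
  rw [iteratedDeriv_succ, iteratedDeriv_one]

lemma iteratedDeriv_three_eq (f : ℝ → ℝ) : iteratedDeriv 3 f = deriv (deriv (deriv f)) := by
  rw [iteratedDeriv_succ, iteratedDeriv_two_eq]

/-- The fissure growing in the south-east direction, for all sufficiently thin strips. -/
theorem exists_southeast_fissure {fp fm : ℝ → ℝ} (hfp : ContDiff ℝ ∞ fp) (hfm : ContDiff ℝ ∞ fm)
    {u₀ : ℝ} (h₀ : deriv fp u₀ = deriv fm u₀)
    (h₁ : iteratedDeriv 2 fm u₀ < iteratedDeriv 2 fp u₀) (h₂ : iteratedDeriv 3 fp u₀ < 0) :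
    ∃ ε₀ : ℝ, 0 < ε₀ ∧ ∀ ε : ℝ, 0 < ε → ε < ε₀ →
      ∃ u v : ℝ, ∃ T : ℝ → ℝ, ∃ B : ℝ × ℝ → ℝ,
        IsUniqueRootIn
          (fun w => deriv fp (w - ε) - deriv fm (w + ε) + 2 * ε * iteratedDeriv 2 fp (w - ε))
          (u₀ - 2 * ε) u₀ u ∧
        u₀ + ε < v ∧
        IsSpine ε T (u - ε) (v - ε) ∧
        T (u₀ - ε) = 0 ∧ T (u - ε) = ε ∧ T (v - ε) = -ε ∧
        IsRightHerringboneFun fp fm ε T (rightSpineValue fp fm ε T) (u - ε) (v - ε) B ∧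
        IsBellmanCandidate fp fm ε (rightHerringboneRegion ε T (u - ε) (v - ε)) B ∧
        ∃ δ : ℝ, 0 < δ ∧
          IsC1Gluing fp fm ε (rightHerringboneRegion ε T (u - ε) (v - ε)) B
            (u - δ) u v (v + δ) := by
  rw [iteratedDeriv_two_eq, iteratedDeriv_two_eq] at h₁
  rw [iteratedDeriv_three_eq] at h₂
  rw [iteratedDeriv_two_eq]
  have ha := contDiff_deriv_infty hfp
  have hb := contDiff_deriv_infty hfm
  have ca : Continuous (deriv fp) := ha.continuous
  have cb : Continuous (deriv fm) := hb.continuous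
  have ca' : Continuous (deriv (deriv fp)) := (contDiff_deriv_infty ha).continuous
  have cb' : Continuous (deriv (deriv fm)) := (contDiff_deriv_infty hb).continuous
  obtain ⟨ε₀, hε₀, H⟩ := exists_spineParam ha hb h₀ h₁ h₂
  refine ⟨ε₀, hε₀, fun ε hε hεε => ?_⟩
  obtain ⟨p, κ, dp, dκ, h, hp0, hpε, hκε, hbε, haε', hbε', hF⟩ := H ε hε hεε
  have hmem0 : (0:ℝ) ∈ Icc (-ε) ε := ⟨by linarith, hε.le⟩
  have hmem1 : -ε ∈ Icc (-ε) ε := left_mem_Icc.2 (by linarith)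
  have hmem2 : ε ∈ Icc (-ε) ε := right_mem_Icc.2 (by linarith)
  set u := p ε + ε with hu
  set v := p (-ε) - ε with hv
  set F : ℝ → ℝ := fun w => deriv fp (w - ε) - deriv fm (w + ε) + 2 * ε * deriv (deriv fp) (w - ε)
  have huI : u ∈ Ioo (u₀ - 2 * ε) u₀ := ⟨by linarith [hpε.1], by linarith [hpε.2]⟩
  have hFu : F u = 0 := by
    have h1 := h.rel ε hmem2
    rw [hκε] at h1
    simp only [F, hu]
    rw [show p ε + ε - ε = p ε by ring, show p ε + ε + ε = p ε + 2 * ε by ring]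
    linarith
  have hroot : IsUniqueRootIn F (u₀ - 2 * ε) u₀ u :=
    ⟨⟨huI, hFu⟩, fun w hw hFw => hF.injOn (Ioo_subset_Icc_self hw) (Ioo_subset_Icc_self huI)
      (hFw.trans hFu.symm)⟩
  have huv : u₀ + ε < v := by
    have h1 := h.q_anti hmem1 hmem0 (by linarith)
    simp only at h1
    linarith
  set kR : ℝ → ℝ := fun y => (deriv fp (y + ε) - deriv fm (y - ε)) / (2 * ε)
  set kL : ℝ → ℝ := fun z => (deriv fm (z + ε) - deriv fp (z - ε)) / (2 * ε)
  have hkRv : kR v = κ (-ε) := by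
    have h1 := h.rel (-ε) hmem1
    simp only [kR, hv]
    rw [show p (-ε) - ε + ε = p (-ε) by ring, show p (-ε) - ε - ε = p (-ε) + 2 * -ε by ring,
      div_eq_iff (by positivity)]
    linarith
  have hkLu : kL u = κ ε := by
    have h1 := h.rel ε hmem2
    simp only [kL, hu]
    rw [show p ε + ε - ε = p ε by ring, show p ε + ε + ε = p ε + 2 * ε by ring,
      div_eq_iff (by positivity)]
    linarith
  have ckR : Continuous kR := by fun_prop
  have ckL : Continuous kL := by fun_prop
  -- Three of the four end inequalities are strict at v or at u, and persist nearby by continuity.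
  have e1 : ∀ᶠ y in 𝓝 v, deriv (deriv fp) (y + ε) < kR y :=
    (isOpen_lt (by fun_prop) ckR).mem_nhds
      (by rw [mem_ofPred_eq, hkRv, hv, sub_add_cancel]; exact haε')
  have e2 : ∀ᶠ y in 𝓝 v, deriv (deriv fm) (y - ε) < kR y :=
    (isOpen_lt (by fun_prop) ckR).mem_nhds (by
      rw [mem_ofPred_eq, hkRv, hv, show p (-ε) - ε - ε = p (-ε) + 2 * -ε by ring]; exact hbε')
  have e3 : ∀ᶠ z in 𝓝 u, deriv (deriv fm) (z + ε) < kL z :=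
    (isOpen_lt (by fun_prop) ckL).mem_nhds (by
      rw [mem_ofPred_eq, hkLu, hu, show p ε + ε + ε = p ε + 2 * ε by ring]; exact hbε)
  obtain ⟨δ₁, hδ₁, H₁⟩ := Metric.eventually_nhds_iff.1 (e1.and e2)
  obtain ⟨δ₂, hδ₂, H₂⟩ := Metric.eventually_nhds_iff.1 e3
  obtain ⟨δ, hδ, hδlt⟩ := exists_between
    (lt_min (lt_min hδ₁ hδ₂) (show 0 < u - (u₀ - 2 * ε) by linarith [huI.1]))
  have hδ1 : δ < δ₁ := hδlt.trans_le ((min_le_left _ _).trans (min_le_left _ _))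
  have hδ2 : δ < δ₂ := hδlt.trans_le ((min_le_left _ _).trans (min_le_right _ _))
  have hδ3 : δ < u - (u₀ - 2 * ε) := hδlt.trans_le (min_le_right _ _)
  obtain ⟨T, B, hT, hT0, hTu, hTv, hB, hB', hglue⟩ :=
    h.exists_herringbone (hfp.of_le (by norm_cast)) (hfm.of_le (by norm_cast)) hδ
      (fun y hy => by
        have h1 := H₁ (y := y) (by
          rw [Real.dist_eq, abs_lt]; constructor <;> linarith [hy.1, hy.2])
        exact ⟨h1.1.le, h1.2.le⟩)
      (fun z hz => by
        have hz1 : u - δ ≤ z := hz.1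
        have hz2 : z ≤ u := hz.2
        have h1 := H₂ (y := z) (by
          rw [Real.dist_eq, abs_lt]; constructor <;> linarith)
        -- The fourth inequality is an equality at u. It reads F z ≤ 0, so it holds to the left of
        -- the root because F is increasing.
        have h2 : F z ≤ F u := hF.monotoneOn ⟨by linarith, by linarith [huI.2]⟩
          (Ioo_subset_Icc_self huI) hz2
        refine ⟨h1.le, ?_⟩
        rw [le_div_iff₀ (by positivity)]
        simp only [hFu] at h2
        simp only [F] at h2
        linarith)
      hu hv hp0.symm
  exact ⟨u, v, T, B, hroot, huv, hT, hT0, hTu, hTv, hB, hB', δ, hδ, hglue⟩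

end DiagonalStrip

/-! ### Reflections of the strip. -/

namespace DiagonalStrip

/-- For `s = 1` the reflection of the plane in the horizontal axis, for `s = -1` the reflection
in the origin. -/
noncomputable def stripSymm (s : ℝ) : ℝ × ℝ →L[ℝ] ℝ × ℝ :=
  (s • ContinuousLinearMap.fst ℝ ℝ ℝ).prod (-ContinuousLinearMap.snd ℝ ℝ ℝ)

@[simp]
lemma stripSymm_apply (s : ℝ) (x : ℝ × ℝ) : stripSymm s x = (s * x.1, -x.2) := rfl

lemma stripSymm_involutive {s : ℝ} (hs : s * s = 1) : Function.Involutive (stripSymm s) := by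
  intro x
  simp [← mul_assoc, hs]

lemma preimage_segment_stripSymm {s : ℝ} (hs : s * s = 1) (x y : ℝ × ℝ) :
    stripSymm s ⁻¹' segment ℝ x y = segment ℝ (stripSymm s x) (stripSymm s y) := by
  rw [← (stripSymm_involutive hs).image_eq_preimage_symm]
  exact image_segment ℝ (stripSymm s).toLinearMap.toAffineMap x y

lemma IsDiagonal.stripSymm {s : ℝ} (hs : s = 1 ∨ s = -1) {x y : ℝ × ℝ} (h : IsDiagonal x y) :
    IsDiagonal (stripSymm s x) (stripSymm s y) := by
  rcases hs with rfl | rfl <;> rcases h with h | h <;>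
    simp only [IsDiagonal, stripSymm_apply] <;>
    first | (left; linarith) | (right; linarith)

lemma LinearOnSegment.stripSymm {s : ℝ} {B : ℝ × ℝ → ℝ} {x y : ℝ × ℝ}
    (h : LinearOnSegment B (stripSymm s x) (stripSymm s y)) :
    LinearOnSegment (B ∘ stripSymm s) x y := by
  intro t ht
  have := h t ht
  rwa [← map_smul, ← map_smul, ← map_add] at this

lemma strip_stripSymm (ε s : ℝ) : stripSymm s ⁻¹' strip ε = strip ε := by
  ext x
  simp only [strip, mem_preimage, mem_ofPred_eq, stripSymm_apply]
  constructor <;> rintro ⟨h1, h2⟩ <;> constructor <;> linarith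

/-- Both reflections preserve the set of diagonal directions and exchange the two boundary lines,
whence the exchange of the boundary functions. -/
lemma IsBellmanCandidate.stripSymm {s : ℝ} (hs : s = 1 ∨ s = -1) {F G fp fm : ℝ → ℝ} {ε : ℝ}
    {Ω : Set (ℝ × ℝ)} {B : ℝ × ℝ → ℝ} (h : IsBellmanCandidate F G ε Ω B)
    (hfp : ∀ t, fp t = G (s * t)) (hfm : ∀ t, fm t = F (s * t)) :
    IsBellmanCandidate fp fm ε (stripSymm s ⁻¹' Ω) (B ∘ stripSymm s) := by
  have hss : s * s = 1 := by rcases hs with rfl | rfl <;> norm_num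
  have hinv := stripSymm_involutive hss
  have hseg : ∀ {x y : ℝ × ℝ} {U : Set (ℝ × ℝ)}, segment ℝ x y ⊆ DiagonalStrip.stripSymm s ⁻¹' U →
      segment ℝ (DiagonalStrip.stripSymm s x) (DiagonalStrip.stripSymm s y) ⊆ U := by
    intro x y U hU
    rw [← preimage_segment_stripSymm hss]
    intro z hz
    have := hU hz
    rwa [mem_preimage, hinv z] at this
  refine ⟨?_, fun x y hxy hU => ?_, fun t ht => ?_, fun t ht => ?_, fun y hy => ?_⟩
  · rw [← strip_stripSymm ε s]
    exact preimage_mono h.subset_strip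
  · have h1 := (h.concave _ _ (hxy.stripSymm hs) (hseg hU)).comp_linearMap
      (DiagonalStrip.stripSymm s).toLinearMap
    refine h1.subset ?_ (convex_segment x y)
    have h2 := preimage_segment_stripSymm hss (DiagonalStrip.stripSymm s x)
      (DiagonalStrip.stripSymm s y)
    rw [hinv, hinv] at h2
    exact h2.ge
  · rw [hfp]
    simpa using h.lower_boundary (s * t) (by simpa using ht)
  · rw [hfm]
    simpa using h.upper_boundary (s * t) (by simpa using ht)
  · rcases h.extremal _ hy with ⟨z, hz, hyz, hU, hl⟩ | ⟨U, hU, hl⟩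
    · left
      refine ⟨DiagonalStrip.stripSymm s z, ?_, ?_, ?_, ?_⟩
      · simp only [stripBoundary, mem_ofPred_eq, stripSymm_apply] at hz ⊢
        rcases hz with hz | hz <;> rw [hz] <;> simp
      · simpa only [hinv y] using hyz.stripSymm hs
      · have h1 := preimage_mono (f := DiagonalStrip.stripSymm s) hU
        rwa [preimage_segment_stripSymm hss, hinv] at h1
      · refine LinearOnSegment.stripSymm ?_
        rwa [hinv]
    · right
      refine ⟨DiagonalStrip.stripSymm s ⁻¹' U,
        (DiagonalStrip.stripSymm s).continuous.continuousAt.preimage_mem_nhds hU,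
        fun x z hxz hxzU => ?_⟩
      exact (hl _ _ (hxz.stripSymm hs) (hseg hxzU)).stripSymm

lemma rightRegion_stripSymm_one (ε l₁ l₂ : ℝ) :
    stripSymm 1 ⁻¹' leftRegion ε l₁ l₂ = rightRegion ε l₁ l₂ := by
  ext x
  have := Set.ext_iff.1 (strip_stripSymm ε 1) x
  simp only [leftRegion, rightRegion, mem_preimage, mem_ofPred_eq, stripSymm_apply] at this ⊢
  rw [this, one_mul, sub_eq_add_neg]

lemma leftRegion_stripSymm_one (ε l₁ l₂ : ℝ) :
    stripSymm 1 ⁻¹' rightRegion ε l₁ l₂ = leftRegion ε l₁ l₂ := by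
  rw [← rightRegion_stripSymm_one, ← preimage_comp,
    (stripSymm_involutive (one_mul 1)).comp_self, preimage_id]

lemma leftRegion_stripSymm_neg_one (ε l₁ l₂ : ℝ) :
    stripSymm (-1) ⁻¹' leftRegion ε l₁ l₂ = leftRegion ε (-l₂) (-l₁) := by
  ext x
  have := Set.ext_iff.1 (strip_stripSymm ε (-1)) x
  simp only [leftRegion, mem_preimage, mem_ofPred_eq, stripSymm_apply] at this ⊢
  rw [this]
  constructor <;> rintro ⟨h, h1, h2⟩ <;> refine ⟨h, ?_, ?_⟩ <;> linarith

lemma rightRegion_stripSymm_neg_one (ε l₁ l₂ : ℝ) :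
    stripSymm (-1) ⁻¹' rightRegion ε l₁ l₂ = rightRegion ε (-l₂) (-l₁) := by
  ext x
  have := Set.ext_iff.1 (strip_stripSymm ε (-1)) x
  simp only [rightRegion, mem_preimage, mem_ofPred_eq, stripSymm_apply] at this ⊢
  rw [this]
  constructor <;> rintro ⟨h, h1, h2⟩ <;> refine ⟨h, ?_, ?_⟩ <;> linarith

lemma leftStandard_comp_stripSymm_one (fp fm : ℝ → ℝ) (ε : ℝ) :
    leftStandard fm fp ε ∘ stripSymm 1 = rightStandard fp fm ε := by
  funext x
  simp only [leftStandard, rightStandard, Function.comp, stripSymm_apply, one_mul,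
    ← sub_eq_add_neg, sub_neg_eq_add]
  ring

lemma rightStandard_comp_stripSymm_one (fp fm : ℝ → ℝ) (ε : ℝ) :
    rightStandard fm fp ε ∘ stripSymm 1 = leftStandard fp fm ε := by
  funext x
  simp only [leftStandard, rightStandard, Function.comp, stripSymm_apply, one_mul,
    ← sub_eq_add_neg, sub_neg_eq_add]
  ring

lemma leftStandard_comp_stripSymm_neg_one (fp fm : ℝ → ℝ) (ε : ℝ) :
    leftStandard (fun t => fm (-t)) (fun t => fp (-t)) ε ∘ stripSymm (-1)
      = leftStandard fp fm ε := by
  funext x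
  simp only [leftStandard, Function.comp, stripSymm_apply]
  rw [show -(-1 * x.1 + -x.2 - ε) = x.1 + x.2 + ε by ring,
    show -(-1 * x.1 + -x.2 + ε) = x.1 + x.2 - ε by ring]
  ring

lemma rightStandard_comp_stripSymm_neg_one (fp fm : ℝ → ℝ) (ε : ℝ) :
    rightStandard (fun t => fm (-t)) (fun t => fp (-t)) ε ∘ stripSymm (-1)
      = rightStandard fp fm ε := by
  funext x
  simp only [rightStandard, Function.comp, stripSymm_apply]
  rw [show -(-1 * x.1 - -x.2 - ε) = x.1 - x.2 + ε by ring,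
    show -(-1 * x.1 - -x.2 + ε) = x.1 - x.2 - ε by ring]
  ring

/-- The reflection in the horizontal axis exchanges x₁ + x₂ with x₁ − x₂, hence the two simple
foliations, and leaves the parameter intervals unchanged. -/
lemma IsC1Gluing.stripSymm_one {fp fm : ℝ → ℝ} {ε : ℝ} {Ω : Set (ℝ × ℝ)} {B : ℝ × ℝ → ℝ}
    {l₁ l₂ r₁ r₂ : ℝ} (h : IsC1Gluing fm fp ε Ω B l₁ l₂ r₁ r₂) :
    IsC1Gluing fp fm ε (stripSymm 1 ⁻¹' Ω) (B ∘ stripSymm 1) r₁ r₂ l₁ l₂ := by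
  have hu : stripSymm 1 ⁻¹' Ω ∪ leftRegion ε r₁ r₂ ∪ rightRegion ε l₁ l₂
      = stripSymm 1 ⁻¹' (Ω ∪ leftRegion ε l₁ l₂ ∪ rightRegion ε r₁ r₂) := by
    rw [preimage_union, preimage_union, rightRegion_stripSymm_one, leftRegion_stripSymm_one,
      union_right_comm]
  have hp : ∀ t, fp t = fp (1 * t) := fun t => by rw [one_mul]
  have hm : ∀ t, fm t = fm (1 * t) := fun t => by rw [one_mul]
  refine ⟨?_, ?_, ?_, ?_, ?_, ?_⟩
  · simpa only [leftRegion_stripSymm_one, rightStandard_comp_stripSymm_one]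
      using h.right_candidate.stripSymm (.inl rfl) hp hm
  · simpa only [rightRegion_stripSymm_one, leftStandard_comp_stripSymm_one]
      using h.left_candidate.stripSymm (.inl rfl) hp hm
  · rw [← leftRegion_stripSymm_one, ← rightStandard_comp_stripSymm_one]
    exact fun x hx => h.right_eq hx
  · rw [← rightRegion_stripSymm_one, ← leftStandard_comp_stripSymm_one]
    exact fun x hx => h.left_eq hx
  · rw [hu]
    exact h.union_candidate.stripSymm (.inl rfl) hp hm
  · rw [hu]
    exact h.union_smooth.comp (stripSymm 1).contDiff.contDiffOn (mapsTo_preimage _ _)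

/-- The reflection in the origin keeps the type of each simple foliation and reverses its parameter
interval. -/
lemma IsC1Gluing.stripSymm_neg_one {fp fm : ℝ → ℝ} {ε : ℝ} {Ω : Set (ℝ × ℝ)} {B : ℝ × ℝ → ℝ}
    {l₁ l₂ r₁ r₂ : ℝ}
    (h : IsC1Gluing (fun t => fm (-t)) (fun t => fp (-t)) ε Ω B l₁ l₂ r₁ r₂) :
    IsC1Gluing fp fm ε (stripSymm (-1) ⁻¹' Ω) (B ∘ stripSymm (-1)) (-l₂) (-l₁) (-r₂) (-r₁) := by
  have hu : stripSymm (-1) ⁻¹' Ω ∪ leftRegion ε (-l₂) (-l₁) ∪ rightRegion ε (-r₂) (-r₁)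
      = stripSymm (-1) ⁻¹' (Ω ∪ leftRegion ε l₁ l₂ ∪ rightRegion ε r₁ r₂) := by
    rw [preimage_union, preimage_union, rightRegion_stripSymm_neg_one,
      leftRegion_stripSymm_neg_one]
  have hp : ∀ t, fp t = fp (-(-1 * t)) := fun t => by rw [neg_one_mul, neg_neg]
  have hm : ∀ t, fm t = fm (-(-1 * t)) := fun t => by rw [neg_one_mul, neg_neg]
  refine ⟨?_, ?_, ?_, ?_, ?_, ?_⟩
  · simpa only [leftRegion_stripSymm_neg_one, leftStandard_comp_stripSymm_neg_one]
      using h.left_candidate.stripSymm (.inr rfl) hp hm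
  · simpa only [rightRegion_stripSymm_neg_one, rightStandard_comp_stripSymm_neg_one]
      using h.right_candidate.stripSymm (.inr rfl) hp hm
  · rw [← leftRegion_stripSymm_neg_one, ← leftStandard_comp_stripSymm_neg_one]
    exact fun x hx => h.left_eq hx
  · rw [← rightRegion_stripSymm_neg_one, ← rightStandard_comp_stripSymm_neg_one]
    exact fun x hx => h.right_eq hx
  · rw [hu]
    exact h.union_candidate.stripSymm (.inr rfl) hp hm
  · rw [hu]
    exact h.union_smooth.comp (stripSymm (-1)).contDiff.contDiffOn (mapsTo_preimage _ _)

lemma IsSpine.neg {ε : ℝ} {T : ℝ → ℝ} {a b : ℝ} (h : IsSpine ε T a b) :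
    IsSpine ε (fun u => -T u) a b := by
  have hd : ∀ u, |derivWithin (fun u => -T u) (Icc a b) u| = |derivWithin T (Icc a b) u| := by
    intro u
    rw [derivWithin.fun_neg, abs_neg]
  refine ⟨h.lt, h.contDiffOn.neg, fun u hu => ?_, fun u hu => ?_, ?_⟩
  · have := h.mem_strip u hu
    constructor <;> linarith
  · rw [hd]
    exact h.slope_le u hu
  · simpa only [hd] using h.slope_lt

lemma IsSpine.comp_neg {ε : ℝ} {T : ℝ → ℝ} {a b : ℝ} (h : IsSpine ε T a b) :
    IsSpine ε (fun u => T (-u)) (-b) (-a) := by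
  have hI : -Icc (-b) (-a) = Icc a b := by simp
  have hmem : ∀ {u}, u ∈ Icc (-b) (-a) → -u ∈ Icc a b := by
    intro u hu
    rwa [← hI, Set.neg_mem_neg]
  have hd : ∀ u, |derivWithin (fun u => T (-u)) (Icc (-b) (-a)) u|
      = |derivWithin T (Icc a b) (-u)| := by
    intro u
    rw [derivWithin_comp_neg, hI, abs_neg]
  refine ⟨by linarith [h.lt], h.contDiffOn.comp contDiff_neg.contDiffOn fun u hu => hmem hu,
    fun u hu => h.mem_strip _ ⟨by linarith [hu.2], by linarith [hu.1]⟩, fun u hu => ?_, ?_⟩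
  · rw [hd]
    exact h.slope_le _ (hmem hu)
  · refine (h.slope_lt.image Neg.neg).subset ?_
    rintro u ⟨hu, hu'⟩
    rw [hd] at hu'
    exact ⟨-u, ⟨hmem hu, hu'⟩, neg_neg u⟩

lemma rightHerringboneRegion_stripSymm_one (ε : ℝ) (T : ℝ → ℝ) (a b : ℝ) :
    stripSymm 1 ⁻¹' rightHerringboneRegion ε T a b
      = rightHerringboneRegion ε (fun u => -T u) a b := by
  ext x
  simp only [rightHerringboneRegion, mem_preimage, mem_ofPred_eq, stripSymm_apply]
  refine exists_congr fun u => and_congr_right fun _ => ?_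
  constructor <;> rintro (⟨h1, h2, h3⟩ | ⟨h1, h2, h3⟩)
  · exact .inr ⟨by linarith, by linarith, by linarith⟩
  · exact .inl ⟨by linarith, by linarith, by linarith⟩
  · exact .inr ⟨by linarith, by linarith, by linarith⟩
  · exact .inl ⟨by linarith, by linarith, by linarith⟩

lemma rightHerringboneRegion_stripSymm_neg_one (ε : ℝ) (T : ℝ → ℝ) (a b : ℝ) :
    stripSymm (-1) ⁻¹' rightHerringboneRegion ε T a b
      = leftHerringboneRegion ε (fun u => -T (-u)) (-b) (-a) := by
  ext x
  simp only [rightHerringboneRegion, leftHerringboneRegion, mem_preimage, mem_ofPred_eq,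
    stripSymm_apply]
  rw [← (Equiv.neg ℝ).exists_congr_right]
  refine exists_congr fun u => ?_
  simp only [Equiv.neg_apply]
  refine and_congr ?_ ?_
  · constructor <;> rintro ⟨h1, h2⟩ <;> constructor <;> linarith
  · constructor <;> rintro (⟨h1, h2, h3⟩ | ⟨h1, h2, h3⟩)
    · exact .inr ⟨by linarith, by linarith, by linarith⟩
    · exact .inl ⟨by linarith, by linarith, by linarith⟩
    · exact .inr ⟨by linarith, by linarith, by linarith⟩
    · exact .inl ⟨by linarith, by linarith, by linarith⟩

/-- The sign of T and the exchange of fp and fm compensate each other. At height 0 the compensation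
is between the sign of T' and that of the difference of second derivatives. -/
lemma rightSpineValue_neg (fp fm : ℝ → ℝ) (ε : ℝ) (T : ℝ → ℝ) (u : ℝ) :
    rightSpineValue fp fm ε (fun u => -T u) u = rightSpineValue fm fp ε T u := by
  simp only [rightSpineValue, neg_eq_zero]
  split_ifs
  · rw [deriv.fun_neg, mul_neg, div_neg]
    ring
  · simp only [mul_neg, div_neg, sub_neg_eq_add, ← sub_eq_add_neg]
    ring

/-- The double sign change leaves the slope of the spine unchanged. The opposite signs of the 1/T'
terms in the two formulas are absorbed by the exchange of fp and fm. -/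
lemma leftSpineValue_neg_comp_neg (fp fm : ℝ → ℝ) (ε : ℝ) (T : ℝ → ℝ) (u : ℝ) :
    leftSpineValue fp fm ε (fun u => -T (-u)) (-u)
      = rightSpineValue (fun t => fm (-t)) (fun t => fp (-t)) ε T u := by
  simp only [rightSpineValue, leftSpineValue, neg_eq_zero, neg_neg, deriv_comp_neg,
    iteratedDeriv_comp_neg, deriv.fun_neg]
  have e1 : -u - ε = -(u + ε) := by ring
  have e2 : -u + -T u - ε = -(u + T u + ε) := by ring
  have e3 : -u - -T u - ε = -(u - T u + ε) := by ring
  rw [e1, e2, e3]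
  split_ifs
  · simp only [smul_eq_mul]
    ring
  · rw [mul_neg (2 * ε), div_neg]
    ring

lemma IsRightHerringboneFun.stripSymm_one {fp fm : ℝ → ℝ} {ε : ℝ} {T : ℝ → ℝ} {a b : ℝ}
    {B : ℝ × ℝ → ℝ} (h : IsRightHerringboneFun fm fp ε T (rightSpineValue fm fp ε T) a b B) :
    IsRightHerringboneFun fp fm ε (fun u => -T u) (rightSpineValue fp fm ε (fun u => -T u)) a b
      (B ∘ stripSymm 1) := by
  refine ⟨fun u hu => ?_, fun u hu s h1 h2 => ?_, fun u hu s h1 h2 => ?_⟩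
  · simpa [rightSpineValue_neg] using h.spine u hu
  · have := h.lower u hu (-s) (by linarith) (by linarith)
    simp only [Function.comp, stripSymm_apply, one_mul, rightSpineValue_neg, sub_neg_eq_add,
      ← sub_eq_add_neg] at this ⊢
    rw [this]
    ring
  · have := h.upper u hu (-s) (by linarith) (by linarith)
    simp only [Function.comp, stripSymm_apply, one_mul, rightSpineValue_neg, sub_neg_eq_add,
      ← sub_eq_add_neg] at this ⊢
    rw [this]
    ring

lemma IsRightHerringboneFun.stripSymm_neg_one {fp fm : ℝ → ℝ} {ε : ℝ} {T : ℝ → ℝ} {a b : ℝ}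
    {B : ℝ × ℝ → ℝ}
    (h : IsRightHerringboneFun (fun t => fm (-t)) (fun t => fp (-t)) ε T
      (rightSpineValue (fun t => fm (-t)) (fun t => fp (-t)) ε T) a b B) :
    IsLeftHerringboneFun fp fm ε (fun u => -T (-u)) (leftSpineValue fp fm ε fun u => -T (-u))
      (-b) (-a) (B ∘ stripSymm (-1)) := by
  have key : ∀ u ∈ Icc (-b) (-a), ∃ w ∈ Icc a b, u = -w := fun u hu =>
    ⟨-u, ⟨by linarith [hu.2], by linarith [hu.1]⟩, (neg_neg u).symm⟩
  refine ⟨fun u hu => ?_, fun u hu s h1 h2 => ?_, fun u hu s h1 h2 => ?_⟩ <;>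
    obtain ⟨w, hw, rfl⟩ := key u hu
  · rw [leftSpineValue_neg_comp_neg, ← h.spine w hw]
    simp
  · rw [neg_neg] at h1
    have := h.lower w hw (-s) (by linarith) (by linarith)
    rw [leftSpineValue_neg_comp_neg]
    simp only [Function.comp, stripSymm_apply, neg_neg]
    rw [show -1 * (-w + -T w - s) = w + T w - -s by ring, this,
      show -(w + T w + ε) = -w + -T w - ε by ring]
    ring
  · rw [neg_neg] at h2
    have := h.upper w hw (-s) (by linarith) (by linarith)
    rw [leftSpineValue_neg_comp_neg]
    simp only [Function.comp, stripSymm_apply, neg_neg]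
    rw [show -1 * (-w - -T w + s) = w - T w + -s by ring, this,
      show -(w - T w + ε) = -w - -T w - ε by ring]
    ring

end DiagonalStrip

/-! ### The three fissures. -/

theorem mainTheorem2 (fp fm : ℝ → ℝ) (hfp : ContDiff ℝ ∞ fp) (hfm : ContDiff ℝ ∞ fm)
    (u₀ : ℝ) (h₀ : deriv fp u₀ = deriv fm u₀) :
    -- SE-fissure
    (iteratedDeriv 2 fm u₀ < iteratedDeriv 2 fp u₀ → iteratedDeriv 3 fp u₀ < 0 →
      ∃ ε₀ : ℝ, 0 < ε₀ ∧ ∀ ε : ℝ, 0 < ε → ε < ε₀ →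
        ∃ u v : ℝ, ∃ T : ℝ → ℝ, ∃ B : ℝ × ℝ → ℝ,
          DiagonalStrip.IsUniqueRootIn
            (fun w => deriv fp (w - ε) - deriv fm (w + ε) + 2 * ε * iteratedDeriv 2 fp (w - ε))
            (u₀ - 2 * ε) u₀ u ∧
          u₀ + ε < v ∧
          DiagonalStrip.IsSpine ε T (u - ε) (v - ε) ∧
          T (u₀ - ε) = 0 ∧ T (u - ε) = ε ∧ T (v - ε) = -ε ∧
          DiagonalStrip.IsRightHerringboneFun fp fm ε T
            (DiagonalStrip.rightSpineValue fp fm ε T) (u - ε) (v - ε) B ∧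
          DiagonalStrip.IsBellmanCandidate fp fm ε
            (DiagonalStrip.rightHerringboneRegion ε T (u - ε) (v - ε)) B ∧
          ∃ δ : ℝ, 0 < δ ∧
            DiagonalStrip.IsC1Gluing fp fm ε
              (DiagonalStrip.rightHerringboneRegion ε T (u - ε) (v - ε)) B
              (u - δ) u v (v + δ)) ∧
    -- NW-fissure
    (iteratedDeriv 2 fp u₀ < iteratedDeriv 2 fm u₀ → 0 < iteratedDeriv 3 fm u₀ →
      ∃ ε₀ : ℝ, 0 < ε₀ ∧ ∀ ε : ℝ, 0 < ε → ε < ε₀ →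
        ∃ u v : ℝ, ∃ T : ℝ → ℝ, ∃ B : ℝ × ℝ → ℝ,
          DiagonalStrip.IsUniqueRootIn
            (fun w => deriv fm (w + ε) - deriv fp (w - ε) - 2 * ε * iteratedDeriv 2 fm (w + ε))
            u₀ (u₀ + 2 * ε) u ∧
          v < u₀ - ε ∧
          DiagonalStrip.IsSpine ε T (v + ε) (u + ε) ∧
          T (u₀ + ε) = 0 ∧ T (u + ε) = -ε ∧ T (v + ε) = ε ∧
          DiagonalStrip.IsLeftHerringboneFun fp fm ε T
            (DiagonalStrip.leftSpineValue fp fm ε T) (v + ε) (u + ε) B ∧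
          DiagonalStrip.IsBellmanCandidate fp fm ε
            (DiagonalStrip.leftHerringboneRegion ε T (v + ε) (u + ε)) B ∧
          ∃ δ : ℝ, 0 < δ ∧
            DiagonalStrip.IsC1Gluing fp fm ε
              (DiagonalStrip.leftHerringboneRegion ε T (v + ε) (u + ε)) B
              u (u + δ) (v - δ) v) ∧
    -- NE-fissure
    (iteratedDeriv 2 fp u₀ < iteratedDeriv 2 fm u₀ → iteratedDeriv 3 fm u₀ < 0 →
      ∃ ε₀ : ℝ, 0 < ε₀ ∧ ∀ ε : ℝ, 0 < ε → ε < ε₀ →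
        ∃ u v : ℝ, ∃ T : ℝ → ℝ, ∃ B : ℝ × ℝ → ℝ,
          DiagonalStrip.IsUniqueRootIn
            (fun w => deriv fm (w - ε) - deriv fp (w + ε) + 2 * ε * iteratedDeriv 2 fm (w - ε))
            (u₀ - 2 * ε) u₀ u ∧
          u₀ + ε < v ∧
          DiagonalStrip.IsSpine ε T (u - ε) (v - ε) ∧
          T (u₀ - ε) = 0 ∧ T (u - ε) = -ε ∧ T (v - ε) = ε ∧
          DiagonalStrip.IsRightHerringboneFun fp fm ε T
            (DiagonalStrip.rightSpineValue fp fm ε T) (u - ε) (v - ε) B ∧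
          DiagonalStrip.IsBellmanCandidate fp fm ε
            (DiagonalStrip.rightHerringboneRegion ε T (u - ε) (v - ε)) B ∧
          ∃ δ : ℝ, 0 < δ ∧
            DiagonalStrip.IsC1Gluing fp fm ε
              (DiagonalStrip.rightHerringboneRegion ε T (u - ε) (v - ε)) B
              v (v + δ) (u - δ) u) := by
  refine ⟨DiagonalStrip.exists_southeast_fissure hfp hfm h₀, fun h₁ h₂ => ?_, fun h₁ h₂ => ?_⟩
  · have d1 : ∀ f : ℝ → ℝ, deriv (fun t => f (-t)) = fun t => -deriv f (-t) := fun f =>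
      funext fun t => deriv_comp_neg f t
    have d2 : ∀ f : ℝ → ℝ, iteratedDeriv 2 (fun t => f (-t)) = fun t => iteratedDeriv 2 f (-t) :=
      fun f => funext fun t => by rw [iteratedDeriv_comp_neg]; norm_num
    -- North-west is south-east reflected in the origin. Composition with t ↦ −t preserves second
    -- derivatives and reverses third ones, which turns f₋''' > 0 into the sign needed.
    obtain ⟨ε₀, hε₀, H⟩ := DiagonalStrip.exists_southeast_fissure (u₀ := -u₀)
      (hfm.comp contDiff_neg) (hfp.comp contDiff_neg)
      (by simpa only [Function.comp_def, d1, neg_neg, neg_inj] using h₀.symm)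
      (by simpa only [Function.comp_def, d2, neg_neg] using h₁)
      (by
        simp only [Function.comp_def, iteratedDeriv_comp_neg, neg_neg, smul_eq_mul]
        linarith)
    simp only [Function.comp_def] at H
    refine ⟨ε₀, hε₀, fun ε hε hεε => ?_⟩
    obtain ⟨u, v, T, B, ⟨⟨hu, hFu⟩, hroot⟩, hv, hT, hT0, hTu, hTv, hB, hB', δ, hδ, hglue⟩ :=
      H ε hε hεε
    simp only [d1, d2] at hFu hroot
    have hreg := DiagonalStrip.rightHerringboneRegion_stripSymm_neg_one ε T (u - ε) (v - ε)
    have eu : -u + ε = -(u - ε) := by ring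
    have ev : -v + ε = -(v - ε) := by ring
    refine ⟨-u, -v, fun x => -T (-x), B ∘ DiagonalStrip.stripSymm (-1),
      ⟨⟨⟨by linarith [hu.2], by linarith [hu.1]⟩, ?_⟩, fun w hw hFw => ?_⟩,
      by linarith, ?_, ?_, ?_, ?_, ?_, ?_, δ, hδ, ?_⟩
    · simp only
      rw [show -u + ε = -(u - ε) by ring, show -u - ε = -(u + ε) by ring]
      linarith
    · rw [← hroot (-w) ⟨by linarith [hw.2], by linarith [hw.1]⟩ ?_, neg_neg]
      simp only at hFw
      rw [show -(-w - ε) = w + ε by ring, show -(-w + ε) = w - ε by ring]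
      linarith
    · rw [eu, ev]
      exact hT.neg.comp_neg
    · simp only
      rw [show -(u₀ + ε) = -u₀ - ε by ring, hT0, neg_zero]
    · simp only
      rw [eu, neg_neg, hTu]
    · simp only
      rw [ev, neg_neg, hTv, neg_neg]
    · rw [eu, ev]
      exact hB.stripSymm_neg_one
    · rw [eu, ev, ← hreg]
      exact hB'.stripSymm (.inr rfl) (fun t => by simp) fun t => by simp
    · rw [eu, ev, ← hreg, show -u + δ = -(u - δ) by ring, show -v - δ = -(v + δ) by ring]
      exact hglue.stripSymm_neg_one
  -- North-east is south-east reflected in the horizontal axis: fp and fm are exchanged and T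
  -- changes sign.
  · obtain ⟨ε₀, hε₀, H⟩ := DiagonalStrip.exists_southeast_fissure hfm hfp h₀.symm h₁ h₂
    refine ⟨ε₀, hε₀, fun ε hε hεε => ?_⟩
    obtain ⟨u, v, T, B, hu, hv, hT, hT0, hTu, hTv, hB, hB', δ, hδ, hglue⟩ := H ε hε hεε
    have hreg := DiagonalStrip.rightHerringboneRegion_stripSymm_one ε T (u - ε) (v - ε)
    refine ⟨u, v, fun x => -T x, B ∘ DiagonalStrip.stripSymm 1, hu, hv, hT.neg,
      neg_eq_zero.2 hT0, congrArg Neg.neg hTu, neg_eq_iff_eq_neg.2 hTv, hB.stripSymm_one, ?_,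
      δ, hδ, ?_⟩
    · rw [← hreg]
      exact hB'.stripSymm (.inl rfl) (fun t => by rw [one_mul]) fun t => by rw [one_mul]
    · rw [← hreg]
      exact hglue.stripSymm_one
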